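/- **Setting.** For a finite set $U$ (the universe), let $\mathcal R(U)$ be the smallest family of sets that contains $U$ and is closed under subsets and finite Cartesian products. A *combinatorial decision problem* $P_A$ is a set of instances $R=(U,R^2,\dots,R^r)$ with finite relations $R^i\in\mathcal R(U)$, together with, for every instance $R$, a set $F(R)$ of feasible solutions, each of which is a finite tuple of finite relations from $\mathcal R(U)$. Its formal language is the set of all $R$ with $F(R)\neq\emptyset$. We write $P_A\in\mathrm{NP}$ if the feasible solutions are NP-certificates: it is decidable in polynomial time, given (encodings by lists of) $R$ and $s$, whether $R$ is an instance and $s\in F(R)$, and every $s\in F(R)$ has an encoding of length polynomial in the length of the encoding of $R$. (In particular the formal language of $P_A$ is then in NP.) The *combinatorial elements* of $R$ are the universe elements and the elements of the relations $R^i$. For a set $A$ of combinatorial elements (the *active* ones), $R|_A$ is obtained from $R$ by discarding every combinatorial element not in $A$ together with all relation elements in which a discarded element occurs. For solutions $s,t$ let $H(s,t)$ be the size of the symmetric difference of the sets of universe elements occurring in $s$ and in $t$. **Recoverable robust version.** An input consists of a tuple of relations $R$, a set $A_0$ of combinatorial elements of $R$ that are active in the base scenario, a bound $\kappa\in\mathbb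 N$ (in binary), and a scenario encoding of one of the following two types, whose sets are pairwise disjoint sets of combinatorial elements of $R$: * *$xor$-dependencies*: $(E',\{(E_{1,1},E_{1,2}),\dots,(E_{n,1},E_{n,2})\})$, which encodes the scenarios $\sigma=E'\cup E_1\cup\dots\cup E_n$ with $E_i\in\{E_{i,1},E_{i,2}\}$ for all $i$; the dependencies are listed one by one, so that $n$ is at most linear in the input length; * *$\Gamma$-set scenarios*: $(E',\{E_1,\dots,E_n\})$ and $\Gamma\in\mathbb N$ (in binary), which encodes the scenarios $\sigma=E'\cup\bigcup_{i\in I}E_i$ with $I\subseteq\{1,\dots,n\}$, $|I|\le\Gamma$. Let $C_\sigma$ be the union of the selected sets and $T$ the union of all sets $E_{i,j}$ (respectively $E_i$). The set $A_\sigma$ of active elements in scenario $\sigma$ is determined by one of three conventions, fixed in advance: (explicit) $A_\sigma=\sigma$; (implicit) $\sigma$ lists the changes, $A_\sigma=A_0\mathbin{\triangle}\sigma$; (mixed) the elements of $E'$ change their status and the uncertain sets are active iff selected, $A_\sigma=((A_0\mathbin{\triangle}E')\setminus T)\cup C_\sigma$. The input is a yes-instance iff there are solutions $s_0\in F(R|_{A_0})$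 and $s_\sigma\in F(R|_{A_\sigma})$ for all scenarios $\sigma$ with $H(s_0,s_\sigma)\le\kappa$ for all $\sigma$ (in particular, $R|_{A_0}$ and all $R|_{A_\sigma}$ have to be instances of $P_A$). **Theorem.** Let $P_A\in\mathrm{NP}$. Then, under each of the three conventions, the Hamming distance recoverable robust version of $P_A$ with a linear number of $xor$-dependencies and the one with $\Gamma$-set scenarios are both in $\Sigma^p_3$. That is, for the language $L$ of encodings of yes-instances there are a polynomial $p$ and a predicate $V$ that is decidable in polynomial time on a Turing machine, such that for every word $x$ $$x\in L\iff \exists u_1\;\forall u_2\;\exists u_3:\ V(x,u_1,u_2,u_3),$$ where $u_1,u_2,u_3$ range over the words of length at most $p(|x|)$. -/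

import Mathlib

namespace HDRR

open Computability (Γ')

/-! ### Polynomial time, NP and the third level of the polynomial hierarchy

Words are lists over the finite alphabet `Γ'` (bits, brackets, comma, blank). The machine model is
the multi-stack Turing machine `Turing.FinTM2` of Mathlib. -/

/-- A finite sequence of words, written with an end marker after each word. -/
def encodeWords (ws : List (List Γ')) : List (Option Γ') :=
  ws.flatMap fun w => w.map some ++ [none]

/-- A predicate on finite sequences of words that is decided by a Turing machine whose running time
is bounded by a polynomial in the total length of the input. -/
def PolyTimeDecidable (V : List (List Γ') → Bool) : Prop :=
  Nonempty (Turing.TM2ComputableInPolyTime encodeWords Computability.encodeBool V)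

/-- `NP`: languages with a polynomial-time verifier for certificates of polynomial length. -/
def InNP (L : Set (List Γ')) : Prop :=
  ∃ (p : Polynomial ℕ) (V : List (List Γ') → Bool), PolyTimeDecidable V ∧
    ∀ x, x ∈ L ↔ ∃ u, u.length ≤ p.eval x.length ∧ V [x, u] = true

/-- `Σ₃ᵖ`: languages with a polynomial-time `∃∀∃` verifier, all three quantifiers ranging over words
of polynomial length. -/
def InSigmaP3 (L : Set (List Γ')) : Prop :=
  ∃ (p : Polynomial ℕ) (V : List (List Γ') → Bool), PolyTimeDecidable V ∧
    ∀ x, x ∈ L ↔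
      ∃ u₁, u₁.length ≤ p.eval x.length ∧
        ∀ u₂, u₂.length ≤ p.eval x.length →
          ∃ u₃, u₃.length ≤ p.eval x.length ∧ V [x, u₁, u₂, u₃] = true

/-! ### Combinatorial elements and relations -/

/-- Universe elements, named by binary strings. -/
abbrev Atom := List Bool

/-- The objects that relations over a universe are made of: universe elements and (nested) tuples
of such objects. -/
inductive Elem : Type
  | atom (a : Atom) : Elem
  | tuple (l : List Elem) : Elem

noncomputable instance : DecidableEq Elem := Classical.decEq _

/-- `x.Occurs e`: `x` is `e` itself or occurs, at any depth, in the tuple `e`. -/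
inductive Elem.Occurs (x : Elem) : Elem → Prop
  | refl : Elem.Occurs x x
  | comp {e : Elem} {l : List Elem} : e ∈ l → Elem.Occurs x e → Elem.Occurs x (Elem.tuple l)

/-- The family `𝓡(U)` of all relations over `U`: the smallest family that contains `U` and is closed
under subsets and finite Cartesian products. -/
inductive IsRelationOver (U : Finset Atom) : Set Elem → Prop
  | univ : IsRelationOver U {e | ∃ a ∈ U, e = Elem.atom a}
  | subset {A B : Set Elem} : IsRelationOver U B → A ⊆ B → IsRelationOver U A
  | prod (As : List (Set Elem)) : (∀ A ∈ As, IsRelationOver U A) →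
      IsRelationOver U {e | ∃ l, e = Elem.tuple l ∧ List.Forall₂ (fun x A => x ∈ A) l As}

/-- A tuple `R = (U, R², …, Rʳ)` of a universe and further finite relations. -/
structure RelTuple where
  univ : Finset Atom
  rels : List (Finset Elem)

/-- Every `Rⁱ` belongs to `𝓡(U)`. -/
def RelTuple.IsValid (R : RelTuple) : Prop :=
  ∀ A ∈ R.rels, IsRelationOver R.univ (A : Set Elem)

/-- The combinatorial elements of `R`: its universe elements and its relation elements. -/
noncomputable def RelTuple.elements (R : RelTuple) : Finset Elem :=
  R.univ.image Elem.atom ∪ R.rels.foldr (· ∪ ·) ∅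

open Classical in
/-- The part of `R` that remains when exactly the combinatorial elements in `A` are active: an
inactive combinatorial element is discarded, together with every relation element in which it
occurs. -/
noncomputable def RelTuple.restrict (R : RelTuple) (A : Finset Elem) : RelTuple where
  univ := R.univ.filter fun a => Elem.atom a ∈ A
  rels := R.rels.map fun B =>
    B.filter fun e => ∀ x : Elem, x.Occurs e → x ∈ R.elements → x ∈ A

/-- A solution is a tuple of finite relations. -/
abbrev Solution := List (Finset Elem)

/-- The universe elements that occur in a solution. -/
def Solution.atoms (s : Solution) : Set Atom :=
  {a | ∃ A ∈ s, ∃ e ∈ A, (Elem.atom a).Occurs e}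

/-- The Hamming distance `|s △ t|` of two solutions, taken over their universe elements. -/
noncomputable def hammingDist (s t : Solution) : ℕ∞ :=
  (symmDiff (Solution.atoms s) (Solution.atoms t)).encard

/-- A combinatorial decision problem: a set of tuples `(U, R, F(R))`, where `R` is a tuple of
relations over `U` and each feasible solution in `F(R)` is a tuple of relations over `U`. -/
structure CombProblem where
  IsInstance : RelTuple → Prop
  feasible : RelTuple → Set Solution
  valid_of_isInstance : ∀ R, IsInstance R → R.IsValid
  feasible_isRelationOver : ∀ R, IsInstance R → ∀ s ∈ feasible R, ∀ A ∈ s,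
    IsRelationOver R.univ (A : Set Elem)

/-- `R` is an instance of `P` and `s ∈ F(R)`. -/
def CombProblem.IsSolution (P : CombProblem) (R : RelTuple) (s : Solution) : Prop :=
  P.IsInstance R ∧ s ∈ P.feasible R

/-! ### Encodings as words -/

mutual
/-- A universe element is written as its name followed by a comma, a tuple as the bracketed
sequence of its components. -/
def Elem.encode : Elem → List Γ'
  | Elem.atom a => a.map Γ'.bit ++ [Γ'.comma]
  | Elem.tuple l => Γ'.bra :: (Elem.encodeList l ++ [Γ'.ket])
/-- The concatenation of the codes of the members of a list. -/
def Elem.encodeList : List Elem → List Γ'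
  | [] => []
  | e :: l => Elem.encode e ++ Elem.encodeList l
end

/-- A natural number, in binary. -/
def Elem.ofNat (n : ℕ) : Elem := Elem.atom (Computability.encodeNat n)

/-- `t` lists the elements of the finite set `A`, in some order. -/
def ListsSet (t : Elem) (A : Finset Elem) : Prop :=
  ∃ l : List Elem, t = Elem.tuple l ∧ ∀ e, e ∈ l ↔ e ∈ A

/-- `t` lists the members of `As`, each of them given by a list of its elements. -/
def ListsSets (t : Elem) (As : List (Finset Elem)) : Prop :=
  ∃ l : List Elem, t = Elem.tuple l ∧ List.Forall₂ ListsSet l As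

/-- `t` describes the tuple of relations `R`. -/
def Describes (t : Elem) (R : RelTuple) : Prop :=
  ∃ u r, t = Elem.tuple [u, r] ∧ ListsSet u (R.univ.image Elem.atom) ∧ ListsSets r R.rels

/-- The word `w` is an encoding of the tuple of relations `R`. -/
def EncodesRel (w : List Γ') (R : RelTuple) : Prop := ∃ t, w = Elem.encode t ∧ Describes t R

/-- The word `w` is an encoding of the solution `s`. -/
def EncodesSol (w : List Γ') (s : Solution) : Prop := ∃ t, w = Elem.encode t ∧ ListsSets t s

/-- The formal language of `P`: the encodings of the instances `R` with `F(R) ≠ ∅`. -/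
def CombProblem.language (P : CombProblem) : Set (List Γ') :=
  {w | ∃ R, EncodesRel w R ∧ P.IsInstance R ∧ (P.feasible R).Nonempty}

/-- `P ∈ NP` for a combinatorial decision problem, with the feasible solutions as certificates: it is
decidable in polynomial time whether `s ∈ F(R)`, and feasible solutions have polynomial length. -/
def CombProblem.InNP (P : CombProblem) : Prop :=
  ∃ (p : Polynomial ℕ) (V : List (List Γ') → Bool), PolyTimeDecidable V ∧
    (∀ x z, V [x, z] = true ↔
      ∃ R s, EncodesRel x R ∧ EncodesSol z s ∧ P.IsSolution R s) ∧
    ∀ x R s, EncodesRel x R → P.IsSolution R s →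
      ∃ z, EncodesSol z s ∧ z.length ≤ p.eval x.length

/-- A problem that is in `NP` in this sense has its formal language in `NP`. -/
theorem CombProblem.InNP.language {P : CombProblem} (h : P.InNP) : HDRR.InNP P.language := by
  obtain ⟨p, V, hV, hdec, hlen⟩ := h
  refine ⟨p, V, hV, fun x => ⟨?_, ?_⟩⟩
  · rintro ⟨R, hR, hI, s, hs⟩
    obtain ⟨z, hz, hle⟩ := hlen x R s hR ⟨hI, hs⟩
    exact ⟨z, hle, (hdec x z).2 ⟨R, s, hR, hz, hI, hs⟩⟩
  · rintro ⟨z, -, hz⟩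
    obtain ⟨R, s, hR, -, hI, hs⟩ := (hdec x z).1 hz
    exact ⟨R, hR, hI, s, hs⟩

/-! ### Scenarios -/

/-- The ways in which the sets of a succinct scenario encoding may act on the active elements `A₀`
of the base scenario. -/
inductive Mode
  | explicit
  | implicit
  | mixed

/-- The active elements of the recovery scenario `σ = E' ∪ C`, where `E'` is the fixed set of the
encoding, `C` the union of the selected uncertain sets and `T` the union of all uncertain sets.

* `explicit`: `σ` is the set of active elements.
* `implicit`: `σ` is the set of elements whose status differs from that in the base scenario.
* `mixed`: the elements of `E'` are deactivated if they are active in the base scenario and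
  activated otherwise; an element of an uncertain set is active iff that set is selected; all other
  elements keep their status. -/
noncomputable def Mode.active (m : Mode) (A₀ E' T C : Finset Elem) : Finset Elem :=
  match m with
  | Mode.explicit => E' ∪ C
  | Mode.implicit => symmDiff A₀ (E' ∪ C)
  | Mode.mixed => (symmDiff A₀ E' \ T) ∪ C

/-- The union of a list of finite sets. -/
noncomputable def unionAll (Es : List (Finset Elem)) : Finset Elem := Es.foldr (· ∪ ·) ∅

/-- Input of the recoverable robust problem with `xor`-dependencies: all combinatorial elements
`ground` that may occur, the active elements `base` of the base scenario, the scenario encoding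
`(E', {(E₁₁, E₁₂), …, (Eₙ₁, Eₙ₂)})` and the bound `κ`. -/
structure XorInput where
  ground : RelTuple
  base : Finset Elem
  fixed : Finset Elem
  deps : List (Finset Elem × Finset Elem)
  kappa : ℕ

/-- All sets `Eᵢⱼ`. -/
def XorInput.uncertain (X : XorInput) : List (Finset Elem) := X.deps.flatMap fun d => [d.1, d.2]

/-- All sets consist of combinatorial elements, and `E'` and the `Eᵢⱼ` are pairwise disjoint. -/
def XorInput.WellFormed (X : XorInput) : Prop :=
  X.base ⊆ X.ground.elements ∧ (∀ E ∈ X.fixed :: X.uncertain, E ⊆ X.ground.elements) ∧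
    (X.fixed :: X.uncertain).Pairwise Disjoint

/-- The sets of active elements of the recovery scenarios: one of `Eᵢ₁`, `Eᵢ₂` is selected for
each `i`. -/
def XorInput.scenarios (X : XorInput) (m : Mode) : Set (Finset Elem) :=
  {A | ∃ Es : List (Finset Elem), List.Forall₂ (fun E d => E = d.1 ∨ E = d.2) Es X.deps ∧
    A = m.active X.base X.fixed (unionAll X.uncertain) (unionAll Es)}

/-- The dependencies are listed one by one. -/
def XorInput.Encoded (w : List Γ') (X : XorInput) : Prop :=
  ∃ g b f l, w = Elem.encode (Elem.tuple [g, b, f, Elem.tuple l, Elem.ofNat X.kappa]) ∧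
    Describes g X.ground ∧ ListsSet b X.base ∧ ListsSet f X.fixed ∧
    List.Forall₂ (fun t d => ListsSets t [d.1, d.2]) l X.deps

/-- Each component of a list contributes to the length of its code. -/
theorem Elem.length_le_encodeList (l : List Elem) : l.length ≤ (Elem.encodeList l).length := by
  induction l with
  | nil => simp [Elem.encodeList]
  | cons e l ih =>
    have h : 1 ≤ (Elem.encode e).length := by cases e <;> simp [Elem.encode]
    simp only [Elem.encodeList, List.length_cons, List.length_append]
    omega

/-- The number of `xor`-dependencies is at most linear in the length of the input. -/
theorem XorInput.length_deps_le {w : List Γ'} {X : XorInput} (h : X.Encoded w) :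
    X.deps.length ≤ w.length := by
  obtain ⟨g, b, f, l, rfl, -, -, -, hl⟩ := h
  have h1 := Elem.length_le_encodeList l
  rw [← hl.length_eq]
  simp only [Elem.encode, Elem.encodeList, List.length_cons, List.length_append]
  omega

/-- Input of the recoverable robust problem with `Γ`-set scenarios: as above, with the scenario
encoding `(E', {E₁, …, Eₙ})` and the number `Γ`. -/
structure GammaInput where
  ground : RelTuple
  base : Finset Elem
  fixed : Finset Elem
  uncertain : List (Finset Elem)
  gamma : ℕ
  kappa : ℕ

/-- All sets consist of combinatorial elements, and `E'` and the `Eᵢ` are pairwise disjoint. -/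
def GammaInput.WellFormed (X : GammaInput) : Prop :=
  X.base ⊆ X.ground.elements ∧ (∀ E ∈ X.fixed :: X.uncertain, E ⊆ X.ground.elements) ∧
    (X.fixed :: X.uncertain).Pairwise Disjoint

/-- The sets of active elements of the recovery scenarios: at most `Γ` of the `Eᵢ` are selected. -/
def GammaInput.scenarios (X : GammaInput) (m : Mode) : Set (Finset Elem) :=
  {A | ∃ Es : List (Finset Elem), Es.Sublist X.uncertain ∧ Es.length ≤ X.gamma ∧
    A = m.active X.base X.fixed (unionAll X.uncertain) (unionAll Es)}

def GammaInput.Encoded (w : List Γ') (X : GammaInput) : Prop :=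
  ∃ g b f u, w = Elem.encode
      (Elem.tuple [g, b, f, u, Elem.ofNat X.gamma, Elem.ofNat X.kappa]) ∧
    Describes g X.ground ∧ ListsSet b X.base ∧ ListsSet f X.fixed ∧ ListsSets u X.uncertain

/-! ### Hamming distance recoverable robust problems -/

/-- There are feasible solutions `s₀` of the base scenario and `s A` of all recovery scenarios `A`
with `H(s₀, s A) ≤ κ`. In particular all scenarios are instances of `P`. -/
def CombProblem.Recoverable (P : CombProblem) (ground : RelTuple) (base : Finset Elem)
    (scen : Set (Finset Elem)) (κ : ℕ) : Prop :=
  ∃ (s₀ : Solution) (s : scen → Solution), P.IsSolution (ground.restrict base) s₀ ∧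
    ∀ A : scen, P.IsSolution (ground.restrict A) (s A) ∧ hammingDist s₀ (s A) ≤ κ

/-- The language of the Hamming distance recoverable robust version of `P` with
`xor`-dependencies. -/
def CombProblem.xorLanguage (P : CombProblem) (m : Mode) : Set (List Γ') :=
  {w | ∃ X : XorInput, X.Encoded w ∧ X.WellFormed ∧
    P.Recoverable X.ground X.base (X.scenarios m) X.kappa}

/-- The language of the Hamming distance recoverable robust version of `P` with `Γ`-set
scenarios. -/
def CombProblem.gammaLanguage (P : CombProblem) (m : Mode) : Set (List Γ') :=
  {w | ∃ X : GammaInput, X.Encoded w ∧ X.WellFormed ∧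
    P.Recoverable X.ground X.base (X.scenarios m) X.kappa}

end HDRR

namespace HDRR

open Computability (Γ')

/-! ### Structured stack programs and their compilation to Turing machines -/

-- The quantifier pattern is that of the problem itself. Guess an encoding of a base solution `s₀`;
-- then, for every scenario, guess an encoding of a recovery solution and check its distance to
-- `s₀`. Given `s₀`, the solution of each scenario can be chosen independently
-- (`CombProblem.recoverable_iff`), so the definition becomes ∃∀∃. All three words are short.
-- Restricting an instance only deletes entries from its description (`length_encode_restrict`), so
-- the bound for certificates of `P` applies to every scenario. A scenario is a word with one symbol
-- per dependency or uncertain set, and longer words can be truncated (`select_take`). The number of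
-- scenarios may be exponential, but none is ever listed.
--
-- The verifier tests that the input is well formed, restricts the instance to the base scenario and
-- to the selected one, and asks the given verifier of `P` about both. It then counts the universe
-- elements occurring in exactly one of the two solutions. Only atoms of the universe occur in
-- feasible solutions (`mem_of_isRelationOver`), so the count runs over the listed universe
-- (`hammingDist_setsOf`). It is compared with the binary number `κ` by repeated halving
-- (`lengthLe_iff`). Correctness is `Format.verify_iff`, and `Format.inSigmaP3` gives membership for
-- both scenario encodings at once through the structure `Format`.
--
-- Most of the work is to show that this verifier runs in polynomial time on a Turing machine.
-- Structured stack programs compile step by step to machines (`Cmd.Runs.simulate`). Data are binary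
-- trees in Polish notation, and `PT M f` says that a program which may run the fixed machine `M`
-- computes `f` in polynomial time with output of polynomial size. This class is closed under
-- composition, pairing, branching (`PT.comp`, `PT.pair`, `PT.cond`), folds with bounded
-- intermediate results (`PT.foldl`) and tree recursion (`PT.datFold`), and it contains the
-- predicate decided by `M` (`PT.call`). The verifier is assembled from these closure properties
-- with `M` the machine for `P`, and `PT.polyTimeDecidable'` turns it into a single machine.

/-- Structured programs over finitely many stacks and a finite register. -/
inductive Cmd (K : Type) (Γ : K → Type) (σ : Type) : Type
  | push (k : K) (f : σ → Γ k) : Cmd K Γ σ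
  | peek (k : K) (f : σ → Option (Γ k) → σ) : Cmd K Γ σ
  | pop (k : K) (f : σ → Option (Γ k) → σ) : Cmd K Γ σ
  | load (f : σ → σ) : Cmd K Γ σ
  | seq (a b : Cmd K Γ σ) : Cmd K Γ σ
  | case (f : σ → Cmd K Γ σ) : Cmd K Γ σ
  | loop (g : σ → Bool) (a : Cmd K Γ σ) : Cmd K Γ σ

namespace Cmd

variable {K : Type} {Γ : K → Type} {σ : Type}

/-- Big-step semantics: started with register `v` and stacks `S`, the program terminates after `n`
steps with register `v'` and stacks `S'`. -/
inductive Runs [DecidableEq K] :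
    Cmd K Γ σ → σ → (∀ k, List (Γ k)) → σ → (∀ k, List (Γ k)) → ℕ → Prop
  | push {k f v S} : Runs (push k f) v S v (Function.update S k (f v :: S k)) 1
  | peek {k f v S} : Runs (peek k f) v S (f v (S k).head?) S 1
  | pop {k f v S} : Runs (pop k f) v S (f v (S k).head?) (Function.update S k (S k).tail) 1
  | load {f v S} : Runs (load f) v S (f v) S 1
  | seq {a b v₁ S₁ v₂ S₂ v₃ S₃ m n} : Runs a v₁ S₁ v₂ S₂ m → Runs b v₂ S₂ v₃ S₃ n →
      Runs (seq a b) v₁ S₁ v₃ S₃ (n + m + 1)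
  | case {f v S v' S' n} : Runs (f v) v S v' S' n → Runs (case f) v S v' S' (n + 1)
  | loop_false {g a v S} : g v = false → Runs (loop g a) v S v S 1
  | loop_true {g a v₁ S₁ v₂ S₂ v₃ S₃ m n} : g v₁ = true → Runs a v₁ S₁ v₂ S₂ m →
      Runs (loop g a) v₂ S₂ v₃ S₃ n → Runs (loop g a) v₁ S₁ v₃ S₃ (n + m + 1)

/-- The continuations that occur while `c` runs, followed by the continuation `k`. -/
def labels : Cmd K Γ σ → List (Cmd K Γ σ) → Set (List (Cmd K Γ σ))
  | push s f, k => {push s f :: k}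
  | peek s f, k => {peek s f :: k}
  | pop s f, k => {pop s f :: k}
  | load f, k => {load f :: k}
  | seq a b, k => {seq a b :: k} ∪ labels a (b :: k) ∪ labels b k
  | case f, k => {case f :: k} ∪ ⋃ v, labels (f v) k
  | loop g a, k => {loop g a :: k} ∪ labels a (loop g a :: k)

/-- A loop body continues with the loop itself, which is already a label, so loops are never
unfolded; a `case` contributes one family per register value, and there are finitely many. -/
theorem finite_labels [Finite σ] (c : Cmd K Γ σ) (k : List (Cmd K Γ σ)) : (labels c k).Finite := by
  induction c generalizing k with
  | seq a b iha ihb => exact ((Set.finite_singleton _).union (iha _)).union (ihb _)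
  | case f ih => exact (Set.finite_singleton _).union (Set.finite_iUnion fun v => ih v _)
  | loop g a ih => exact (Set.finite_singleton _).union (ih _)
  | _ => exact Set.finite_singleton _

theorem cons_mem_labels (c : Cmd K Γ σ) (k : List (Cmd K Γ σ)) : c :: k ∈ labels c k := by
  cases c <;> simp [labels]

/-- One statement per continuation; `norm` names the continuations. -/
def stmt {Λ : Type} (norm : List (Cmd K Γ σ) → Λ) : List (Cmd K Γ σ) → Turing.TM2.Stmt Γ Λ σ
  | [] => .halt
  | push s f :: k => .push s f (.goto fun _ => norm k)
  | peek s f :: k => .peek s f (.goto fun _ => norm k)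
  | pop s f :: k => .pop s f (.goto fun _ => norm k)
  | load f :: k => .load f (.goto fun _ => norm k)
  | seq a b :: k => .goto fun _ => norm (a :: b :: k)
  | case f :: k => .goto fun v => norm (f v :: k)
  | loop g a :: k => .goto fun v => norm (bif g v then a :: loop g a :: k else k)

theorem iterate_bind_add {α : Type} {f : α → Option α} {m n : ℕ} {a b c : Option α}
    (h₁ : (flip bind f)^[m] a = b) (h₂ : (flip bind f)^[n] b = c) :
    (flip bind f)^[n + m] a = c := by
  rw [Function.iterate_add_apply, h₁, h₂]

/-- Induction on the run. On labels in `L` the machine executes `stmt`, which performs one stack or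
register operation or rearranges the continuation, in one step; the counts in `Runs` are therefore
exact. The continuation `k` stays arbitrary because subprograms run in front of what remains. -/
theorem Runs.simulate [DecidableEq K] {Λ : Type} (norm : List (Cmd K Γ σ) → Λ)
    (L : Set (List (Cmd K Γ σ))) (M : Λ → Turing.TM2.Stmt Γ Λ σ)
    (hM : ∀ l ∈ L, M (norm l) = stmt norm l) {c : Cmd K Γ σ} {v S v' S' n}
    (h : Runs c v S v' S' n) (k : List (Cmd K Γ σ)) (hk : labels c k ⊆ L) :
    (flip bind (Turing.TM2.step M))^[n] (some ⟨some (norm (c :: k)), v, S⟩) =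
      some ⟨some (norm k), v', S'⟩ := by
  have one : ∀ (c : Cmd K Γ σ) (k v S), labels c k ⊆ L →
      (flip bind (Turing.TM2.step M))^[1] (some ⟨some (norm (c :: k)), v, S⟩) =
        some (Turing.TM2.stepAux (stmt norm (c :: k)) v S) := by
    intro c k v S h
    simp [flip, hM _ (h (cons_mem_labels c k))]
  induction h generalizing k with
  | seq h₁ h₂ ih₁ ih₂ =>
    refine iterate_bind_add (one _ _ _ _ hk) (iterate_bind_add (ih₁ _ ?_) (ih₂ _ ?_))
    · exact fun x hx => hk (Or.inl (Or.inr hx))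
    · exact fun x hx => hk (Or.inr hx)
  | case h ih =>
    refine iterate_bind_add (one _ _ _ _ hk) (ih _ ?_)
    exact fun x hx => hk (Or.inr (Set.mem_iUnion.2 ⟨_, hx⟩))
  | loop_false hg =>
    rw [one _ _ _ _ hk]; simp [stmt, hg]
  | loop_true hg h₁ h₂ ih₁ ih₂ =>
    refine iterate_bind_add (one _ _ _ _ hk) (iterate_bind_add (b := some ⟨some _, _, _⟩) ?_ (ih₂ _ hk))
    have := ih₁ _ (fun x hx => hk (Or.inr hx))
    simpa [stmt, hg] using this
  | _ => rw [one _ _ _ _ hk]; simp [stmt]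

section compile

/-- The continuations of a whole program, including the empty one. -/
def allLabels (c : Cmd K Γ σ) : Set (List (Cmd K Γ σ)) := insert [] (labels c [])

noncomputable instance [Finite σ] (c : Cmd K Γ σ) : Fintype (allLabels c) :=
  ((finite_labels c []).insert _).fintype

open Classical in
/-- The continuation `l` as a label. -/
noncomputable def toLabel (c : Cmd K Γ σ) (l : List (Cmd K Γ σ)) : allLabels c :=
  if h : l ∈ allLabels c then ⟨l, h⟩ else ⟨[], Or.inl rfl⟩

variable [DecidableEq K] [Fintype K] [Fintype σ]

/-- The Turing machine that executes a program. -/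
noncomputable def toFinTM2 (c : Cmd K Γ σ) (k₀ k₁ : K) [Fintype (Γ k₀)] (v₀ : σ) :
    Turing.FinTM2 where
  K := K
  k₀ := k₀
  k₁ := k₁
  Γ := Γ
  Λ := allLabels c
  main := toLabel c [c]
  σ := σ
  initialState := v₀
  m l := stmt (toLabel c) l.1

/-- The additional step is the halt statement at the empty continuation. -/
theorem Runs.toFinTM2 {c : Cmd K Γ σ} {v S v' S' n} (h : Runs c v S v' S' n) (k₀ k₁ : K)
    [Fintype (Γ k₀)] (v₀ : σ) :
    (flip bind (c.toFinTM2 k₀ k₁ v₀).step)^[n + 1]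
      (some ⟨some (c.toFinTM2 k₀ k₁ v₀).main, v, S⟩) = some ⟨none, v', S'⟩ := by
  have hn : ∀ l ∈ allLabels c, (toLabel c l).1 = l := fun l hl => by simp [toLabel, hl]
  have key := h.simulate (toLabel c) (allLabels c) (fun l => stmt (toLabel c) l.1)
    (fun l hl => by rw [hn l hl]) [] (Set.subset_insert _ _)
  rw [add_comm]
  refine iterate_bind_add key ?_
  have : (toLabel c ([] : List (Cmd K Γ σ))).1 = [] := hn _ (Or.inl rfl)
  change some (Turing.TM2.stepAux (stmt (toLabel c) (toLabel c []).1) v' S') = _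
  rw [this]
  rfl

end compile

end Cmd

end HDRR

namespace HDRR

open Computability (Γ')

/-! ### Binary trees as the data of a stack machine -/

/-- Binary trees, the data on which programs operate. -/
inductive Dat : Type
  | nil : Dat
  | cons (a b : Dat) : Dat
  deriving DecidableEq

namespace Dat

/-- Polish notation. -/
def enc : Dat → List Bool
  | nil => [false]
  | cons a b => true :: (enc a ++ enc b)

/-- The number of nodes. -/
def size : Dat → ℕ
  | nil => 1
  | cons a b => size a + size b + 1

@[simp] theorem length_enc (t : Dat) : t.enc.length = t.size := by
  induction t with
  | nil => rfl
  | cons a b iha ihb => simp [enc, size, iha, ihb]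

theorem size_pos (t : Dat) : 0 < t.size := by cases t <;> simp [size]

/-- The left subtree. -/
def hd : Dat → Dat
  | nil => nil
  | cons a _ => a

/-- The right subtree. -/
def tl : Dat → Dat
  | nil => nil
  | cons _ b => b

/-- Whether a tree is a leaf. -/
def isNil : Dat → Bool
  | nil => true
  | cons _ _ => false

end Dat

/-- Types whose elements are coded injectively by binary trees. -/
class Coded (α : Type) where
  code : α → Dat
  code_injective : Function.Injective code

open Coded (code)

instance : Coded Dat := ⟨id, Function.injective_id⟩

instance : Coded Bool := ⟨fun b => bif b then .cons .nil .nil else .nil, fun a b => by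
  cases a <;> cases b <;> simp⟩

instance {α β : Type} [Coded α] [Coded β] : Coded (α × β) :=
  ⟨fun p => .cons (code p.1) (code p.2), fun p q h => by
    simp only [Dat.cons.injEq] at h
    exact Prod.ext (Coded.code_injective h.1) (Coded.code_injective h.2)⟩

/-- A list is coded by nested pairs. -/
def codeList {α : Type} [Coded α] : List α → Dat
  | [] => .nil
  | a :: l => .cons (code a) (codeList l)

instance {α : Type} [Coded α] : Coded (List α) :=
  ⟨codeList, fun l => by
    induction l with
    | nil => intro l' h; cases l' <;> simp_all [codeList]
    | cons a l ih =>
      intro l' h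
      cases l' with
      | nil => simp [codeList] at h
      | cons b l' =>
        simp only [codeList, Dat.cons.injEq] at h
        rw [Coded.code_injective h.1, ih h.2]⟩

/-- The size of the code of an element. -/
def csize {α : Type} [Coded α] (a : α) : ℕ := (code a).size

/-! ### The stack machine -/

/-- The stacks that hold the data of a program. -/
inductive Reg : Type
  | main | tmpA | tmpB | count
  deriving DecidableEq

instance : Fintype Reg := ⟨{.main, .tmpA, .tmpB, .count}, fun x => by cases x <;> decide⟩

variable (M : Turing.FinTM2)

/-- The stacks of a program that may call the machine `M`: data stacks, an input and an output
stack, and the stacks of `M`. -/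
abbrev Stk : Type := Reg ⊕ (Unit ⊕ Unit) ⊕ M.K

/-- The stack alphabets. -/
abbrev Alpha : Stk M → Type
  | .inl _ => Bool
  | .inr (.inl (.inl _)) => Option Γ'
  | .inr (.inl (.inr _)) => Bool
  | .inr (.inr k) => M.Γ k

/-- The register: the last symbol read from a data stack, the last symbol read from the input,
and the state and the current label of `M`. -/
abbrev Sig : Type := Option Bool × Option (Option Γ') × M.σ × Option M.Λ

/-- Programs that may call `M`. -/
abbrev Prog : Type := Cmd (Stk M) (Alpha M) (Sig M)

variable {M}

/-- The contents of all stacks. -/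
def store (d : Reg → List Bool) (i : List (Option Γ')) (o : List Bool) (F : ∀ k, List (M.Γ k)) :
    ∀ k : Stk M, List (Alpha M k)
  | .inl x => d x
  | .inr (.inl (.inl _)) => i
  | .inr (.inl (.inr _)) => o
  | .inr (.inr k) => F k

theorem update_store_inl (d : Reg → List Bool) (i : List (Option Γ')) (o : List Bool)
    (F : ∀ k, List (M.Γ k)) (x : Reg) (l : List Bool) :
    Function.update (store (M := M) d i o F) (.inl x) l = store (Function.update d x l) i o F := by
  funext k
  rcases k with y | (⟨⟨⟩⟩ | ⟨⟨⟩⟩) | k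
  · by_cases h : y = x
    · subst h; simp [store]
    · rw [Function.update_of_ne (by simpa using h)]; simp [store, h]
  all_goals rw [Function.update_of_ne (by simp)]; rfl

variable (M) in
/-- The stacks when only the data stacks are in use. -/
def rst (d : Reg → List Bool) : ∀ k : Stk M, List (Alpha M k) := store d [] [] fun _ => []

/-- The contents of the four data stacks. -/
def regs (m a b c : List Bool) : Reg → List Bool
  | .main => m
  | .tmpA => a
  | .tmpB => b
  | .count => c

section regs
variable (m a b c l : List Bool)
@[simp] theorem regs_main : regs m a b c .main = m := rfl
@[simp] theorem regs_tmpA : regs m a b c .tmpA = a := rfl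
@[simp] theorem regs_tmpB : regs m a b c .tmpB = b := rfl
@[simp] theorem regs_count : regs m a b c .count = c := rfl
@[simp] theorem update_regs_main : Function.update (regs m a b c) .main l = regs l a b c := by
  funext k; cases k <;> simp [regs, Function.update]
@[simp] theorem update_regs_tmpA : Function.update (regs m a b c) .tmpA l = regs m l b c := by
  funext k; cases k <;> simp [regs, Function.update]
@[simp] theorem update_regs_tmpB : Function.update (regs m a b c) .tmpB l = regs m a l c := by
  funext k; cases k <;> simp [regs, Function.update]
@[simp] theorem update_regs_count : Function.update (regs m a b c) .count l = regs m a b l := by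
  funext k; cases k <;> simp [regs, Function.update]
end regs

/-- Started with any register and data `d`, the program ends with data `d'` after at most `n`
steps. -/
def Tri (c : Prog M) (n : ℕ) (d d' : Reg → List Bool) : Prop :=
  ∀ v, ∃ v' k, k ≤ n ∧ c.Runs v (rst M d) v' (rst M d') k

theorem Tri.mono {c : Prog M} {m n : ℕ} {d d'} (h : Tri c m d d') (hmn : m ≤ n) : Tri c n d d' :=
  fun v => let ⟨v', k, hk, hr⟩ := h v; ⟨v', k, hk.trans hmn, hr⟩

/-- Since `Tri` allows every initial register, the register that `a` leaves behind needs no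
description. -/
theorem Tri.seq {a b : Prog M} {m n : ℕ} {d₁ d₂ d₃} (ha : Tri a m d₁ d₂) (hb : Tri b n d₂ d₃) :
    Tri (.seq a b) (m + n + 1) d₁ d₃ := fun v => by
  obtain ⟨v₁, k₁, hk₁, h₁⟩ := ha v
  obtain ⟨v₂, k₂, hk₂, h₂⟩ := hb v₁
  exact ⟨v₂, _, by omega, .seq h₁ h₂⟩

-- Rules for elementary instructions and loops

namespace Prog

/-- Do nothing. -/
def skip : Prog M := .load id

/-- Push a symbol on a data stack. -/
def pushR (x : Reg) (b : Bool) : Prog M := .push (.inl x) fun _ => b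

/-- Pop a symbol from a data stack. -/
def popR (x : Reg) : Prog M := .pop (.inl x) fun v o => (o, v.2)

/-- Read the top symbol of a data stack. -/
def peekR (x : Reg) : Prog M := .peek (.inl x) fun v o => (o, v.2)

/-- Pop a symbol from a data stack and branch. -/
def popCase (x : Reg) (f : Option Bool → Prog M) : Prog M := .seq (popR x) (.case fun v => f v.1)

/-- Read the top symbol of a data stack and branch. -/
def peekCase (x : Reg) (f : Option Bool → Prog M) : Prog M := .seq (peekR x) (.case fun v => f v.1)

/-- Repeat while the top symbol of a data stack satisfies a condition. -/
def whileTop (x : Reg) (p : Option Bool → Bool) (a : Prog M) : Prog M :=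
  .seq (peekR x) (.loop (fun v => p v.1) (.seq a (peekR x)))

theorem tri_skip (d) : Tri (skip (M := M)) 1 d d := fun _ => ⟨_, _, le_rfl, .load⟩

theorem tri_pushR (x : Reg) (b : Bool) (d) :
    Tri (pushR (M := M) x b) 1 d (Function.update d x (b :: d x)) := fun v => by
  refine ⟨v, 1, le_rfl, ?_⟩
  rw [rst, rst, ← update_store_inl]
  exact .push

theorem runs_popR (x : Reg) (d) (v : Sig M) :
    (popR x).Runs v (rst M d) ((d x).head?, v.2) (rst M (Function.update d x (d x).tail)) 1 := by
  rw [rst, rst, ← update_store_inl]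
  exact .pop

theorem tri_popR (x : Reg) (d) : Tri (popR (M := M) x) 1 d (Function.update d x (d x).tail) :=
  fun v => ⟨_, 1, le_rfl, runs_popR x d v⟩

theorem runs_peekR (x : Reg) (d) (v : Sig M) :
    (peekR x).Runs v (rst M d) ((d x).head?, v.2) (rst M d) 1 := .peek

theorem tri_popCase {x : Reg} {f : Option Bool → Prog M} {n d d'}
    (h : Tri (f (d x).head?) n (Function.update d x (d x).tail) d') :
    Tri (popCase x f) (n + 3) d d' := fun v => by
  obtain ⟨v', k, hk, hr⟩ := h ((d x).head?, v.2)
  exact ⟨v', _, by omega, .seq (runs_popR x d v) (.case hr)⟩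

theorem tri_peekCase {x : Reg} {f : Option Bool → Prog M} {n d d'}
    (h : Tri (f (d x).head?) n d d') : Tri (peekCase x f) (n + 3) d d' := fun v => by
  obtain ⟨v', k, hk, hr⟩ := h ((d x).head?, v.2)
  exact ⟨v', _, by omega, .seq (runs_peekR x d v) (.case hr)⟩

/-- The behaviour of the loop of `whileTop` once the top symbol has been read. -/
def LoopFrom (x : Reg) (p : Option Bool → Bool) (a : Prog M) (n : ℕ) (d d' : Reg → List Bool) :
    Prop :=
  ∀ v : Sig M, v.1 = (d x).head? → ∃ v' k, k ≤ n ∧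
    (Cmd.loop (fun v => p v.1) (.seq a (peekR x))).Runs v (rst M d) v' (rst M d') k

theorem tri_whileTop {x : Reg} {p : Option Bool → Bool} {a : Prog M} {n d d'}
    (h : LoopFrom x p a n d d') : Tri (whileTop x p a) (n + 2) d d' := fun v => by
  obtain ⟨v', k, hk, hr⟩ := h ((d x).head?, v.2) rfl
  exact ⟨v', _, by omega, .seq (runs_peekR x d v) hr⟩

theorem LoopFrom.done {x : Reg} {p : Option Bool → Bool} {a : Prog M} {d}
    (h : p (d x).head? = false) : LoopFrom x p a 1 d d := fun v hv =>
  ⟨v, 1, le_rfl, .loop_false (by rw [hv, h])⟩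

/-- An iteration ends by peeking at `x` again, which restores the invariant that the register shows
the top symbol. -/
theorem LoopFrom.step {x : Reg} {p : Option Bool → Bool} {a : Prog M} {m n d₁ d₂ d₃}
    (h : p (d₁ x).head? = true) (ha : Tri a m d₁ d₂) (hl : LoopFrom x p a n d₂ d₃) :
    LoopFrom x p a (n + m + 3) d₁ d₃ := fun v hv => by
  obtain ⟨v₁, k₁, hk₁, h₁⟩ := ha v
  obtain ⟨v₂, k₂, hk₂, h₂⟩ := hl ((d₂ x).head?, v₁.2) rfl
  exact ⟨v₂, _, by omega, .loop_true (by rw [hv, h]) (.seq h₁ (runs_peekR x d₂ v₁)) h₂⟩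

theorem LoopFrom.mono {x : Reg} {p : Option Bool → Bool} {a : Prog M} {m n d d'}
    (h : LoopFrom x p a m d d') (hmn : m ≤ n) : LoopFrom x p a n d d' :=
  fun v hv => let ⟨v', k, hk, hr⟩ := h v hv; ⟨v', k, hk.trans hmn, hr⟩

-- Moving, exchanging and copying whole trees

/-- Move the contents of one data stack onto another one, in reverse order. -/
def pour (x y : Reg) : Prog M :=
  whileTop x Option.isSome (popCase x fun o => pushR y (o.getD false))

theorem tri_pour {x y : Reg} (hxy : x ≠ y) (d) :
    Tri (pour (M := M) x y) (7 * (d x).length + 3) d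
      (Function.update (Function.update d x []) y ((d x).reverse ++ d y)) := by
  refine tri_whileTop (n := 7 * (d x).length + 1) ?_
  generalize hl : d x = l
  induction l generalizing d with
  | nil =>
    have : Function.update (Function.update d x []) y (([] : List Bool).reverse ++ d y) = d := by
      funext z; by_cases hz : z = y
      · subst hz; simp
      · by_cases hzx : z = x
        · subst hzx; simp [hz, hl]
        · simp [hz, hzx]
    rw [this]
    exact (LoopFrom.done (by simp [hl])).mono (by simp)
  | cons s l ih =>
    set d₂ := Function.update (Function.update d x l) y (s :: d y) with hd₂
    have h₂ : d₂ x = l := by simp [hd₂, hxy]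
    have e : Function.update (Function.update d x []) y ((s :: l).reverse ++ d y) =
        Function.update (Function.update d₂ x []) y (l.reverse ++ d₂ y) := by
      funext z; by_cases hz : z = y
      · subst hz; simp [hd₂]
      · by_cases hzx : z = x
        · subst hzx; simp [hz]
        · simp [hz, hzx, hd₂]
    rw [e]
    refine (LoopFrom.step (by simp [hl]) (tri_popCase (n := 1) ?_) (ih d₂ h₂)).mono ?_
    · have := tri_pushR (M := M) y s (Function.update d x l)
      simpa [hl, hd₂, Function.update_of_ne hxy.symm] using this
    · simp; omega

/-- Move the top tree of the main stack, reversed, onto `tmpA`. -/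
def take : Prog M :=
  .seq (pushR .count true) (whileTop .count Option.isSome (popCase .main fun o =>
    bif o.getD false then .seq (pushR .tmpA true) (pushR .count true)
    else .seq (pushR .tmpA false) (popR .count)))

/-- The stack `count` holds, in unary, the number of subtrees still to be read. A node replaces one
pending subtree by two, a leaf removes one, so the counter becomes empty exactly at the end of the
tree. -/
theorem tri_take (t : Dat) (m a b : List Bool) :
    Tri (take (M := M)) (9 * t.size + 5) (regs (t.enc ++ m) a b [])
      (regs m (t.enc.reverse ++ a) b []) := by
  -- The induction is in continuation form: whatever the loop does in `n` steps with `t` consumed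
  -- and one fewer pending subtree, it does in `n + 9 * t.size` steps from before `t`. For a node
  -- the two hypotheses chain.
  have key : ∀ (t : Dat) (m a c : List Bool) (n : ℕ) (d' : Reg → List Bool),
      LoopFrom (M := M) .count Option.isSome (popCase .main fun o =>
        bif o.getD false then .seq (pushR .tmpA true) (pushR .count true)
        else .seq (pushR .tmpA false) (popR .count)) n (regs m (t.enc.reverse ++ a) b c) d' →
      LoopFrom (M := M) .count Option.isSome (popCase .main fun o =>
        bif o.getD false then .seq (pushR .tmpA true) (pushR .count true)
        else .seq (pushR .tmpA false) (popR .count)) (n + 9 * t.size)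
        (regs (t.enc ++ m) a b (true :: c)) d' := by
    intro t
    induction t with
    | nil =>
      intro m a c n d' h
      refine (LoopFrom.step (d₂ := regs m (false :: a) b c) (by simp)
        (tri_popCase (n := 3) ?_) (n := n) (by simpa [Dat.enc] using h)).mono
        (show _ ≤ n + 9 by omega)
      · simpa [Dat.enc] using (tri_pushR .tmpA false (regs m a b (true :: c))).seq (tri_popR .count _)
    | cons x y ihx ihy =>
      intro m a c n d' h
      have h₁ := ihx (y.enc ++ m) (true :: a) (true :: c) _ d'
        (ihy m (x.enc.reverse ++ true :: a) c n d' (by simpa [Dat.enc] using h))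
      refine (LoopFrom.step (by simp) (tri_popCase (n := 3) ?_) h₁).mono
        (show _ ≤ n + 9 * (x.size + y.size + 1) by omega)
      · simpa [Dat.enc] using (tri_pushR .tmpA true
          (regs (x.enc ++ (y.enc ++ m)) a b (true :: c))).seq (tri_pushR .count true _)
  have h := key t m a [] 1 _ (LoopFrom.done (by simp))
  have := (tri_pushR (M := M) .count true (regs (t.enc ++ m) a b [])).seq (tri_whileTop (by simpa using h))
  exact this.mono (by omega)

theorem tri_pushMain (s : Bool) (m a b c : List Bool) :
    Tri (pushR (M := M) .main s) 1 (regs m a b c) (regs (s :: m) a b c) := by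
  simpa using tri_pushR (M := M) .main s (regs m a b c)

theorem tri_popMain (s : Bool) (m a b c : List Bool) :
    Tri (popR (M := M) .main) 1 (regs (s :: m) a b c) (regs m a b c) := by
  simpa using tri_popR (M := M) .main (regs (s :: m) a b c)

/-- Push a constant word on the main stack. -/
def pushWord : List Bool → Prog M
  | [] => skip
  | s :: w => .seq (pushWord w) (pushR .main s)

theorem tri_pushWord (w m a b c : List Bool) :
    Tri (pushWord (M := M) w) (2 * w.length + 1) (regs m a b c) (regs (w ++ m) a b c) := by
  induction w with
  | nil => exact tri_skip _
  | cons s w ih => exact (ih.seq (tri_pushMain _ _ _ _ _)).mono (by simp; omega)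

/-- Exchange the two topmost trees. -/
def swap : Prog M :=
  .seq take <| .seq (pour .tmpA .tmpB) <| .seq take <| .seq (pour .tmpB .count) <|
    .seq (pour .count .main) (pour .tmpA .main)

/-- Each `pour` reverses. After two moves `x` stands in its original order on `tmpB`, so a detour
over `count`, free again once `y` is taken, is needed to return it to `main` unreversed; `y` is
still reversed on `tmpA` and returns directly. -/
theorem tri_swap (x y : Dat) (m : List Bool) :
    Tri (swap (M := M)) (40 * (x.size + y.size) + 40) (regs (x.enc ++ (y.enc ++ m)) [] [] [])
      (regs (y.enc ++ (x.enc ++ m)) [] [] []) := by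
  refine ((tri_take x _ _ _).seq <| (tri_pour (by decide) _).seq <| Tri.seq (n := _)
    (d₂ := regs m (y.enc.reverse) x.enc []) (m := 9 * y.size + 5) ?_ <|
    (tri_pour (by decide) _).seq <| (tri_pour (by decide) _).seq
    (Tri.mono (m := 7 * y.size + 3) ?_ (le_refl _))).mono ?_
  · simpa using tri_take (M := M) y m [] x.enc
  · simpa using tri_pour (M := M) (x := .tmpA) (y := .main) (by decide)
      (regs (x.enc ++ m) y.enc.reverse [] [])
  · simp; omega

/-- Remove the topmost tree. -/
def drop : Prog M := .seq take (whileTop .tmpA Option.isSome (popR .tmpA))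

theorem tri_drop (x : Dat) (m : List Bool) :
    Tri (drop (M := M)) (20 * x.size + 20) (regs (x.enc ++ m) [] [] []) (regs m [] [] []) := by
  have key : ∀ l : List Bool, LoopFrom (M := M) .tmpA Option.isSome (popR .tmpA) (4 * l.length + 1)
      (regs m l [] []) (regs m [] [] []) := by
    intro l
    induction l with
    | nil => exact LoopFrom.done (by simp)
    | cons s l ih =>
      refine (LoopFrom.step (by simp) (tri_popR _ _) (by simpa using ih)).mono ?_
      simp; omega
  refine ((tri_take x _ _ _).seq (tri_whileTop (by simpa using key x.enc.reverse))).mono ?_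
  simp; omega

/-- Duplicate the topmost tree. -/
def dup : Prog M :=
  .seq take <| .seq (whileTop .tmpA Option.isSome (popCase .tmpA fun o =>
    .seq (pushR .main (o.getD false)) (pushR .tmpB (o.getD false)))) <|
  .seq (pour .tmpB .tmpA) (pour .tmpA .main)

theorem tri_dup (x : Dat) (m : List Bool) :
    Tri (dup (M := M)) (60 * x.size + 60) (regs (x.enc ++ m) [] [] [])
      (regs (x.enc ++ (x.enc ++ m)) [] [] []) := by
  have key : ∀ l m b : List Bool, LoopFrom (M := M) .tmpA Option.isSome (popCase .tmpA fun o =>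
      .seq (pushR .main (o.getD false)) (pushR .tmpB (o.getD false))) (9 * l.length + 1)
      (regs m l b []) (regs (l.reverse ++ m) [] (l.reverse ++ b) []) := by
    intro l
    induction l with
    | nil => intro m b; exact LoopFrom.done (by simp)
    | cons s l ih =>
      intro m b
      refine (LoopFrom.step (d₂ := regs (s :: m) l (s :: b) []) (by simp)
        (tri_popCase (n := 3) ?_) (by simpa using ih (s :: m) (s :: b))).mono (by simp; omega)
      simpa using (tri_pushR .main s (regs m l b [])).seq (tri_pushR .tmpB s _)
  refine ((tri_take x _ _ _).seq <| Tri.seq (tri_whileTop (key (x.enc.reverse ++ []) m [])) <|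
    (tri_pour (by decide) _).seq
    (Tri.mono (m := 7 * x.size + 3) ?_ (le_refl _))).mono ?_
  · simpa using tri_pour (M := M) (x := .tmpA) (y := .main) (by decide)
      (regs (x.enc ++ m) x.enc.reverse [] [])
  · simp; omega

end Prog

end HDRR

namespace HDRR

open Computability (Γ')
open Coded (code)

/-! ### Functions computable in polynomial time, relative to a machine `M` -/

/-- The coefficients are natural numbers. This allows time bounds to be evaluated at upper bounds of
the input size. -/
theorem eval_mono (p : Polynomial ℕ) {m n : ℕ} (h : m ≤ n) : p.eval m ≤ p.eval n := by
  simp only [Polynomial.eval_eq_sum, Polynomial.sum]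
  exact Finset.sum_le_sum fun i _ => Nat.mul_le_mul le_rfl (Nat.pow_le_pow_left h i)

variable (M : Turing.FinTM2)

/-- `f` is computed in polynomial time by a program that replaces the topmost tree of the main
stack, and that may call `M`. -/
def PT {α β : Type} [Coded α] [Coded β] (f : α → β) : Prop :=
  ∃ (c : Prog M) (p : Polynomial ℕ), ∀ a, csize (f a) ≤ p.eval (csize a) ∧
    ∀ m, Tri c (p.eval (csize a)) (regs ((code a).enc ++ m) [] [] [])
      (regs ((code (f a)).enc ++ m) [] [] [])

variable {M}
variable {α β γ δ : Type} [Coded α] [Coded β] [Coded γ] [Coded δ]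

theorem csize_pos (a : α) : 0 < csize a := Dat.size_pos _

theorem csize_prod (a : α) (b : β) : csize (a, b) = csize a + csize b + 1 := rfl

theorem csize_nil : csize ([] : List α) = 1 := rfl

theorem csize_cons (a : α) (l : List α) : csize (a :: l) = csize a + csize l + 1 := rfl

theorem enc_code_prod (a : α) (b : β) :
    (code (a, b)).enc = true :: ((code a).enc ++ (code b).enc) := rfl

theorem enc_code_nil : (code ([] : List α)).enc = [false] := rfl

theorem enc_code_cons (a : α) (l : List α) :
    (code (a :: l)).enc = true :: ((code a).enc ++ (code l).enc) := rfl

theorem csize_bool_le (b : Bool) : csize b ≤ 3 := by cases b <;> decide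

theorem PT.intro {f : α → β} (c : Prog M) (p q : Polynomial ℕ)
    (hq : ∀ a, csize (f a) ≤ q.eval (csize a))
    (h : ∀ a m, Tri c (p.eval (csize a)) (regs ((code a).enc ++ m) [] [] [])
      (regs ((code (f a)).enc ++ m) [] [] [])) : PT M f :=
  ⟨c, p + q, fun a => ⟨by have := hq a; simp; omega, fun m => (h a m).mono (by simp)⟩⟩

-- Closure properties of polynomial-time functions

/-- A function that agrees on codes with a polynomial-time function is polynomial-time. -/
theorem PT.of_code {f : α → β} {g : γ → δ} (hg : PT M g) (e : α → γ)
    (he : ∀ a, code (e a) = code a) (h : ∀ a, code (f a) = code (g (e a))) : PT M f := by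
  obtain ⟨c, p, hp⟩ := hg
  refine ⟨c, p, fun a => ?_⟩
  have := hp (e a)
  simpa only [csize, he, h] using this

theorem PT.congr {f g : α → β} (hg : PT M g) (h : ∀ a, f a = g a) : PT M f := funext h ▸ hg

/-- The time of the second program is measured in the size of `f a`; this is why `PT` bounds output
sizes besides running times. -/
theorem PT.comp {f : α → β} {g : β → γ} (hg : PT M g) (hf : PT M f) : PT M fun a => g (f a) := by
  obtain ⟨c, p, hp⟩ := hf
  obtain ⟨d, q, hq⟩ := hg
  refine .intro (.seq c d) (p + q.comp p + 1) (q.comp p) (fun a => ?_) fun a m => ?_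
  · have := eval_mono q (hp a).1
    have := (hq (f a)).1
    simp; omega
  · refine (((hp a).2 m).seq ((hq (f a)).2 m)).mono ?_
    have := eval_mono q (hp a).1
    simp; omega

theorem PT.self : PT M fun a : α => a :=
  .intro Prog.skip 1 .X (by simp) fun a m => by simpa using Prog.tri_skip _

theorem PT.const (b : β) : PT M fun _ : α => b := by
  refine .intro (.seq Prog.drop (Prog.pushWord (code b).enc)) (.C (2 * csize b + 30) + 20 * .X)
    (.C (csize b)) (by simp) fun a m => ?_
  refine ((Prog.tri_drop _ _).seq (Prog.tri_pushWord _ _ _ _ _)).mono ?_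
  simp [csize]; omega

/-- The second program must start with its argument on top, so the copy of the input is brought up
by a swap. A final swap restores the order, and the pushed `true` is the Polish symbol of the pair.
-/
theorem PT.pair {f : α → β} {g : α → γ} (hf : PT M f) (hg : PT M g) : PT M fun a => (f a, g a) := by
  obtain ⟨c, p, hp⟩ := hf
  obtain ⟨d, q, hq⟩ := hg
  refine .intro (.seq Prog.dup <| .seq c <| .seq Prog.swap <| .seq d <| .seq Prog.swap
    (Prog.pushR .main true)) (300 * .X + 100 * p + 100 * q + 300) (p + q + 1) (fun a => ?_)
    fun a m => ?_
  · have := (hp a).1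
    have := (hq a).1
    rw [csize_prod]; simp; omega
  · refine ((Prog.tri_dup _ _).seq <| ((hp a).2 _).seq <| (Prog.tri_swap _ _ _).seq <|
      ((hq a).2 _).seq <| (Prog.tri_swap _ _ _).seq
      (n := 1) (by simpa [enc_code_prod] using Prog.tri_pushMain true _ _ _ _)).mono ?_
    have := (hp a).1
    have := (hq a).1
    simp only [csize, Polynomial.eval_add, Polynomial.eval_mul, Polynomial.eval_ofNat,
      Polynomial.eval_X] at *
    omega

/-- Test for a leaf. -/
theorem PT.isNil : PT M Dat.isNil := by
  refine .intro (Prog.peekCase .main fun o => .seq Prog.drop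
    (Prog.pushWord (code (!(o.getD false))).enc)) (30 * .X + 60) 3
    (fun a => (csize_bool_le _).trans (by simp)) fun a m => ?_
  have h : (!((regs ((code a).enc ++ m) [] [] [] .main).head?.getD false)) = a.isNil := by
    cases a <;> rfl
  have hb := csize_bool_le a.isNil
  refine (Prog.tri_peekCase (n := 20 * a.size + 40) ?_).mono ?_
  · simp only [h]
    refine ((Prog.tri_drop a m).seq (Prog.tri_pushWord _ _ _ _ _)).mono ?_
    rw [Dat.length_enc]; simp only [csize] at hb; omega
  · simp [csize, code]; omega

/-- Once the leading `true` is popped, the two subtrees lie on the stack as separate trees, and the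
lower one can be swapped up and dropped. -/
theorem PT.hd : PT M Dat.hd := by
  refine .intro (Prog.popCase .main fun o => bif o.getD false then .seq Prog.swap Prog.drop
    else Prog.pushR .main false) (60 * .X + 100) .X
    (fun a => by cases a <;> simp only [csize, code, Dat.hd, Dat.size, id_eq, Polynomial.eval_X] <;> omega) fun a m => ?_
  cases a with
  | nil =>
    refine (Prog.tri_popCase (n := 1) ?_).mono (m := 4) (by simp)
    simpa [Dat.enc, code, Dat.hd] using Prog.tri_pushR .main false (regs m [] [] [])
  | cons x y =>
    refine (Prog.tri_popCase (n := _) ?_).mono (m := (40 * (x.size + y.size) + 40) +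
      (20 * y.size + 20) + 1 + 3) ?_
    · simpa [Dat.enc, code, Dat.hd] using (Prog.tri_swap x y m).seq (Prog.tri_drop _ _)
    · simp [csize, code, Dat.size]; omega

theorem PT.tl : PT M Dat.tl := by
  refine .intro (Prog.popCase .main fun o => bif o.getD false then Prog.drop
    else Prog.pushR .main false) (20 * .X + 100) .X
    (fun a => by cases a <;> simp only [csize, code, Dat.tl, Dat.size, id_eq, Polynomial.eval_X] <;> omega) fun a m => ?_
  cases a with
  | nil =>
    refine (Prog.tri_popCase (n := 1) ?_).mono (m := 4) (by simp)
    simpa [Dat.enc, code, Dat.tl] using Prog.tri_pushR .main false (regs m [] [] [])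
  | cons x y =>
    refine (Prog.tri_popCase (n := _) ?_).mono (m := (20 * x.size + 20) + 3) ?_
    · simpa [Dat.enc, code, Dat.tl] using Prog.tri_drop x (y.enc ++ m)
    · simp [csize, code, Dat.size]; omega

theorem PT.fst' : PT M (Prod.fst : α × β → α) := PT.of_code PT.hd code (fun _ => rfl) fun _ => rfl

theorem PT.snd' : PT M (Prod.snd : α × β → β) := PT.of_code PT.tl code (fun _ => rfl) fun _ => rfl

theorem PT.fst {f : α → β × γ} (hf : PT M f) : PT M fun a => (f a).1 := PT.fst'.comp hf

theorem PT.snd {f : α → β × γ} (hf : PT M f) : PT M fun a => (f a).2 := PT.snd'.comp hf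

theorem PT.cond {c : α → Bool} {f g : α → β} (hc : PT M c) (hf : PT M f) (hg : PT M g) :
    PT M fun a => bif c a then f a else g a := by
  obtain ⟨t, r, hr⟩ := hc
  obtain ⟨c', p, hp⟩ := hf
  obtain ⟨d, q, hq⟩ := hg
  -- The code of `true` is the word `true, false, false`, so two symbols remain after the branch has
  -- popped the first; that of `false` is a single symbol.
  refine .intro (.seq Prog.dup <| .seq t <| Prog.popCase .main fun o => bif o.getD false then
    .seq (Prog.popR .main) (.seq (Prog.popR .main) c') else d)
    (60 * .X + 100 + r + p + q) (p + q) (fun a => ?_) fun a m => ?_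
  · have := (hp a).1
    have := (hq a).1
    cases c a <;> simp <;> omega
  · refine ((Prog.tri_dup _ _).seq <| ((hr a).2 _).seq <| Prog.tri_popCase
      (n := p.eval (csize a) + q.eval (csize a) + 4) ?_).mono ?_
    · cases c a with
      | false => exact Tri.mono (by simpa [Dat.enc, code] using (hq a).2 m) (by omega)
      | true =>
        refine Tri.mono (m := 1 + (1 + p.eval (csize a) + 1) + 1) ?_ (by omega)
        simpa [Dat.enc, code] using
          (Prog.tri_popR .main (regs (false :: false :: ((code a).enc ++ m)) [] [] [])).seq
            ((Prog.tri_popR .main _).seq (by simpa using (hp a).2 m))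
    · simp only [csize, Polynomial.eval_add, Polynomial.eval_mul, Polynomial.eval_ofNat,
        Polynomial.eval_X] at *
      omega

theorem PT.ite {c : α → Prop} [DecidablePred c] {f g : α → β} (hc : PT M fun a => decide (c a))
    (hf : PT M f) (hg : PT M g) : PT M fun a => if c a then f a else g a :=
  (hc.cond hf hg).congr fun a => by by_cases h : c a <;> simp [h]

theorem csize_enc_le (t : Dat) : csize t.enc ≤ 4 * t.size + 1 := by
  have : ∀ l : List Bool, csize l ≤ 4 * l.length + 1 := by
    intro l
    induction l with
    | nil => simp [csize_nil]
    | cons b l ih => have := csize_bool_le b; rw [csize_cons]; simp; omega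
  simpa using this t.enc

/-- Polish notation as a list. -/
theorem PT.enc : PT M Dat.enc := by
  refine .intro (.seq Prog.take <| .seq (Prog.pushR .main false) <|
    Prog.whileTop .tmpA Option.isSome (Prog.popCase .tmpA fun o =>
      .seq (Prog.pushWord (code (o.getD false)).enc) (Prog.pushR .main true)))
    (30 * .X + 100) (4 * .X + 1) (fun a => by simpa using! csize_enc_le a) fun a m => ?_
  -- `take` leaves the last symbol on top of `tmpA`, so the list grows from its end: each symbol is
  -- put in front as its code preceded by the `true` of a list cell.
  have key : ∀ l r : List Bool, Prog.LoopFrom (M := M) .tmpA Option.isSome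
      (Prog.popCase .tmpA fun o =>
        .seq (Prog.pushWord (code (o.getD false)).enc) (Prog.pushR .main true)) (20 * l.length + 1)
      (regs ((code r).enc ++ m) l [] []) (regs ((code (l.reverse ++ r)).enc ++ m) [] [] []) := by
    intro l
    induction l with
    | nil => intro r; exact Prog.LoopFrom.done (by simp)
    | cons s l ih =>
      intro r
      refine (Prog.LoopFrom.step (d₂ := regs ((code (s :: r)).enc ++ m) l [] []) (by simp)
        (Prog.tri_popCase (n := 10) ?_) (by simpa using ih (s :: r))).mono (by simp; omega)
      refine Tri.mono (m := (2 * (code s).enc.length + 1) + 1 + 1) ?_ ?_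
      · simpa [code, codeList, Dat.enc] using (Prog.tri_pushWord (code s).enc ((code r).enc ++ m) l [] []).seq
          (Prog.tri_pushR .main true _)
      · have := csize_bool_le s
        simp only [csize] at this
        rw [Dat.length_enc]; omega
  have h := key a.enc.reverse []
  rw [List.reverse_reverse, List.append_nil] at h
  refine ((Prog.tri_take a _ _ _).seq <| Tri.seq (m := 1) (d₂ := regs ((code ([] : List Bool)).enc ++ m) a.enc.reverse [] [])
    ?_ (Prog.tri_whileTop h)).mono ?_
  · simpa [enc_code_nil] using Prog.tri_pushMain false m a.enc.reverse [] []
  · simp [csize, code]; omega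

/-- Folds over lists whose intermediate results have polynomial size. -/
theorem PT.foldl {f : α → List β} {g : α → γ} {h : α → γ → β → γ} (hf : PT M f) (hg : PT M g)
    (hh : PT M fun p : α × γ × β => h p.1 p.2.1 p.2.2) (q : Polynomial ℕ)
    (hq : ∀ a l₁ l₂, f a = l₁ ++ l₂ → csize (l₁.foldl (h a) (g a)) ≤ q.eval (csize a)) :
    PT M fun a => (f a).foldl (h a) (g a) := by
  -- the loop works on a list, followed by the pair of the accumulator and the argument
  have hs : PT M fun s : (β × List β) × γ × α => (s.1.2, h s.2.2 s.2.1 s.1.1, s.2.2) :=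
    .pair (.snd (.fst .self)) (.pair (hh.comp (.pair (.snd (.snd .self))
      (.pair (.fst (.snd .self)) (.fst (.fst .self))))) (.snd (.snd .self)))
  obtain ⟨c, p, hp⟩ := hs
  obtain ⟨c₀, p₀, hp₀⟩ := hf.pair (hg.pair PT.self)
  obtain ⟨c₁, p₁, hp₁⟩ := PT.fst' (M := M) (α := γ) (β := α)
  -- `B` bounds the size of the loop state: remaining list, accumulator and argument.
  let B : Polynomial ℕ := p₀ + q + .X + 10
  -- Between iterations the outer pair symbol of the state is removed, so that the top of `main` is
  -- the first symbol of the remaining list, `true` iff the list is nonempty. The body puts the pair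
  -- symbol back for `c` and removes it again. A nonempty list has the same code as the pair of its
  -- head and tail.
  let body : Prog M := .seq (Prog.pushR .main true) (.seq c (Prog.popR .main))
  have key : ∀ a m (l₂ l₁ : List β), f a = l₁ ++ l₂ → csize l₂ ≤ p₀.eval (csize a) →
      Prog.LoopFrom (M := M) .main (fun o => o.getD false) body
        (l₂.length * (p.eval (B.eval (csize a)) + 10) + 1)
        (regs ((code l₂).enc ++ ((code (l₁.foldl (h a) (g a), a)).enc ++ m)) [] [] [])
        (regs ((code ([] : List β)).enc ++ ((code ((f a).foldl (h a) (g a), a)).enc ++ m)) [] [] []) := by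
    intro a m l₂
    induction l₂ with
    | nil =>
      intro l₁ h₁ _
      rw [h₁, List.append_nil]
      exact (Prog.LoopFrom.done (by simp [code, codeList, Dat.enc])).mono (by omega)
    | cons b l₂ ih =>
      intro l₁ h₁ h₂
      rw [csize_cons] at h₂
      have e : f a = (l₁ ++ [b]) ++ l₂ := by simp [h₁]
      have ih' := ih _ e (by omega)
      have hb := hp ((b, l₂), (l₁.foldl (h a) (g a), a))
      have hbound : csize ((b, l₂), (l₁.foldl (h a) (g a), a)) ≤ B.eval (csize a) := by
        have := hq a l₁ _ h₁
        simp only [csize_prod, B, Polynomial.eval_add, Polynomial.eval_ofNat, Polynomial.eval_X]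
        omega
      refine (Prog.LoopFrom.step (by simp [code, codeList, Dat.enc]) (m := p.eval (B.eval (csize a)) + 4) ?_ ih').mono ?_
      · refine ((Prog.tri_pushMain true _ _ _ _).seq ((Tri.mono (n := p.eval (B.eval (csize a))) ?_
          (eval_mono p hbound)).seq (Prog.tri_popMain true _ _ _ _))).mono (by omega)
        simpa [enc_code_prod, enc_code_cons] using hb.2 m
      · rw [List.length_cons, Nat.add_mul]; omega
  have len : ∀ l : List β, l.length ≤ csize l := by
    intro l
    induction l with
    | nil => simp
    | cons b l ih => rw [csize_cons]; simp; omega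
  -- After the loop, the pop removes the code of the empty list, and `c₁` projects to the
  -- accumulator.
  refine .intro (.seq c₀ (.seq (Prog.popR .main) (.seq
    (Prog.whileTop .main (fun o => o.getD false) body) (.seq (Prog.popR .main) c₁))))
    (p₀ + p₀ * (p.comp B + 10) + p₁.comp (q + .X + 1) + 20) q
    (fun a => hq a (f a) [] (by simp)) fun a m => ?_
  have h₀ := (hp₀ a).1
  rw [csize_prod] at h₀
  have hl := key a m (f a) [] (by simp) (by omega)
  have hc := (hp₁ ((f a).foldl (h a) (g a), a)).2 m
  refine (Tri.seq (m := p₀.eval (csize a)) ?_ <| (Prog.tri_popMain true _ _ _ _).seq <|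
    (Prog.tri_whileTop hl).seq <| (Tri.seq (m := 1) ?_ (hc.mono (n := p₁.eval (q.eval (csize a) + csize a + 1)) ?_))).mono ?_
  · simpa [enc_code_prod] using (hp₀ a).2 m
  · exact Prog.tri_popMain false _ _ _ _
  · have := hq a (f a) [] (by simp)
    exact eval_mono _ (by rw [csize_prod]; omega)
  · have h₁ : (f a).length * (p.eval (B.eval (csize a)) + 10) ≤
        p₀.eval (csize a) * (p.eval (B.eval (csize a)) + 10) :=
      Nat.mul_le_mul ((len _).trans (by omega)) le_rfl
    simp only [Polynomial.eval_add, Polynomial.eval_mul, Polynomial.eval_comp,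
      Polynomial.eval_ofNat, Polynomial.eval_X, Polynomial.eval_one]
    omega

end HDRR

namespace HDRR

open Computability (Γ')
open Coded (code)

/-! ### Input, output, and calls of a foreign machine -/

/-- Unary numbers as trees. -/
def Dat.chain : ℕ → Dat
  | 0 => .nil
  | n + 1 => .cons .nil (chain n)

theorem Dat.chain_injective : Function.Injective Dat.chain := fun m => by
  induction m with
  | zero => intro n h; cases n <;> simp_all [Dat.chain]
  | succ m ih =>
    intro n h
    cases n with
    | zero => simp [Dat.chain] at h
    | succ n => rw [ih (by simpa [Dat.chain] using h)]

/-- The position of a symbol in the alphabet. -/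
def symNum : Γ' → ℕ
  | .blank => 0
  | .bit false => 1
  | .bit true => 2
  | .bra => 3
  | .ket => 4
  | .comma => 5

theorem symNum_injective : Function.Injective symNum := by decide

instance : Coded Γ' := ⟨fun s => .chain (symNum s), Dat.chain_injective.comp symNum_injective⟩

instance {α : Type} [Coded α] : Coded (Option α) :=
  ⟨fun o => o.elim .nil fun a => .cons .nil (code a), fun a b h => by
    cases a <;> cases b <;> simp_all [Coded.code_injective.eq_iff]⟩

/-- The position of a symbol of the alphabet with an end marker. -/
def optNum : Option Γ' → ℕ
  | none => 0
  | some s => symNum s + 1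

/-- The next symbol. -/
def nextSym : Option Γ' → Option Γ'
  | none => some .blank
  | some .blank => some (.bit false)
  | some (.bit false) => some (.bit true)
  | some (.bit true) => some .bra
  | some .bra => some .ket
  | some .ket => some .comma
  | some .comma => none

theorem iterate_nextSym (s : Option Γ') : nextSym^[optNum s] none = s := by
  revert s; decide

/-- A symbol is thus a unary number, which a program decodes by applying `nextSym` once per cell,
starting from `none`. -/
theorem code_sym (s : Option Γ') : code s = Dat.chain (optNum s) := by
  cases s <;> rfl

theorem optNum_le (s : Option Γ') : optNum s ≤ 6 := by
  revert s; decide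

variable {M : Turing.FinTM2}

theorem update_store_ext (d : Reg → List Bool) (i : List (Option Γ')) (o : List Bool)
    (F : ∀ k, List (M.Γ k)) (k : M.K) (l : List (M.Γ k)) :
    Function.update (store (M := M) d i o F) (.inr (.inr k)) l =
      store d i o (Function.update F k l) := by
  funext z
  rcases z with y | (⟨⟨⟩⟩ | ⟨⟨⟩⟩) | j
  rotate_right
  · by_cases h : j = k
    · subst h; simp [store]
    · rw [Function.update_of_ne (by simpa using h)]; simp [store, h]
  all_goals rw [Function.update_of_ne (by simp)]; rfl

theorem update_store_inp (d : Reg → List Bool) (i : List (Option Γ')) (o : List Bool)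
    (F : ∀ k, List (M.Γ k)) (l : List (Option Γ')) :
    Function.update (store (M := M) d i o F) (.inr (.inl (.inl ()))) l = store d l o F := by
  funext z
  rcases z with y | (⟨⟨⟩⟩ | ⟨⟨⟩⟩) | j
  · rw [Function.update_of_ne (by simp)]; rfl
  · simp [store]
  all_goals rw [Function.update_of_ne (by simp)]; rfl

theorem update_store_out (d : Reg → List Bool) (i : List (Option Γ')) (o : List Bool)
    (F : ∀ k, List (M.Γ k)) (l : List Bool) :
    Function.update (store (M := M) d i o F) (.inr (.inl (.inr ()))) l = store d i l F := by
  funext z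
  rcases z with y | (⟨⟨⟩⟩ | ⟨⟨⟩⟩) | j
  rotate_right 2
  · simp [store]
  all_goals rw [Function.update_of_ne (by simp)]; rfl

-- Running the foreign machine inside a program

namespace Prog

/-- One statement of `M` as a program. -/
def ofStmt : Turing.TM2.Stmt M.Γ M.Λ M.σ → Prog M
  | .push k f q => .seq (.push (.inr (.inr k)) fun v => f v.2.2.1) (ofStmt q)
  | .peek k f q => .seq (.peek (.inr (.inr k)) fun v o => (v.1, v.2.1, f v.2.2.1 o, v.2.2.2))
      (ofStmt q)
  | .pop k f q => .seq (.pop (.inr (.inr k)) fun v o => (v.1, v.2.1, f v.2.2.1 o, v.2.2.2))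
      (ofStmt q)
  | .load f q => .seq (.load fun v => (v.1, v.2.1, f v.2.2.1, v.2.2.2)) (ofStmt q)
  | .branch f q₁ q₂ => .case fun v => bif f v.2.2.1 then ofStmt q₁ else ofStmt q₂
  | .goto l => .load fun v => (v.1, v.2.1, v.2.2.1, some (l v.2.2.1))
  | .halt => .load fun v => (v.1, v.2.1, v.2.2.1, none)

/-- A bound for the running time of `ofStmt`. -/
def cost : Turing.TM2.Stmt M.Γ M.Λ M.σ → ℕ
  | .push _ _ q => cost q + 2
  | .peek _ _ q => cost q + 2
  | .pop _ _ q => cost q + 2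
  | .load _ q => cost q + 2
  | .branch _ q₁ q₂ => cost q₁ + cost q₂ + 1
  | .goto _ => 1
  | .halt => 1

theorem runs_ofStmt (q : Turing.TM2.Stmt M.Γ M.Λ M.σ) (x y s l d i o) (F : ∀ k, List (M.Γ k)) :
    ∃ n ≤ cost q, (ofStmt q).Runs (x, y, s, l) (store d i o F)
      (x, y, (Turing.TM2.stepAux q s F).var, (Turing.TM2.stepAux q s F).l)
      (store d i o (Turing.TM2.stepAux q s F).stk) n := by
  induction q generalizing s F with
  | push k f q ih =>
    obtain ⟨n, hn, h⟩ := ih s (Function.update F k (f s :: F k))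
    rw [← update_store_ext] at h
    exact ⟨_, by simp only [cost]; omega, .seq .push h⟩
  | peek k f q ih =>
    obtain ⟨n, hn, h⟩ := ih (f s (F k).head?) F
    exact ⟨_, by simp only [cost]; omega, .seq .peek h⟩
  | pop k f q ih =>
    obtain ⟨n, hn, h⟩ := ih (f s (F k).head?) (Function.update F k (F k).tail)
    rw [← update_store_ext] at h
    exact ⟨_, by simp only [cost]; omega, .seq .pop h⟩
  | load f q ih =>
    obtain ⟨n, hn, h⟩ := ih (f s) F
    exact ⟨_, by simp only [cost]; omega, .seq .load h⟩
  | branch f q₁ q₂ ih₁ ih₂ =>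
    cases hf : f s with
    | true =>
      obtain ⟨n, hn, h⟩ := ih₁ s F
      refine ⟨n + 1, by simp only [cost]; omega, .case ?_⟩
      simpa [hf] using h
    | false =>
      obtain ⟨n, hn, h⟩ := ih₂ s F
      refine ⟨n + 1, by simp only [cost]; omega, .case ?_⟩
      simpa [hf] using h
  | goto l => exact ⟨1, by simp [cost], .load⟩
  | halt => exact ⟨1, by simp [cost], .load⟩

/-- One step of `M`. -/
def stepM : Prog M := .case fun v => v.2.2.2.elim skip fun l => ofStmt (M.m l)

variable (M) in
/-- A bound for the running time of one step of `M`. -/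
def costM : ℕ := letI := M.ΛFin; ∑ l : M.Λ, cost (M.m l)

/-- The program's register carries the state and label of `M`, and the loop runs while a label is
present. Each step of `M` costs at most `costM M` plus the overhead of the loop and of the branch.
-/
theorem runs_loop_stepM (x y d i o) (n : ℕ) (c c' : M.Cfg)
    (h : (flip bind M.step)^[n] (some c) = some c') (hc' : c'.l = none) :
    ∃ k ≤ n * (costM M + 2) + 1, (Cmd.loop (fun v => v.2.2.2.isSome) stepM).Runs
      (x, y, c.var, c.l) (store d i o c.stk) (x, y, c'.var, none) (store d i o c'.stk) k := by
  induction n generalizing c with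
  | zero =>
    simp only [Function.iterate_zero, id_eq, Option.some.injEq] at h
    subst h
    rw [hc']
    exact ⟨1, by simp, .loop_false rfl⟩
  | succ n ih =>
    rw [Function.iterate_succ_apply] at h
    obtain ⟨l, s, F⟩ := c
    cases l with
    | none =>
      -- A halted configuration has no successor, so it cannot reach `c'` in a positive number of
      -- steps.
      have e : flip bind M.step (some ⟨none, s, F⟩) = none := rfl
      rw [e] at h
      have : ∀ n, (flip bind M.step)^[n] none = none := fun n => by
        induction n with
        | zero => rfl
        | succ n ih => rw [Function.iterate_succ_apply]; exact ih
      rw [this] at h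
      exact absurd h (by simp)
    | some l =>
      obtain ⟨k, hk, hr⟩ := ih (Turing.TM2.stepAux (M.m l) s F) h
      obtain ⟨j, hj, hr'⟩ := runs_ofStmt (M.m l) x y s (some l) d i o F
      have hle : cost (M.m l) ≤ costM M := by
        let _ := M.ΛFin
        exact Finset.single_le_sum (f := fun l => cost (M.m l)) (fun _ _ => Nat.zero_le _)
          (Finset.mem_univ l)
      exact ⟨k + (j + 1) + 1, by rw [Nat.add_mul]; omega, .loop_true rfl (.case hr') hr⟩

/-- Read the code of a symbol from the main stack into the register. -/
def readSym : Prog M :=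
  .seq (.load fun v => (v.1, some none, v.2.2)) <| .seq (popR .main) <|
    .loop (fun v => v.1.getD false) <| .seq (popR .main) <|
      .seq (.load fun v => (v.1, v.2.1.map nextSym, v.2.2)) (popR .main)

theorem runs_popMain (s : Bool) (m a b c : List Bool) (i o) (F : ∀ k, List (M.Γ k)) (v : Sig M) :
    (popR .main).Runs v (store (regs (s :: m) a b c) i o F) (some s, v.2)
      (store (regs m a b c) i o F) 1 := by
  rw [← update_regs_main (s :: m) a b c m, ← update_store_inl]
  exact .pop

/-- A unary number is a sequence of pairs `true, false` closed by one `false`. Each pair advances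
the candidate symbol, and there are at most six. -/
theorem runs_readSym (s : Option Γ') (m : List Bool) (i o) (F : ∀ k, List (M.Γ k)) (v : Sig M) :
    ∃ k ≤ 60, readSym.Runs v (store (regs ((code s).enc ++ m) [] [] []) i o F)
      (some false, some s, v.2.2) (store (regs m [] [] []) i o F) k := by
  have key : ∀ (n : ℕ) (t : Option Γ'), ∃ k ≤ 7 * n + 3, (Cmd.seq (popR .main) <|
      .loop (fun v => v.1.getD false) <| .seq (popR .main) <|
      .seq (.load fun v => (v.1, v.2.1.map nextSym, v.2.2)) (popR .main)).Runs (v.1, some t, v.2.2)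
      (store (regs ((Dat.chain n).enc ++ m) [] [] []) i o F)
      (some false, some (nextSym^[n] t), v.2.2) (store (regs m [] [] []) i o F) k := by
    intro n
    generalize v.1 = x
    induction n generalizing x with
    | zero => intro t; exact ⟨_, le_rfl, .seq (runs_popMain _ _ _ _ _ _ _ _ _) (.loop_false rfl)⟩
    | succ n ih =>
      intro t
      obtain ⟨k, hk, hr⟩ := ih (some false) (nextSym t)
      cases hr with
      | seq h₁ h₂ =>
        refine ⟨_, ?_, .seq (runs_popMain _ _ _ _ _ _ _ _ _) (.loop_true rfl
          (.seq (runs_popMain _ _ _ _ _ _ _ _ _) (.seq .load h₁)) h₂)⟩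
        cases h₁
        omega
  obtain ⟨k, hk, hr⟩ := key (optNum s) none
  rw [← code_sym, iterate_nextSym] at hr
  have := optNum_le s
  exact ⟨_, by omega, .seq .load hr⟩

/-- Move a list of symbols from the main stack to the input stack of `M`. -/
def feed (ι : Option Γ' → M.Γ M.k₀) : Prog M :=
  .seq (popR .main) <| .loop (fun v => v.1.getD false) <| .seq readSym <|
    .seq (.push (.inr (.inr M.k₀)) fun v => ι (v.2.1.getD none)) (popR .main)

/-- Pushing one symbol after another reverses the list; for this reason `PT.call` asks for the
reversed input. -/
theorem runs_feed (ι : Option Γ' → M.Γ M.k₀) (l : List (Option Γ')) (m : List Bool) (i o)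
    (r : List (M.Γ M.k₀)) (v : Sig M) :
    ∃ v', ∃ k ≤ 70 * l.length + 3, (feed ι).Runs v
      (store (regs ((code l).enc ++ m) [] [] []) i o (Function.update (fun _ => []) M.k₀ r)) v'
      (store (regs m [] [] []) i o
        (Function.update (fun _ => []) M.k₀ ((l.map ι).reverse ++ r))) k := by
  induction l generalizing r v with
  | nil => exact ⟨_, 1 + 1 + 1, by simp, .seq (runs_popMain _ _ _ _ _ _ _ _ _) (.loop_false rfl)⟩
  | cons s l ih =>
    have hpop : (popR .main).Runs v (store (regs ((code (s :: l)).enc ++ m) [] [] []) i o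
      (Function.update (fun _ => []) M.k₀ r)) (some true, v.2) (store (regs ((code s).enc ++ ((code l).enc ++ m)) [] [] []) i o
      (Function.update (fun _ => []) M.k₀ r)) 1 := by
      simpa [enc_code_cons] using runs_popMain true ((code s).enc ++ ((code l).enc ++ m)) [] [] [] i o
        (Function.update (fun _ => []) M.k₀ r) v
    obtain ⟨k₁, hk₁, h₁⟩ := runs_readSym s ((code l).enc ++ m) i o
      (Function.update (fun _ => []) M.k₀ r) (some true, v.2)
    obtain ⟨v', k₂, hk₂, h₂⟩ := ih (ι s :: r) (some false, some s, v.2.2)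
    have hpush : (Cmd.push (.inr (.inr M.k₀)) fun v : Sig M => ι (v.2.1.getD none)).Runs
        (some false, some s, v.2.2) (store (regs ((code l).enc ++ m) [] [] []) i o
        (Function.update (fun _ => []) M.k₀ r)) (some false, some s, v.2.2)
        (store (regs ((code l).enc ++ m) [] [] []) i o
        (Function.update (fun _ => []) M.k₀ (ι s :: r))) 1 := by
      have : store (M := M) (regs ((code l).enc ++ m) [] [] []) i o
          (Function.update (fun _ => []) M.k₀ (ι s :: r)) = Function.update
          (store (regs ((code l).enc ++ m) [] [] []) i o (Function.update (fun _ => []) M.k₀ r))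
          (.inr (.inr M.k₀)) (ι s :: Function.update (fun _ => []) M.k₀ r M.k₀) := by
        rw [update_store_ext, Function.update_idem]; simp
      rw [this]
      exact .push
    cases h₂ with
    | seq h₃ h₄ =>
      refine ⟨v', _, ?_, .seq hpop (.loop_true rfl (.seq h₁ (.seq hpush h₃)) (by simpa using h₄))⟩
      cases h₃
      simp only [List.length_cons]
      omega

/-- Run `M` on a list of symbols and leave its answer on the main stack. -/
def call (ι : Option Γ' → M.Γ M.k₀) (φ : M.Γ M.k₁ → Bool) : Prog M :=
  .seq (feed ι) <| .seq (.load fun v => (v.1, v.2.1, M.initialState, some M.main)) <|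
    .seq (.loop (fun v => v.2.2.2.isSome) stepM) <|
    .seq (.pop (.inr (.inr M.k₁)) fun v o => (o.map φ, v.2)) <|
    .case fun v => pushWord (code (v.1.getD false)).enc

theorem initList_stk (s : List (M.Γ M.k₀)) :
    (Turing.initList M s).stk = Function.update (fun _ => []) M.k₀ s := by
  funext k
  by_cases h : k = M.k₀
  · subst h; simp [Turing.initList]
  · simp [Turing.initList, h]

theorem haltList_stk (s : List (M.Γ M.k₁)) :
    (Turing.haltList M s).stk = Function.update (fun _ => []) M.k₁ s := by
  funext k
  by_cases h : k = M.k₁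
  · subst h; simp [Turing.haltList]
  · simp [Turing.haltList, h]

/-- In the halting configuration of `TM2OutputsInTime` every stack except the output is empty.
Popping the one answer symbol therefore clears all stacks of `M`, and `M` can be called again later.
-/
theorem tri_call (ι : Option Γ' → M.Γ M.k₀) (φ : M.Γ M.k₁ ≃ Bool) (l : List (Option Γ')) (b : Bool)
    (n : ℕ) (h : Turing.TM2OutputsInTime M (l.reverse.map ι) (some [φ.symm b]) n) (m : List Bool) :
    Tri (call ι φ) (70 * l.length + 3 + n * (costM M + 2) + 30)
      (regs ((code l).enc ++ m) [] [] []) (regs ((code b).enc ++ m) [] [] []) := fun v => by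
  obtain ⟨⟨j, hj⟩, hjn⟩ := h
  obtain ⟨v₁, k₁, hk₁, h₁⟩ := runs_feed ι l m [] [] [] v
  obtain ⟨k₂, hk₂, h₂⟩ := runs_loop_stepM v₁.1 v₁.2.1 (regs m [] [] []) [] [] j _ _ hj rfl
  rw [initList_stk, haltList_stk] at h₂
  obtain ⟨v₃, k₃, hk₃, h₃⟩ := tri_pushWord (M := M) (code b).enc m [] [] []
    (some b, v₁.2.1, M.initialState, none)
  have e₁ : rst M (regs ((code l).enc ++ m) [] [] []) = store (regs ((code l).enc ++ m) [] [] []) [] []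
      (Function.update (fun _ => []) M.k₀ []) := by
    rw [Function.update_eq_self_iff.2 rfl]; rfl
  have hpop : (Cmd.pop (.inr (.inr M.k₁)) fun (v : Sig M) o => (o.map φ, v.2)).Runs
      (v₁.1, v₁.2.1, M.initialState, none) (store (regs m [] [] []) [] []
        (Function.update (fun _ => []) M.k₁ [φ.symm b]))
      (some b, v₁.2.1, M.initialState, none) (rst M (regs m [] [] [])) 1 := by
    have e₂ : rst M (regs m [] [] []) = Function.update (store (regs m [] [] []) [] []
        (Function.update (fun _ => []) M.k₁ [φ.symm b])) (.inr (.inr M.k₁))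
        (Function.update (fun _ => []) M.k₁ [φ.symm b] M.k₁).tail := by
      rw [update_store_ext, Function.update_idem]
      simp only [Function.update_self, List.tail_cons]
      rw [Function.update_eq_self_iff.2 rfl]; rfl
    have e₃ : (some b, v₁.2.1, M.initialState, none) = ((fun (v : Sig M) (o : Option (M.Γ M.k₁)) =>
        (o.map φ, v.2)) (v₁.1, v₁.2.1, M.initialState, none)
        (Function.update (β := fun k => List (M.Γ k)) (fun _ => []) M.k₁ [φ.symm b] M.k₁).head?) := by
      simp
    rw [e₂, e₃]
    exact .pop
  rw [List.append_nil, ← List.map_reverse] at h₁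
  refine ⟨v₃, _, ?_, .seq (e₁ ▸ h₁) (.seq .load (.seq h₂ (.seq hpop (.case h₃))))⟩
  have : j * (costM M + 2) ≤ n * (costM M + 2) := Nat.mul_le_mul_right (costM M + 2) hjn
  have := csize_bool_le b
  simp only [Dat.length_enc] at hk₃
  simp only [csize] at this
  omega

end Prog

variable {α β : Type} [Coded α] [Coded β]

theorem length_le_csize (l : List α) : l.length ≤ csize l := by
  induction l with
  | nil => simp
  | cons b l ih => rw [csize_cons]; simp; omega

/-- A predicate decided by `M` is polynomial-time relative to `M`. -/
theorem PT.call {V : List (List Γ') → Bool}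
    (H : Turing.TM2ComputableInPolyTime encodeWords Computability.encodeBool V)
    {g : α → List (List Γ')} (hg : PT H.tm fun a => (encodeWords (g a)).reverse) :
    PT H.tm fun a => V (g a) := by
  obtain ⟨c, p, hp⟩ := hg
  refine .intro (.seq c (Prog.call H.inputAlphabet.symm H.outputAlphabet))
    (p + (70 * p + (H.time.comp p) * .C (Prog.costM H.tm + 2) + 40)) 3
    (fun a => (csize_bool_le _).trans (by simp)) fun a m => ?_
  have hlen : (encodeWords (g a)).length ≤ p.eval (csize a) := by
    have := (length_le_csize _).trans (hp a).1
    simpa using this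
  have key := Prog.tri_call H.inputAlphabet.symm H.outputAlphabet (encodeWords (g a)).reverse
    (V (g a)) _ (by rw [List.reverse_reverse]; exact H.outputsFun (g a)) m
  refine (((hp a).2 m).seq key).mono ?_
  have := Nat.mul_le_mul_right (Prog.costM H.tm + 2) (eval_mono H.time hlen)
  simp only [Polynomial.eval_add, Polynomial.eval_mul, Polynomial.eval_comp,
      Polynomial.eval_ofNat, Polynomial.eval_C, List.length_reverse]
  omega

theorem csize_sym_le (s : Option Γ') : csize s ≤ 13 := by
  revert s; decide

-- Reading the input and writing the answer

namespace Prog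

theorem runs_pushWord (w : List Bool) (d : Reg → List Bool) (i o) (F : ∀ k, List (M.Γ k))
    (v : Sig M) : (pushWord w).Runs v (store d i o F) v
      (store (Function.update d .main (w ++ d .main)) i o F) (2 * w.length + 1) := by
  induction w with
  | nil =>
    rw [Function.update_eq_self_iff.2 (by simp)]
    exact .load
  | cons s w ih =>
    have h : (pushR .main s).Runs v (store (Function.update d .main (w ++ d .main)) i o F) v
        (store (Function.update d .main (s :: w ++ d .main)) i o F) 1 := by
      have : store (M := M) (Function.update d .main (s :: w ++ d .main)) i o F = Function.update
          (store (Function.update d .main (w ++ d .main)) i o F) (.inl .main)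
          (s :: Function.update d .main (w ++ d .main) .main) := by
        rw [update_store_inl, Function.update_idem]; simp
      rw [this]
      exact .push
    exact (show 2 * (s :: w).length + 1 = 1 + (2 * w.length + 1) + 1 by simp; omega) ▸ .seq ih h

/-- Pop a symbol from the input stack. -/
def popInp : Prog M := .pop (.inr (.inl (.inl ()))) fun v o => (v.1, o, v.2.2)

theorem runs_popInp (d) (l : List (Option Γ')) (o) (F : ∀ k, List (M.Γ k)) (v : Sig M) :
    popInp.Runs v (store d l o F) (v.1, l.head?, v.2.2) (store d l.tail o F) 1 := by
  rw [← update_store_inp d l o F l.tail]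
  exact .pop

/-- Move the input, reversed, to the main stack. -/
def readInput : Prog M :=
  .seq (pushWord [false]) <| .seq popInp <| .loop (fun v => v.2.1.isSome) <|
    .seq (.case fun v => pushWord (true :: (code (v.2.1.getD none)).enc)) popInp

/-- The list is built by putting cells in front while the word is read from the left, hence the
reversal, which later turns right-to-left scans of the input into left folds. -/
theorem runs_readInput (l : List (Option Γ')) (o) (F : ∀ k, List (M.Γ k)) (v : Sig M) :
    ∃ v', ∃ k ≤ 50 * l.length + 10, readInput.Runs v (store (regs [] [] [] []) l o F) v'
      (store (regs (code l.reverse).enc [] [] []) [] o F) k := by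
  have key : ∀ (r : List (Option Γ')) (v : Sig M), v.2.1 = l.head? → ∃ v', ∃ k ≤ 50 * l.length + 1,
      (Cmd.loop (fun v => v.2.1.isSome) <| .seq (.case fun v =>
        pushWord (true :: (code (v.2.1.getD none)).enc)) popInp).Runs v
      (store (regs (code r).enc [] [] []) l.tail o F) v'
      (store (regs (code (l.reverse ++ r)).enc [] [] []) [] o F) k := by
    induction l with
    | nil => intro r v hv; exact ⟨v, 1, by simp, .loop_false (by simp [hv])⟩
    | cons s l ih =>
      intro r v hv
      obtain ⟨v', k, hk, hr⟩ := ih (s :: r) (v.1, l.head?, v.2.2) rfl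
      have h := runs_pushWord (true :: (code s).enc) (regs (code r).enc [] [] []) l o F v
      rw [update_regs_main] at h
      have hs : v.2.1.getD none = s := by rw [hv]; rfl
      refine ⟨v', _, ?_, .loop_true (by simp [hv]) (.seq (.case (by rw [hs]; exact h))
        (runs_popInp _ _ _ _ _))
        (by simpa [enc_code_cons] using hr)⟩
      have := csize_sym_le s
      simp only [csize] at this
      simp only [List.length_cons, Dat.length_enc]
      omega
  obtain ⟨v', k, hk, hr⟩ := key [] (v.1, l.head?, v.2.2) rfl
  rw [List.append_nil] at hr
  have h := runs_pushWord [false] (regs [] [] [] []) l o F v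
  rw [update_regs_main] at h
  exact ⟨v', _, by simp; omega, .seq h (.seq (runs_popInp _ _ _ _ _) hr)⟩

/-- Move the answer to the output stack and clean up. -/
def writeOutput : Prog M :=
  .seq (popR .main) <| .seq (.case fun v => bif v.1.getD false then
    .seq (popR .main) (.seq (popR .main) (.push (.inr (.inl (.inr ()))) fun _ => true)) else
    .push (.inr (.inl (.inr ()))) fun _ => false)
    (.load fun _ => (none, none, M.initialState, none))

/-- The final configuration required of a machine has its initial register value, so the register is
reset after the answer is written. -/
theorem runs_writeOutput (b : Bool) (v : Sig M) : ∃ k ≤ 20, writeOutput.Runs v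
    (rst M (regs (code b).enc [] [] [])) (none, none, M.initialState, none)
    (store (regs [] [] [] []) [] [b] fun _ => []) k := by
  have hpush : ∀ (b : Bool) (v : Sig M), (Cmd.push (.inr (.inl (.inr ()))) fun _ => b).Runs v
      (rst M (regs [] [] [] [])) v (store (regs [] [] [] []) [] [b] fun _ => []) 1 := by
    intro b v
    rw [rst, ← update_store_out (M := M) _ _ [] _ [b]]
    exact .push
  cases b with
  | false => exact ⟨_, by omega, .seq (runs_popMain _ _ _ _ _ _ _ _ _) (.seq (.case (hpush _ _)) .load)⟩
  | true => exact ⟨_, by omega, .seq (runs_popMain _ _ _ _ _ _ _ _ _) (.seq (.case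
      (.seq (runs_popMain _ _ _ _ _ _ _ _ _) (.seq (runs_popMain _ _ _ _ _ _ _ _ _)
        (hpush _ _)))) .load)⟩

end Prog

variable (M) in
theorem store_empty : store (M := M) (regs [] [] [] []) [] [] (fun _ => []) = fun _ => [] := by
  funext k; rcases k with (_ | _ | _ | _) | (_ | _) | _ <;> rfl

instance : Fintype (Sig M) :=
  letI := M.ΛFin
  letI := M.σFin
  inferInstance

instance : Fintype (Stk M) :=
  letI := M.kFin
  inferInstance

/-- The Turing machine of a program that reads the input stack and writes the output stack. -/
noncomputable def Prog.machine (c : Prog M) : Turing.FinTM2 :=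
  c.toFinTM2 (.inr (.inl (.inl ()))) (.inr (.inl (.inr ()))) (none, none, M.initialState, none)

theorem Prog.outputs_machine {c : Prog M} {l : List (Option Γ')} {b : Bool} {m n : ℕ}
    (h : c.Runs (none, none, M.initialState, none) (store (regs [] [] [] []) l [] fun _ => [])
      (none, none, M.initialState, none) (store (regs [] [] [] []) [] [b] fun _ => []) n)
    (hm : n + 1 ≤ m) : Nonempty (Turing.TM2OutputsInTime c.machine l (some [b]) m) := by
  have h' := h.toFinTM2 (.inr (.inl (.inl ()))) (.inr (.inl (.inr ())))
    (none, none, M.initialState, none)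
  have e₁ := update_store_inp (M := M) (regs [] [] [] []) [] [] (fun _ => []) l
  have e₂ := update_store_out (M := M) (regs [] [] [] []) [] [] (fun _ => []) [b]
  rw [store_empty] at e₁ e₂
  rw [← e₁, ← e₂] at h'
  have i₁ : Turing.initList c.machine l = ⟨some c.machine.main, c.machine.initialState, _⟩ :=
    congrArg (fun S => (⟨some c.machine.main, c.machine.initialState, S⟩ : c.machine.Cfg))
      (Prog.initList_stk (M := c.machine) l)
  have i₂ : Turing.haltList c.machine [b] = ⟨none, c.machine.initialState, _⟩ :=
    congrArg (fun S => (⟨none, c.machine.initialState, S⟩ : c.machine.Cfg))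
      (Prog.haltList_stk (M := c.machine) [b])
  refine ⟨⟨⟨n + 1, ?_⟩, hm⟩⟩
  rw [i₁]
  refine Eq.trans ?_ (congrArg some i₂.symm)
  exact h'

/-- Predicates that are polynomial-time relative to a machine, as functions of the reversed input
word, are decided by a Turing machine in polynomial time. -/
theorem PT.polyTimeDecidable {W : List (List Γ') → Bool} {F : List (Option Γ') → Bool}
    (hF : PT M F) (hW : ∀ ws, W ws = F (encodeWords ws).reverse) : PolyTimeDecidable W := by
  obtain ⟨c, p, hp⟩ := hF
  let prog : Prog M := .seq Prog.readInput (.seq c Prog.writeOutput)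
  -- The input is read in at most 50 steps per symbol and becomes a list of size at most `14 *
  -- l.length + 1`: a symbol has size at most 13, and a list cell adds one.
  let q : Polynomial ℕ := 50 * .X + p.comp (14 * .X + 1) + 100
  have hsize : ∀ l : List (Option Γ'), csize l ≤ 14 * l.length + 1 := by
    intro l
    induction l with
    | nil => simp [csize_nil]
    | cons s l ih =>
      have := csize_sym_le s
      rw [csize_cons]; simp; omega
  have key : ∀ (l l' : List (Option Γ')) (b' : List Bool), l' = l → b' = [F l.reverse] →
      Nonempty (Turing.TM2OutputsInTime prog.machine l' (some b') (q.eval l.length)) := by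
    rintro _ l _ rfl rfl
    obtain ⟨v₁, k₁, hk₁, h₁⟩ := Prog.runs_readInput (M := M) l [] (fun _ => [])
      (none, none, M.initialState, none)
    obtain ⟨v₂, k₂, hk₂, h₂⟩ := (hp l.reverse).2 [] v₁
    obtain ⟨k₃, hk₃, h₃⟩ := Prog.runs_writeOutput (F l.reverse) v₂
    rw [List.append_nil, List.append_nil] at h₂
    refine Prog.outputs_machine (.seq h₁ (.seq h₂ h₃)) ?_
    have := eval_mono p (show csize l.reverse ≤ 14 * l.length + 1 by simpa using hsize l.reverse)
    simp only [q, Polynomial.eval_add, Polynomial.eval_mul, Polynomial.eval_comp,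
      Polynomial.eval_ofNat, Polynomial.eval_X, Polynomial.eval_one]
    omega
  refine ⟨⟨⟨prog.machine, Equiv.refl _, Equiv.refl _⟩, q, fun ws =>
    Classical.choice (key (encodeWords ws) _ _ (List.map_id _) ?_)⟩⟩
  rw [← hW]
  rfl

end HDRR

namespace HDRR

open Computability (Γ')
open Coded (code)

/-! ### A library of polynomial-time functions -/

variable {M : Turing.FinTM2}
variable {α β γ δ : Type} [Coded α] [Coded β] [Coded γ] [Coded δ]

theorem csize_le_of_mem {b : β} {l : List β} (h : b ∈ l) : csize b ≤ csize l := by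
  induction l with
  | nil => simp at h
  | cons c l ih =>
    rw [csize_cons]
    rcases List.mem_cons.1 h with rfl | h
    · omega
    · have := ih h; omega

theorem csize_append (l l' : List β) : csize (l ++ l') + 1 = csize l + csize l' := by
  induction l with
  | nil => simp [csize_nil, add_comm]
  | cons b l ih => rw [List.cons_append, csize_cons, csize_cons]; omega

theorem csize_tail_le (l : List β) : csize l.tail ≤ csize l := by
  cases l with
  | nil => exact le_rfl
  | cons b l => rw [csize_cons, List.tail_cons]; omega

theorem csize_le_of_forall_mem {l : List β} {n : ℕ} (h : ∀ b ∈ l, csize b ≤ n) :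
    csize l ≤ l.length * (n + 1) + 1 := by
  induction l with
  | nil => simp [csize_nil]
  | cons b l ih =>
    have h₁ := h b (by simp)
    have h₂ := ih fun c hc => h c (by simp [hc])
    rw [csize_cons, List.length_cons, Nat.add_mul]
    omega

theorem PT.csize_le {f : α → β} (hf : PT M f) :
    ∃ p : Polynomial ℕ, ∀ a, csize (f a) ≤ p.eval (csize a) :=
  let ⟨_, p, hp⟩ := hf; ⟨p, fun a => (hp a).1⟩

/-- Folds over lists in which every step adds a bounded amount to the size. -/
theorem PT.foldl_incr {f : α → List β} {g : α → γ} {h : α → γ → β → γ} (hf : PT M f) (hg : PT M g)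
    (hh : PT M fun p : α × γ × β => h p.1 p.2.1 p.2.2) (q : Polynomial ℕ)
    (hq : ∀ a c b, b ∈ f a → csize (h a c b) ≤ csize c + q.eval (csize a)) :
    PT M fun a => (f a).foldl (h a) (g a) := by
  obtain ⟨pf, hpf⟩ := hf.csize_le
  obtain ⟨pg, hpg⟩ := hg.csize_le
  refine PT.foldl hf hg hh (pg + pf * q) fun a l₁ l₂ e => ?_
  have key : csize (l₁.foldl (h a) (g a)) ≤ csize (g a) + l₁.length * q.eval (csize a) := by
    have hmem : ∀ b ∈ l₁, b ∈ f a := fun b hb => by rw [e]; exact List.mem_append_left _ hb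
    generalize g a = c
    clear e
    induction l₁ generalizing c with
    | nil => simp
    | cons b l ih =>
      have h₁ := ih (fun b hb => hmem b (by simp [hb])) (h a c b)
      have h₂ := hq a c b (hmem b (by simp))
      rw [List.foldl_cons, List.length_cons, Nat.add_mul]
      omega
  have hl : l₁.length ≤ pf.eval (csize a) := by
    have := length_le_csize (f a)
    have := hpf a
    rw [e, List.length_append] at *
    omega
  have := Nat.mul_le_mul_right (q.eval (csize a)) hl
  have := hpg a
  simp only [Polynomial.eval_add, Polynomial.eval_mul]
  omega

-- Boolean and list operations

theorem PT.cons {f : α → β} {g : α → List β} (hf : PT M f) (hg : PT M g) :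
    PT M fun a => f a :: g a :=
  PT.of_code (hf.pair hg) (fun a => a) (fun _ => rfl) fun _ => rfl

theorem PT.singleton {f : α → β} (hf : PT M f) : PT M fun a => [f a] := hf.cons (.const [])

theorem PT.some {f : α → β} (hf : PT M f) : PT M fun a => some (f a) :=
  PT.of_code ((PT.const Dat.nil).pair hf) (fun a => a) (fun _ => rfl) fun _ => rfl

theorem PT.isEmpty {f : α → List β} (hf : PT M f) : PT M fun a => (f a).isEmpty :=
  (PT.of_code (f := fun l : List β => l.isEmpty) PT.isNil code (fun _ => rfl) fun l => by
    cases l <;> rfl).comp hf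

theorem PT.tail {f : α → List β} (hf : PT M f) : PT M fun a => (f a).tail :=
  (PT.of_code (f := fun l : List β => l.tail) PT.tl code (fun _ => rfl) fun l => by
    cases l <;> rfl).comp hf

theorem PT.headD {f : α → List β} {g : α → β} (hf : PT M f) (hg : PT M g) :
    PT M fun a => (f a).headD (g a) := by
  have h : PT M fun t : Dat => bif t.hd.isNil then t.tl else t.hd.hd :=
    (PT.isNil.comp PT.hd).cond PT.tl (PT.hd.comp PT.hd)
  refine (PT.of_code (f := fun p : List β × β => p.1.headD p.2) h code (fun _ => rfl) ?_).comp
    (hf.pair hg)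
  rintro ⟨l, b⟩
  cases l <;> rfl

theorem PT.not {f : α → Bool} (hf : PT M f) : PT M fun a => !f a :=
  (hf.cond (.const false) (.const true)).congr fun a => by cases f a <;> rfl

theorem PT.and {f g : α → Bool} (hf : PT M f) (hg : PT M g) : PT M fun a => f a && g a :=
  (hf.cond hg (.const false)).congr fun a => by cases f a <;> rfl

theorem PT.or {f g : α → Bool} (hf : PT M f) (hg : PT M g) : PT M fun a => f a || g a :=
  (hf.cond (.const true) hg).congr fun a => by cases f a <;> rfl

theorem PT.beqBool {f g : α → Bool} (hf : PT M f) (hg : PT M g) : PT M fun a => f a == g a :=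
  (hf.cond hg hg.not).congr fun a => by cases f a <;> cases g a <;> rfl

theorem PT.reverse {f : α → List β} (hf : PT M f) : PT M fun a => (f a).reverse := by
  obtain ⟨p, hp⟩ := hf.csize_le
  refine (PT.foldl_incr (h := fun _ c b => b :: c) hf (.const [])
    (.cons (.snd (.snd .self)) (.fst (.snd .self))) (p + 1) fun a c b hb => ?_).congr fun a => by simp
  have := (csize_le_of_mem hb).trans (hp a)
  rw [csize_cons]; simp; omega

theorem PT.append {f g : α → List β} (hf : PT M f) (hg : PT M g) : PT M fun a => f a ++ g a := by
  obtain ⟨p, hp⟩ := hf.reverse.csize_le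
  refine (PT.foldl_incr (h := fun _ c b => b :: c) hf.reverse hg
    (.cons (.snd (.snd .self)) (.fst (.snd .self))) (p + 1) fun a c b hb => ?_).congr fun a => by simp
  have := (csize_le_of_mem hb).trans (hp a)
  rw [csize_cons]; simp; omega

theorem foldl_append_eq {β γ : Type} (l : List β) (g : β → List γ) (c : List γ) :
    l.foldl (fun c b => c ++ g b) c = c ++ l.flatMap g := by
  induction l generalizing c with
  | nil => simp
  | cons b l ih => rw [List.foldl_cons, ih, List.flatMap_cons, List.append_assoc]

/-- Members of `f a` are no larger than `f a`, so the bound for `g` becomes uniform over the list;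
this is the growth per step that `PT.foldl_incr` needs. -/
theorem PT.csize_le_mem {f : α → List β} {g : α → β → γ} (hf : PT M f)
    (hg : PT M fun p : α × β => g p.1 p.2) :
    ∃ p : Polynomial ℕ, ∀ a, ∀ b ∈ f a, csize (g a b) ≤ p.eval (csize a) := by
  obtain ⟨p, hp⟩ := hf.csize_le
  obtain ⟨q, hq⟩ := hg.csize_le
  refine ⟨q.comp (.X + p + 1), fun a b hb => (hq (a, b)).trans ?_⟩
  rw [Polynomial.eval_comp]
  apply eval_mono
  have := (csize_le_of_mem hb).trans (hp a)
  rw [csize_prod]; simp; omega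

theorem PT.flatMap {f : α → List β} {g : α → β → List γ} (hf : PT M f)
    (hg : PT M fun p : α × β => g p.1 p.2) : PT M fun a => (f a).flatMap (g a) := by
  obtain ⟨p, hp⟩ := hf.csize_le_mem hg
  refine (PT.foldl_incr (h := fun a c b => c ++ g a b) hf (.const [])
    (.append (.fst (.snd .self)) (hg.comp (.pair (.fst .self) (.snd (.snd .self))))) p
    fun a c b hb => ?_).congr fun a => by rw [foldl_append_eq, List.nil_append]
  have := csize_append c (g a b)
  have := hp a b hb
  omega

theorem PT.map {f : α → List β} {g : α → β → γ} (hf : PT M f)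
    (hg : PT M fun p : α × β => g p.1 p.2) : PT M fun a => (f a).map (g a) :=
  (hf.flatMap (g := fun a b => [g a b]) hg.singleton).congr fun a => by
    rw [List.map_eq_flatMap]

theorem PT.filter {f : α → List β} {g : α → β → Bool} (hf : PT M f)
    (hg : PT M fun p : α × β => g p.1 p.2) : PT M fun a => (f a).filter (g a) :=
  (hf.flatMap (g := fun a b => bif g a b then [b] else [])
    (hg.cond (.singleton (.snd .self)) (.const []))).congr fun a => by
    induction f a with
    | nil => rfl
    | cons b l ih => rw [List.filter_cons, List.flatMap_cons, ← ih]; cases g a b <;> rfl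

theorem PT.any {f : α → List β} {g : α → β → Bool} (hf : PT M f)
    (hg : PT M fun p : α × β => g p.1 p.2) : PT M fun a => (f a).any (g a) := by
  refine (PT.foldl (h := fun a c b => c || g a b) hf (.const false)
    (.or (.fst (.snd .self)) (hg.comp (.pair (.fst .self) (.snd (.snd .self))))) 3
    fun a l₁ l₂ _ => (csize_bool_le _).trans (by simp)).congr fun a => ?_
  have : ∀ (l : List β) (c : Bool), l.foldl (fun c b => c || g a b) c = (c || l.any (g a)) := by
    intro l
    induction l with
    | nil => simp
    | cons b l ih => intro c; rw [List.foldl_cons, ih, List.any_cons, Bool.or_assoc]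
  rw [this, Bool.false_or]

theorem PT.all {f : α → List β} {g : α → β → Bool} (hf : PT M f)
    (hg : PT M fun p : α × β => g p.1 p.2) : PT M fun a => (f a).all (g a) :=
  (hf.any (g := fun a b => !g a b) hg.not).not.congr fun a => by
    rw [List.all_eq_not_any_not]

theorem PT.foldr {f : α → List β} {g : α → γ} {h : α → β → γ → γ} (hf : PT M f) (hg : PT M g)
    (hh : PT M fun p : α × β × γ => h p.1 p.2.1 p.2.2) (q : Polynomial ℕ)
    (hq : ∀ a l₁ l₂, f a = l₁ ++ l₂ → csize (l₂.foldr (h a) (g a)) ≤ q.eval (csize a)) :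
    PT M fun a => (f a).foldr (h a) (g a) := by
  refine (PT.foldl (h := fun a c b => h a b c) hf.reverse hg
    (hh.comp (.pair (.fst .self) (.pair (.snd (.snd .self)) (.fst (.snd .self))))) q
    fun a l₁ l₂ e => ?_).congr fun a => by rw [List.foldl_reverse]
  have := hq a l₂.reverse l₁.reverse (by rw [← List.reverse_append, ← e, List.reverse_reverse])
  rwa [List.foldr_reverse] at this

theorem PT.foldr_incr {f : α → List β} {g : α → γ} {h : α → β → γ → γ} (hf : PT M f) (hg : PT M g)
    (hh : PT M fun p : α × β × γ => h p.1 p.2.1 p.2.2) (q : Polynomial ℕ)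
    (hq : ∀ a c b, b ∈ f a → csize (h a b c) ≤ csize c + q.eval (csize a)) :
    PT M fun a => (f a).foldr (h a) (g a) :=
  (PT.foldl_incr (h := fun a c b => h a b c) hf.reverse hg
    (hh.comp (.pair (.fst .self) (.pair (.snd (.snd .self)) (.fst (.snd .self))))) q
    fun a c b hb => hq a c b (List.mem_reverse.1 hb)).congr fun a => by rw [List.foldl_reverse]

/-! ### Equality tests -/

/-- Polish notation is a prefix code: the end of a tree is determined by its symbols. -/
theorem Dat.enc_append_inj {t t' : Dat} {r r' : List Bool} (h : t.enc ++ r = t'.enc ++ r') :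
    t = t' ∧ r = r' := by
  induction t generalizing t' r r' with
  | nil => cases t' <;> simp_all [Dat.enc]
  | cons x y ihx ihy =>
    cases t' with
    | nil => simp [Dat.enc] at h
    | cons x' y' =>
      simp only [Dat.enc, List.cons_append, List.append_assoc, List.cons.injEq, true_and] at h
      obtain ⟨rfl, h'⟩ := ihx h
      obtain ⟨rfl, h''⟩ := ihy h'
      exact ⟨rfl, h''⟩

theorem Dat.enc_injective : Function.Injective Dat.enc := fun t t' h =>
  (Dat.enc_append_inj (r := []) (r' := []) (by simpa using h)).1

/-- One pass over the first list consumes the second in parallel; the flag records agreement so far,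
and the second list must be used up at the end. -/
theorem PT.eqListBool {f g : α → List Bool} (hf : PT M f) (hg : PT M g) :
    PT M fun a => decide (f a = g a) := by
  have hstep : PT M fun p : α × (Bool × List Bool) × Bool =>
      ((p.2.1.1 && (!p.2.1.2.isEmpty && p.2.1.2.headD false == p.2.2)), p.2.1.2.tail) :=
    .pair (.and (.fst (.fst (.snd .self))) (.and (PT.not (.isEmpty (.snd (.fst (.snd .self)))))
      (.beqBool (.headD (.snd (.fst (.snd .self))) (.const false)) (.snd (.snd .self)))))
      (.tail (.snd (.fst (.snd .self))))
  have hfold := PT.foldl_incr (h := fun _ (c : Bool × List Bool) (b : Bool) =>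
    ((c.1 && (!c.2.isEmpty && c.2.headD false == b)), c.2.tail)) hf (.pair (.const true) hg) hstep 3
    fun a c b _ => by
      obtain ⟨c₁, c₂⟩ := c
      have := csize_bool_le (c₁ && (!c₂.isEmpty && c₂.headD false == b))
      have := csize_tail_le c₂
      simp only [csize_prod, Polynomial.eval_ofNat]
      omega
  refine (PT.and (.fst hfold) (.isEmpty (.snd hfold))).congr fun a => ?_
  have key : ∀ (l l' : List Bool) (c : Bool), (let r := l.foldl (fun (c : Bool × List Bool)
      (b : Bool) => ((c.1 && (!c.2.isEmpty && c.2.headD false == b)), c.2.tail)) (c, l')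
      (r.1 && r.2.isEmpty)) = (c && decide (l = l')) := by
    intro l
    induction l with
    | nil => intro l' c; cases l' <;> simp
    | cons b l ih =>
      intro l' c
      rw [List.foldl_cons, ih]
      cases l' with
      | nil => simp
      | cons b' l' =>
        rw [Bool.eq_iff_iff]
        cases c <;> cases b <;> cases b' <;> simp <;> exact decide_eq_true_iff
  have := key (f a) (g a) true
  simp only [Bool.true_and] at this
  exact this.symm

theorem PT.code' : PT M (fun a : α => code a) := PT.of_code PT.self code (fun _ => rfl) fun _ => rfl

/-- Codes are injective and so is Polish notation, so equality in any coded type reduces to equality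
of bit lists. -/
theorem PT.decEq [DecidableEq β] {f g : α → β} (hf : PT M f) (hg : PT M g) :
    PT M fun a => decide (f a = g a) :=
  (PT.eqListBool (PT.enc.comp (PT.code'.comp hf)) (PT.enc.comp (PT.code'.comp hg))).congr fun a => by
    rw [Bool.eq_iff_iff, decide_eq_true_iff, decide_eq_true_iff, Dat.enc_injective.eq_iff,
      Coded.code_injective.eq_iff]

theorem PT.mem [DecidableEq β] {f : α → β} {g : α → List β} (hf : PT M f) (hg : PT M g) :
    PT M fun a => decide (f a ∈ g a) :=
  (hg.any (g := fun a b => decide (f a = b)) (.decEq (hf.comp (.fst .self)) (.snd .self))).congr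
    fun a => by rw [Bool.eq_iff_iff]; simp

/-- Case distinction over finitely many values. -/
theorem PT.cases [Fintype β] [DecidableEq β] [Inhabited β] {f : α → β} {g : α → β → γ}
    (hf : PT M f) (hg : ∀ b, PT M fun a => g a b) : PT M fun a => g a (f a) := by
  have key : ∀ L : List β, ∃ G : α → γ, PT M G ∧ ∀ a, f a ∈ L → G a = g a (f a) := by
    intro L
    induction L with
    | nil => exact ⟨_, hg default, by simp⟩
    | cons b L ih =>
      obtain ⟨G, hG, h⟩ := ih
      refine ⟨_, PT.ite (c := fun a => f a = b) (.decEq hf (.const b)) (hg b) hG, fun a ha => ?_⟩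
      by_cases e : f a = b
      · simp [e]
      · rw [if_neg e]; exact h a ((List.mem_cons.1 ha).resolve_left e)
  obtain ⟨G, hG, h⟩ := key Finset.univ.toList
  exact hG.congr fun a => (h a (by simp)).symm

/-! ### Recursion over trees -/

/-- Structural recursion. -/
def Dat.fold {γ : Type} (z : γ) (h : γ → γ → γ) : Dat → γ
  | .nil => z
  | .cons a b => h (fold z h a) (fold z h b)

/-- One step of the evaluation of a tree in Polish notation, from right to left. -/
def polishStep {γ : Type} (z : γ) (h : γ → γ → γ) (b : Bool) (s : List γ) : List γ :=
  bif b then (bif s.tail.isEmpty then s else h (s.headD z) (s.tail.headD z) :: s.tail.tail)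
  else z :: s

theorem foldr_polishStep {γ : Type} (z : γ) (h : γ → γ → γ) (t : Dat) (w : List Bool) :
    (t.enc ++ w).foldr (polishStep z h) [] = t.fold z h :: w.foldr (polishStep z h) [] := by
  induction t generalizing w with
  | nil => rfl
  | cons x y ihx ihy =>
    rw [Dat.enc, List.cons_append, List.append_assoc, List.foldr_cons, ihx, ihy]
    rfl

/-- Bounds the intermediate stacks of the evaluation. Every entry is the value of a genuine tree of
size at most `N`, so a bound on the recursion over trees bounds the entries. A proper suffix of the
code of a node is a suffix of the left code followed by the right one, so the hypothesis for `y`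
feeds the one for `x`. -/
theorem foldr_polishStep_suffix {γ : Type} (z : γ) (h : γ → γ → γ) (N : ℕ) (t : Dat)
    (ht : t.size ≤ N) (w : List Bool)
    (hw : ∀ s, s <:+ w → (s.foldr (polishStep z h) []).length ≤ s.length ∧
      ∀ c ∈ s.foldr (polishStep z h) [], ∃ x : Dat, x.size ≤ N ∧ c = x.fold z h)
    (s : List Bool) (hs : s <:+ t.enc ++ w) : (s.foldr (polishStep z h) []).length ≤ s.length ∧
      ∀ c ∈ s.foldr (polishStep z h) [], ∃ x : Dat, x.size ≤ N ∧ c = x.fold z h := by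
  have whole : ∀ t : Dat, t.size ≤ N → ((t.enc ++ w).foldr (polishStep z h) []).length ≤
      (t.enc ++ w).length ∧ ∀ c ∈ (t.enc ++ w).foldr (polishStep z h) [],
        ∃ x : Dat, x.size ≤ N ∧ c = x.fold z h := by
    intro t ht
    rw [foldr_polishStep]
    have h₀ := hw w List.suffix_rfl
    have := t.size_pos
    refine ⟨by simp; omega, fun c hc => ?_⟩
    rcases List.mem_cons.1 hc with rfl | hc
    · exact ⟨t, ht, rfl⟩
    · exact h₀.2 c hc
  induction t generalizing w s with
  | nil =>
    rcases List.suffix_cons_iff.1 hs with rfl | hs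
    · exact whole .nil ht
    · exact hw s hs
  | cons x y ihx ihy =>
    have hx : x.size ≤ N := by simp only [Dat.size] at ht; omega
    have hy : y.size ≤ N := by simp only [Dat.size] at ht; omega
    rcases List.suffix_cons_iff.1 hs with rfl | hs'
    · exact whole (.cons x y) ht
    · rw [List.append_eq, List.append_assoc] at hs'
      have hw' := fun s hs => ihy hy w hw s hs whole
      refine ihx hx (y.enc ++ w) hw' s hs' fun (t : Dat) ht => ?_
      rw [foldr_polishStep]
      have h₀ := hw' (y.enc ++ w) List.suffix_rfl
      have := t.size_pos
      refine ⟨by simp only [List.length_cons, List.length_append, Dat.length_enc] at *; omega, fun c hc => ?_⟩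
      rcases List.mem_cons.1 hc with rfl | hc
      · exact ⟨t, ht, rfl⟩
      · exact h₀.2 c hc

/-- Evaluating Polish notation from right to left with a stack of values turns structural recursion
into a list fold. Values have to be bounded only for trees no larger than `d a`, since no others
arise. -/
theorem PT.datFold {d : α → Dat} {z : α → γ} {h : α → γ → γ → γ} (hd : PT M d) (hz : PT M z)
    (hh : PT M fun p : α × γ × γ => h p.1 p.2.1 p.2.2) (q : Polynomial ℕ)
    (hq : ∀ (a : α) (t : Dat), t.size ≤ (d a).size → csize (t.fold (z a) (h a)) ≤ q.eval (csize a)) :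
    PT M fun a => (d a).fold (z a) (h a) := by
  obtain ⟨p, hp⟩ := hd.csize_le
  have hs : PT M fun p : α × Bool × List γ => p.2.2 := .snd (.snd .self)
  have hz' : PT M fun p : α × Bool × List γ => z p.1 := hz.comp (.fst .self)
  have hstep : PT M fun p : α × Bool × List γ => polishStep (z p.1) (h p.1) p.2.1 p.2.2 :=
    .cond (.fst (.snd .self)) (.cond hs.tail.isEmpty hs (.cons (hh.comp (.pair (.fst .self)
      (.pair (hs.headD hz') (hs.tail.headD hz')))) hs.tail.tail)) (hz'.cons hs)
  refine (PT.headD (PT.foldr (h := fun a => polishStep (z a) (h a)) (PT.enc.comp hd) (.const [])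
    -- The stack has at most `p` entries, each of size at most `q`.
    hstep (p * (q + 1) + 1) fun a l₁ l₂ e => ?_) hz).congr fun a => ?_
  · obtain ⟨h₁, h₂⟩ := foldr_polishStep_suffix (z a) (h a) _ (d a) le_rfl []
      (fun s hs => by rw [List.suffix_nil.1 hs]; simp) l₂
      (by rw [List.append_nil, e]; exact List.suffix_append _ _)
    have h₃ := csize_le_of_forall_mem (l := l₂.foldr (polishStep (z a) (h a)) [])
      (n := q.eval (csize a)) fun c hc => by
        obtain ⟨x, hx, rfl⟩ := h₂ c hc
        exact hq a x hx
    have hl : l₂.length ≤ (d a).size := by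
      rw [← Dat.length_enc, e, List.length_append]; omega
    have := Nat.mul_le_mul_right (q.eval (csize a) + 1) ((h₁.trans hl).trans (hp a))
    simp only [Polynomial.eval_add, Polynomial.eval_mul, Polynomial.eval_one]
    omega
  · have := foldr_polishStep (z a) (h a) (d a) []
    rw [List.append_nil] at this
    rw [this]
    rfl

/-! ### Elements as data -/

mutual
/-- The tree that codes an element. -/
def Elem.toDat : Elem → Dat
  | .atom a => .cons .nil (code a)
  | .tuple l => .cons (.cons .nil .nil) (Elem.listDat l)
/-- The tree that codes a list of elements. -/
def Elem.listDat : List Elem → Dat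
  | [] => .nil
  | e :: l => .cons (Elem.toDat e) (Elem.listDat l)
end

mutual
theorem Elem.toDat_inj : ∀ e e' : Elem, e.toDat = e'.toDat → e = e'
  | .atom a, .atom b, h => by
    simp only [Elem.toDat, Dat.cons.injEq, true_and] at h
    rw [Coded.code_injective h]
  | .atom a, .tuple l, h => by simp [Elem.toDat] at h
  | .tuple l, .atom a, h => by simp [Elem.toDat] at h
  | .tuple l, .tuple l', h => by
    simp only [Elem.toDat, Dat.cons.injEq, true_and] at h
    rw [Elem.listDat_inj l l' h]
theorem Elem.listDat_inj : ∀ l l' : List Elem, Elem.listDat l = Elem.listDat l' → l = l'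
  | [], [], _ => rfl
  | [], e :: l, h => by simp [Elem.listDat] at h
  | e :: l, [], h => by simp [Elem.listDat] at h
  | e :: l, e' :: l', h => by
    simp only [Elem.listDat, Dat.cons.injEq] at h
    rw [Elem.toDat_inj e e' h.1, Elem.listDat_inj l l' h.2]
end

instance : Coded Elem := ⟨Elem.toDat, fun e e' h => Elem.toDat_inj e e' h⟩

theorem code_listElem (l : List Elem) : code l = Elem.listDat l := by
  induction l with
  | nil => rfl
  | cons e l ih => exact congrArg (Dat.cons e.toDat) ih

/-- Whether an element is a tuple. -/
def Elem.isTuple : Elem → Bool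
  | .atom _ => false
  | .tuple _ => true

/-- The name of an atom. -/
def Elem.bits : Elem → List Bool
  | .atom a => a
  | .tuple _ => []

/-- The components of a tuple. -/
def Elem.children : Elem → List Elem
  | .atom _ => []
  | .tuple l => l

theorem Elem.isTuple_iff {e : Elem} : e.isTuple = true ↔ e = .tuple e.children := by
  cases e <;> simp [Elem.isTuple, Elem.children]

theorem Elem.isTuple_eq_false_iff {e : Elem} : e.isTuple = false ↔ e = .atom e.bits := by
  cases e <;> simp [Elem.isTuple, Elem.bits]

theorem PT.atom {f : α → List Bool} (hf : PT M f) : PT M fun a => Elem.atom (f a) :=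
  PT.of_code ((PT.const Dat.nil).pair hf) (fun a => a) (fun _ => rfl) fun _ => rfl

theorem PT.tuple {f : α → List Elem} (hf : PT M f) : PT M fun a => Elem.tuple (f a) :=
  PT.of_code ((PT.const (Dat.cons .nil .nil)).pair hf) (fun a => a) (fun _ => rfl) fun a =>
    congrArg (Dat.cons _) (code_listElem (f a)).symm

theorem PT.isTuple {f : α → Elem} (hf : PT M f) : PT M fun a => (f a).isTuple :=
  (PT.of_code (f := Elem.isTuple) (PT.isNil.comp PT.hd).not code (fun _ => rfl) fun e => by
    cases e <;> rfl).comp hf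

theorem PT.bits {f : α → Elem} (hf : PT M f) : PT M fun a => (f a).bits :=
  (PT.of_code (f := Elem.bits) ((PT.isNil.comp PT.hd).cond PT.tl (.const .nil)) code
    (fun _ => rfl) fun e => by cases e <;> rfl).comp hf

theorem PT.children {f : α → Elem} (hf : PT M f) : PT M fun a => (f a).children :=
  (PT.of_code (f := Elem.children) ((PT.isNil.comp PT.hd).cond (.const .nil) PT.tl) code
    (fun _ => rfl) fun e => by
      cases e with
      | atom a => rfl
      | tuple l => exact code_listElem l).comp hf

/-! ### Writing elements as words -/

theorem csize_word_le (w : List Γ') : csize w ≤ 14 * w.length + 1 := by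
  have h : ∀ s : Γ', csize s ≤ 13 := by decide
  have := csize_le_of_forall_mem fun s (_ : s ∈ w) => h s
  omega

/-- The words of an element, of a name and of a list of elements, and whether the tree is a leaf. -/
def encStep (r₁ r₂ : List Γ' × List Γ' × List Γ' × Bool) : List Γ' × List Γ' × List Γ' × Bool :=
  (bif r₁.2.2.2 then r₂.2.1 ++ [Γ'.comma] else Γ'.bra :: (r₂.2.2.1 ++ [Γ'.ket]),
    (bif r₁.2.2.2 then Γ'.bit false else Γ'.bit true) :: r₂.2.1, r₁.1 ++ r₂.2.2.1, false)

/-- The words that a tree stands for. -/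
def Dat.words (t : Dat) : List Γ' × List Γ' × List Γ' × Bool := t.fold ([], [], [], true) encStep

theorem Dat.words_cons (a b : Dat) : (Dat.cons a b).words = encStep a.words b.words := rfl

theorem Dat.words_bits (l : List Bool) : (code l).words.2.1 = l.map Γ'.bit := by
  induction l with
  | nil => rfl
  | cons b l ih =>
    change (encStep (code b).words (code l).words).2.1 = _
    simp only [encStep, ih, List.map_cons]
    cases b <;> rfl

-- A subtree of a code may stand for an element, a name or a list of elements, and a fold does not
-- know which. All readings are computed together, and the tag in the left subtree, a leaf exactly
-- for atoms, selects the right one.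
mutual
theorem Dat.words_elem : ∀ e : Elem, e.toDat.words.1 = e.encode
  | .atom a => by
    rw [Elem.toDat, Elem.encode, Dat.words_cons, encStep, Dat.words_bits]
    rfl
  | .tuple l => by
    rw [Elem.toDat, Elem.encode, Dat.words_cons, encStep, Dat.words_list l]
    rfl
theorem Dat.words_list : ∀ l : List Elem, (Elem.listDat l).words.2.2.1 = Elem.encodeList l
  | [] => rfl
  | e :: l => by
    rw [Elem.listDat, Elem.encodeList, Dat.words_cons, encStep, Dat.words_elem e, Dat.words_list l]
end

/-- The bound also covers readings that make no sense for the given tree, because the fold computes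
them as well. -/
theorem Dat.length_words (t : Dat) : t.words.1.length ≤ 2 * t.size ∧
    t.words.2.1.length ≤ t.size ∧ t.words.2.2.1.length ≤ 2 * t.size := by
  induction t with
  | nil => simp [Dat.words, Dat.fold]
  | cons a b iha ihb =>
    rw [Dat.words_cons, encStep]
    simp only [List.length_cons, List.length_append, Dat.size]
    refine ⟨?_, by omega, by omega⟩
    cases a.words.2.2.2 <;> simp <;> omega

theorem PT.words : PT M Dat.words := by
  have h₁ : PT M fun p : Dat × (List Γ' × List Γ' × List Γ' × Bool) ×
    (List Γ' × List Γ' × List Γ' × Bool) => p.2.1 := .fst (.snd .self)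
  have h₂ : PT M fun p : Dat × (List Γ' × List Γ' × List Γ' × Bool) ×
    (List Γ' × List Γ' × List Γ' × Bool) => p.2.2 := .snd (.snd .self)
  refine PT.datFold PT.self (.const ([], [], [], true)) (h := fun _ => encStep)
    (.pair (.cond h₁.snd.snd.snd (.append h₂.snd.fst (.const [Γ'.comma]))
      (.cons (.const Γ'.bra) (.append h₂.snd.snd.fst (.const [Γ'.ket]))))
      (.pair (.cons (.cond h₁.snd.snd.snd (.const (Γ'.bit false)) (.const (Γ'.bit true)))
        h₂.snd.fst) (.pair (.append h₁.fst h₂.snd.snd.fst) (.const false)))) (70 * .X + 10)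
    fun a t ht => ?_
  have h := t.length_words
  have s₁ := csize_word_le t.words.1
  have s₂ := csize_word_le t.words.2.1
  have s₃ := csize_word_le t.words.2.2.1
  have s₄ := csize_bool_le t.words.2.2.2
  change csize (t.words.1, t.words.2.1, t.words.2.2.1, t.words.2.2.2) ≤ _
  change t.size ≤ csize a at ht
  rw [csize_prod, csize_prod, csize_prod]
  simp only [Polynomial.eval_add, Polynomial.eval_mul, Polynomial.eval_X, Polynomial.eval_ofNat]
  omega

theorem PT.encode {f : α → Elem} (hf : PT M f) : PT M fun a => (f a).encode :=
  (PT.fst (PT.words.comp (PT.code'.comp hf))).congr fun a => (Dat.words_elem (f a)).symm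

/-! ### Occurrence -/

theorem Elem.occurs_atom {x : Elem} {a : Atom} : x.Occurs (.atom a) ↔ x = .atom a :=
  ⟨fun h => by cases h; rfl, fun h => h ▸ .refl⟩

theorem Elem.occurs_tuple {x : Elem} {l : List Elem} :
    x.Occurs (.tuple l) ↔ x = .tuple l ∨ ∃ e ∈ l, x.Occurs e := by
  constructor
  · intro h
    cases h with
    | refl => exact .inl rfl
    | comp he h => exact .inr ⟨_, he, h⟩
  · rintro (rfl | ⟨e, he, h⟩)
    · exact .refl
    · exact .comp he h

/-- The tree itself, whether `x` occurs in the element and in the list of elements it stands for. -/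
def occStep (x : Dat) (r₁ r₂ : Dat × Bool × Bool) : Dat × Bool × Bool :=
  (.cons r₁.1 r₂.1, decide (Dat.cons r₁.1 r₂.1 = x) || (!r₁.1.isNil && r₂.2.2), r₁.2.1 || r₂.2.2)

/-- Evaluation of `occStep`. -/
def Dat.occ (x t : Dat) : Dat × Bool × Bool := t.fold (.nil, false, false) (occStep x)

theorem Dat.occ_eq (x a b : Dat) : Dat.occ x (.cons a b) = occStep x (Dat.occ x a) (Dat.occ x b) :=
  rfl

theorem Dat.occ_fst (x t : Dat) : (Dat.occ x t).1 = t := by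
  induction t with
  | nil => rfl
  | cons a b iha ihb => rw [Dat.occ_eq, occStep, iha, ihb]

-- The tree itself is carried along to be compared with `x`. Testing the tag for a leaf prevents the
-- bits of a name from being searched as if they were a list of elements.
mutual
theorem Dat.occ_elem (x : Elem) : ∀ e : Elem, (Dat.occ x.toDat e.toDat).2.1 = true ↔ x.Occurs e
  | .atom a => by
    rw [Elem.occurs_atom, Elem.toDat, Dat.occ_eq, occStep, Dat.occ_fst, Dat.occ_fst]
    rw [show Dat.cons .nil (code a) = (Elem.atom a).toDat from rfl]
    simp only [Dat.isNil, Bool.not_true, Bool.false_and, Bool.or_false, decide_eq_true_iff]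
    exact ⟨fun h => (Elem.toDat_inj _ _ h).symm, fun h => by rw [h]⟩
  | .tuple l => by
    rw [Elem.occurs_tuple, Elem.toDat, Dat.occ_eq, occStep, Dat.occ_fst, Dat.occ_fst]
    rw [show Dat.cons (.cons .nil .nil) (Elem.listDat l) = (Elem.tuple l).toDat from rfl]
    simp only [Dat.isNil, Bool.not_false, Bool.true_and, Bool.or_eq_true, decide_eq_true_iff]
    rw [Dat.occ_list x l]
    exact or_congr ⟨fun h => (Elem.toDat_inj _ _ h).symm, fun h => by rw [h]⟩ Iff.rfl
theorem Dat.occ_list (x : Elem) : ∀ l : List Elem,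
    (Dat.occ x.toDat (Elem.listDat l)).2.2 = true ↔ ∃ e ∈ l, x.Occurs e
  | [] => by simp [Elem.listDat, Dat.occ, Dat.fold]
  | e :: l => by
    rw [Elem.listDat, Dat.occ_eq, occStep, Bool.or_eq_true, Dat.occ_elem x e, Dat.occ_list x l]
    simp
end

/-- Decides whether an element occurs in another one. -/
def Elem.occursB (x e : Elem) : Bool := (Dat.occ x.toDat e.toDat).2.1

theorem Elem.occursB_iff {x e : Elem} : x.occursB e = true ↔ x.Occurs e := Dat.occ_elem x e

theorem PT.datCons {f g : α → Dat} (hf : PT M f) (hg : PT M g) :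
    PT M fun a => Dat.cons (f a) (g a) :=
  PT.of_code (hf.pair hg) (fun a => a) (fun _ => rfl) fun _ => rfl

theorem PT.occurs {f g : α → Elem} (hf : PT M f) (hg : PT M g) :
    PT M fun a => (f a).occursB (g a) := by
  have h : PT M fun p : Dat × Dat => Dat.occ p.1 p.2 := by
    have h₁ : PT M fun p : (Dat × Dat) × (Dat × Bool × Bool) × (Dat × Bool × Bool) => p.2.1 :=
      .fst (.snd .self)
    have h₂ : PT M fun p : (Dat × Dat) × (Dat × Bool × Bool) × (Dat × Bool × Bool) => p.2.2 :=
      .snd (.snd .self)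
    refine PT.datFold (h := fun p : Dat × Dat => occStep p.1) (.snd .self)
      (.const (Dat.nil, false, false)) (.pair (.datCons h₁.fst h₂.fst)
        (.pair (.or (.decEq (.datCons h₁.fst h₂.fst) (.fst (.fst .self)))
          (.and (.not (PT.isNil.comp h₁.fst)) h₂.snd.snd)) (.or h₁.snd.fst h₂.snd.snd)))
      (.X + 8) fun a t ht => ?_
    change csize ((Dat.occ a.1 t).1, (Dat.occ a.1 t).2.1, (Dat.occ a.1 t).2.2) ≤ _
    have s₁ := csize_bool_le (Dat.occ a.1 t).2.1
    have s₂ := csize_bool_le (Dat.occ a.1 t).2.2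
    rw [csize_prod, csize_prod, Dat.occ_fst, show csize a = csize a.1 + csize a.2 + 1 from rfl]
    change t.size ≤ csize a.2 at ht
    change t.size + _ + _ ≤ _
    simp only [Polynomial.eval_add, Polynomial.eval_X, Polynomial.eval_ofNat]
    omega
  exact PT.snd'.comp h |>.fst.comp ((PT.code'.comp hf).pair (PT.code'.comp hg))

/-! ### Reading elements from words -/

/-- One step of the parser, which reads from right to left and keeps a stack of open lists; the
empty stack signals failure. -/
def parseStep : Γ' → List (List Elem) → List (List Elem)
  | .bit b, (.atom a :: f) :: s => (.atom (b :: a) :: f) :: s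
  | .comma, f :: s => (.atom [] :: f) :: s
  | .ket, f :: s => [] :: f :: s
  | .bra, f :: g :: s => (.tuple f :: g) :: s
  | _, _ => []

/-- The element that is encoded by a word (a junk value if there is none). -/
def Elem.parse (w : List Γ') : Elem := ((w.foldr parseStep [[]]).headD []).headD (.atom [])

-- Read from right to left, a closing bracket opens a list, an opening bracket completes it, a comma
-- starts an atom, and bits are added in front of that atom.
mutual
theorem foldr_parseStep_encode : ∀ (e : Elem) (f : List Elem) (s : List (List Elem)),
    e.encode.foldr parseStep (f :: s) = (e :: f) :: s
  | .atom a, f, s => by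
    rw [Elem.encode, List.foldr_append]
    change (a.map Γ'.bit).foldr parseStep ((.atom [] :: f) :: s) = _
    induction a with
    | nil => rfl
    | cons b a ih => rw [List.map_cons, List.foldr_cons, ih]; rfl
  | .tuple l, f, s => by
    rw [Elem.encode, List.foldr_cons, List.foldr_append]
    change parseStep .bra ((Elem.encodeList l).foldr parseStep ([] :: f :: s)) = _
    rw [foldr_parseStep_encodeList l, List.append_nil]
    rfl
theorem foldr_parseStep_encodeList : ∀ (l f : List Elem) (s : List (List Elem)),
    (Elem.encodeList l).foldr parseStep (f :: s) = (l ++ f) :: s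
  | [], f, s => rfl
  | e :: l, f, s => by
    rw [Elem.encodeList, List.foldr_append, foldr_parseStep_encodeList l,
      foldr_parseStep_encode e]
    rfl
end

theorem Elem.parse_encode (e : Elem) : Elem.parse e.encode = e := by
  rw [Elem.parse, foldr_parseStep_encode e]; rfl

theorem Elem.encode_injective : Function.Injective Elem.encode :=
  Function.LeftInverse.injective Elem.parse_encode

theorem csize_atom (a : List Bool) : csize (Elem.atom a) = csize a + 2 := by
  change 1 + csize a + 1 = _; omega

theorem csize_tuple (l : List Elem) : csize (Elem.tuple l) = csize l + 4 := by
  change 3 + (Elem.listDat l).size + 1 = _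
  rw [← code_listElem, csize]; omega

theorem csize_parseStep_le (b : Γ') (s : List (List Elem)) :
    csize (parseStep b s) ≤ csize s + 10 := by
  unfold parseStep
  split
  · rename_i b a f s
    have := csize_bool_le b
    simp only [csize_cons, csize_atom]; omega
  · simp only [csize_cons, csize_atom, csize_nil]; omega
  · simp only [csize_cons, csize_nil]; omega
  · simp only [csize_cons, csize_tuple]; omega
  · rw [csize_nil]; omega

theorem PT.parseStep {f : α → Γ'} {g : α → List (List Elem)} (hf : PT M f) (hg : PT M g) :
    PT M fun a => parseStep (f a) (g a) := by
  have h₁ : PT M fun a => (g a).headD [] := hg.headD (.const [])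
  have h₂ : PT M fun a => (g a).tail.headD [] := hg.tail.headD (.const [])
  have h₃ : PT M fun a => ((g a).headD []).headD (.tuple []) := h₁.headD (.const _)
  refine PT.cases (g := fun a b => HDRR.parseStep b (g a)) hf fun b => ?_
  cases b with
  | blank => exact PT.const []
  | bit b =>
    refine (PT.cond h₃.isTuple (.const []) (.cons (.cons (.atom (.cons (.const b) h₃.bits))
      h₁.tail) hg.tail)).congr fun a => ?_
    rcases g a with _ | ⟨_ | ⟨_ | _, f⟩, s⟩ <;> rfl
  | bra =>
    refine (PT.cond hg.tail.isEmpty (.const []) (.cons (.cons (.tuple h₁) h₂)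
      hg.tail.tail)).congr fun a => ?_
    rcases g a with _ | ⟨f, _ | ⟨f', s⟩⟩ <;> rfl
  | ket =>
    refine (PT.cond hg.isEmpty (.const []) (.cons (.const []) hg)).congr fun a => ?_
    rcases g a with _ | ⟨f, s⟩ <;> rfl
  | comma =>
    refine (PT.cond hg.isEmpty (.const []) (.cons (.cons (.const (Elem.atom [])) h₁)
      hg.tail)).congr fun a => ?_
    rcases g a with _ | ⟨f, s⟩ <;> rfl

theorem PT.parse {f : α → List Γ'} (hf : PT M f) : PT M fun a => Elem.parse (f a) :=
  .headD (.headD (PT.foldr_incr (h := fun _ => HDRR.parseStep) hf (.const [[]])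
    (.parseStep (.fst (.snd .self)) (.snd (.snd .self))) 10
    fun _ c b _ => (csize_parseStep_le b c).trans (by simp)) (.const [])) (.const (Elem.atom []))

/-! ### Binary numbers -/

/-- The value of a binary number, least significant bit first. -/
def bitsVal : List Bool → ℕ
  | [] => 0
  | b :: l => b.toNat + 2 * bitsVal l

theorem bitsVal_encodeNat (n : ℕ) : bitsVal (Computability.encodeNat n) = n := by
  have h : ∀ p : PosNum, bitsVal (Computability.encodePosNum p) = (p : ℕ) := by
    intro p
    induction p with
    | one => rfl
    | bit1 p ih => simp [Computability.encodePosNum, bitsVal, ih]; omega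
    | bit0 p ih => simp [Computability.encodePosNum, bitsVal, ih]; omega
  rw [Computability.encodeNat]
  conv_rhs => rw [← Num.to_of_nat n]
  cases (n : Num) with
  | zero => rfl
  | pos p => exact h p

/-- Whether a list of bits has no leading zero. -/
def isBinary (l : List Bool) : Bool := l.isEmpty || l.reverse.headD false

theorem exists_encodePosNum (b : Bool) (l : List Bool)
    (h : ((b :: l).reverse.headD false) = true) : ∃ p, b :: l = Computability.encodePosNum p := by
  induction l generalizing b with
  | nil =>
    have : b = true := by simpa using h
    exact ⟨.one, by rw [this]; rfl⟩
  | cons c l ih =>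
    obtain ⟨p, hp⟩ := ih c (by
      rw [List.reverse_cons] at h
      rcases hr : (c :: l).reverse with _ | ⟨x, r⟩
      · simp at hr
      · rw [hr] at h; exact h)
    cases b with
    | false => exact ⟨.bit0 p, by rw [hp]; rfl⟩
    | true => exact ⟨.bit1 p, by rw [hp]; rfl⟩

/-- The least significant bit comes first, so canonical numerals are the empty word and the words
ending in `true`. The test rejects inputs in which a number is padded with zeros. -/
theorem isBinary_iff (l : List Bool) : isBinary l = true ↔ ∃ n, l = Computability.encodeNat n := by
  constructor
  · intro h
    cases l with
    | nil => exact ⟨0, rfl⟩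
    | cons b l =>
      obtain ⟨p, hp⟩ := exists_encodePosNum b l (by simpa [isBinary] using h)
      exact ⟨((Num.pos p : Num) : ℕ), by rw [hp, Computability.encodeNat, Num.of_to_nat]; rfl⟩
  · rintro ⟨n, rfl⟩
    have h : ∀ p : PosNum, (Computability.encodePosNum p).reverse.headD false = true := by
      intro p
      induction p with
      | one => rfl
      | bit1 p ih | bit0 p ih =>
        rw [Computability.encodePosNum, List.reverse_cons]
        rcases hr : (Computability.encodePosNum p).reverse with _ | ⟨x, r⟩
        · rw [hr] at ih; simp at ih
        · rw [hr] at ih; exact ih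
    rw [Computability.encodeNat, isBinary]
    cases (n : Num) with
    | zero => rfl
    | pos p => rw [Computability.encodeNum, h p, Bool.or_true]

theorem PT.isBinary {f : α → List Bool} (hf : PT M f) : PT M fun a => isBinary (f a) :=
  .or hf.isEmpty (.headD hf.reverse (.const false))

/-- Every other element of a list, starting with the first. -/
def halfStep (c : Bool × List Bool) (b : Bool) : Bool × List Bool :=
  (!c.1, bif c.1 then c.2 else b :: c.2)

/-- A list of half the length, rounded up. -/
def half (l : List Bool) : List Bool := (l.foldl halfStep (false, [])).2

theorem length_half (l : List Bool) : (half l).length = (l.length + 1) / 2 := by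
  have h : ∀ (l : List Bool) (c : Bool × List Bool),
      (l.foldl halfStep c).2.length = c.2.length + (l.length + (!c.1).toNat) / 2 := by
    intro l
    induction l with
    | nil => intro c; rcases c with ⟨_ | _, c⟩ <;> simp
    | cons b l ih =>
      intro c
      rw [List.foldl_cons, ih]
      rcases c with ⟨_ | _, c⟩ <;> simp [halfStep] <;> omega
  simpa [half] using h l (false, [])

theorem csize_listBool_le (l : List Bool) : csize l ≤ 4 * l.length + 1 := by
  have := csize_le_of_forall_mem fun b (_ : b ∈ l) => csize_bool_le b
  omega

theorem PT.half {f : α → List Bool} (hf : PT M f) : PT M fun a => half (f a) := by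
  have h₁ : PT M fun p : α × (Bool × List Bool) × Bool => p.2.1 := .fst (.snd .self)
  refine .snd (PT.foldl_incr (h := fun _ => halfStep) hf (.const (false, []))
    (.pair h₁.fst.not (.cond h₁.fst h₁.snd (.cons (.snd (.snd .self)) h₁.snd))) 10
    fun a c b _ => ?_)
  have := csize_bool_le (!c.1)
  have := csize_bool_le b
  have := csize_pos c.1
  rw [show csize c = csize c.1 + csize c.2 + 1 from rfl, halfStep, csize_prod]
  have : csize (bif c.1 then c.2 else b :: c.2) ≤ csize c.2 + csize b + 1 := by
    cases c.1 <;> simp only [cond_true, cond_false, csize_cons] <;> omega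
  simp only [Polynomial.eval_ofNat]
  omega

/-- Decides whether the length of a list is at most a number in binary. -/
def lengthLe (l bits : List Bool) : Bool :=
  (bits.foldl (fun l b => half (bif b then l.tail else l)) l).isEmpty

/-- A length `n` is at most `b + 2 * v` iff the half, rounded up, of `n` diminished by `b`
(truncated at zero) is at most `v`. The binary number, possibly exponential in the number of its
bits, is never written in unary. -/
theorem lengthLe_iff (l bits : List Bool) : lengthLe l bits = true ↔ l.length ≤ bitsVal bits := by
  rw [lengthLe]
  induction bits generalizing l with
  | nil => cases l <;> simp [bitsVal]
  | cons b bits ih =>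
    rw [List.foldl_cons, ih, length_half, bitsVal]
    cases b <;> simp <;> omega

theorem PT.lengthLe {f g : α → List Bool} (hf : PT M f) (hg : PT M g) :
    PT M fun a => lengthLe (f a) (g a) := by
  obtain ⟨p, hp⟩ := hf.csize_le
  have h₁ : PT M fun p : α × List Bool × Bool => p.2.1 := .fst (.snd .self)
  refine .isEmpty (PT.foldl (h := fun _ l b => HDRR.half (bif b then l.tail else l)) hg hf
    (.half (.cond (.snd (.snd .self)) h₁.tail h₁)) (4 * p + 1) fun a l₁ l₂ _ => ?_)
  have key : ∀ bits l : List Bool,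
      (bits.foldl (fun l b => HDRR.half (bif b then l.tail else l)) l).length ≤ l.length := by
    intro bits
    induction bits with
    | nil => intro l; exact le_rfl
    | cons b bits ih =>
      intro l
      rw [List.foldl_cons]
      refine (ih _).trans ?_
      rw [length_half]
      cases b <;> simp <;> omega
  have h₂ := csize_listBool_le (l₁.foldl (fun l b => HDRR.half (bif b then l.tail else l)) (f a))
  have h₃ := key l₁ (f a)
  have h₄ := (length_le_csize (f a)).trans (hp a)
  simp only [Polynomial.eval_add, Polynomial.eval_mul, Polynomial.eval_one, Polynomial.eval_ofNat]
  omega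

/-! ### Lists of elements as sets -/

theorem PT.dedup {f : α → List Elem} (hf : PT M f) : PT M fun a => (f a).dedup := by
  obtain ⟨p, hp⟩ := hf.csize_le
  refine (PT.foldr_incr (h := fun _ (x : Elem) c => if x ∈ c then c else x :: c) hf (.const [])
    (.ite (.mem (.fst (.snd .self)) (.snd (.snd .self))) (.snd (.snd .self))
      (.cons (.fst (.snd .self)) (.snd (.snd .self)))) (p + 1) fun a c b hb => ?_).congr fun a => ?_
  · have := (csize_le_of_mem hb).trans (hp a)
    simp only [Polynomial.eval_add, Polynomial.eval_one]
    split
    · omega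
    · rw [csize_cons]; omega
  · induction f a with
    | nil => rfl
    | cons x l ih =>
      rw [List.foldr_cons, ← ih]
      by_cases h : x ∈ l
      · rw [List.dedup_cons_of_mem h, if_pos (List.mem_dedup.2 h)]
      · rw [List.dedup_cons_of_notMem h, if_neg (by rwa [List.mem_dedup])]

/-- One step of the test for disjointness: the flag, and the union of the lists seen so far. -/
noncomputable def disjointStep (l : List Elem) (c : Bool × List Elem) : Bool × List Elem :=
  (c.1 && l.all fun x => !decide (x ∈ c.2), l ++ c.2)

/-- Decides whether lists are pairwise disjoint. -/
noncomputable def pairwiseDisjoint (ls : List (List Elem)) : Bool := (ls.foldr disjointStep (true, [])).1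

/-- The second component of the fold is the concatenation of the later lists, and being disjoint
from it means being disjoint from each of them. -/
theorem pairwiseDisjoint_iff (ls : List (List Elem)) :
    pairwiseDisjoint ls = true ↔ (ls.map List.toFinset).Pairwise Disjoint := by
  have h : ∀ ls : List (List Elem), (ls.foldr disjointStep (true, [])).2 = ls.flatten := by
    intro ls
    induction ls with
    | nil => rfl
    | cons l ls ih => rw [List.foldr_cons, disjointStep, ih, List.flatten_cons]
  rw [pairwiseDisjoint]
  induction ls with
  | nil => simp
  | cons l ls ih =>
    rw [List.foldr_cons, disjointStep, Bool.and_eq_true, List.map_cons, List.pairwise_cons, h]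
    refine and_comm.trans (and_congr ?_ ih)
    simp only [List.all_eq_true, Bool.not_eq_true', decide_eq_false_iff_not, List.mem_flatten,
      List.mem_map, forall_exists_index, and_imp, forall_apply_eq_imp_iff₂,
      Finset.disjoint_left, List.mem_toFinset, not_exists, not_and]
    exact ⟨fun h l' hl' x hx => h x hx l' hl', fun h x hx l' hl' => h l' hl' hx⟩

theorem PT.pairwiseDisjoint {f : α → List (List Elem)} (hf : PT M f) :
    PT M fun a => pairwiseDisjoint (f a) := by
  obtain ⟨p, hp⟩ := hf.csize_le
  have h₁ : PT M fun p : α × List Elem × Bool × List Elem => p.2.2 := .snd (.snd .self)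
  refine .fst (PT.foldr_incr (h := fun _ => disjointStep) hf (.const (true, []))
    (.pair (.and h₁.fst (.all (g := fun (p : α × List Elem × Bool × List Elem) x =>
      !decide (x ∈ p.2.2.2)) (.fst (.snd .self)) (.not (.mem (.snd .self) (h₁.snd.comp (.fst .self))))))
      (.append (.fst (.snd .self)) h₁.snd)) (p + 3) fun a c b hb => ?_)
  have h₂ := csize_append b c.2
  have h₃ := (csize_le_of_mem hb).trans (hp a)
  have h₄ := csize_bool_le (c.1 && b.all fun x => !decide (x ∈ c.2))
  rw [show csize c = csize c.1 + csize c.2 + 1 from rfl, disjointStep, csize_prod]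
  simp only [Polynomial.eval_add, Polynomial.eval_ofNat]
  omega

/-- Decides inclusion of lists as sets. -/
noncomputable def subsetB (l l' : List Elem) : Bool := l.all fun x => decide (x ∈ l')

theorem subsetB_iff (l l' : List Elem) : subsetB l l' = true ↔ l.toFinset ⊆ l'.toFinset := by
  simp [subsetB, Finset.subset_iff]

theorem PT.subsetB {f g : α → List Elem} (hf : PT M f) (hg : PT M g) :
    PT M fun a => subsetB (f a) (g a) :=
  hf.all (g := fun a x => decide (x ∈ g a)) (.mem (.snd .self) (hg.comp (.fst .self)))

theorem unionAll_map_toFinset (ls : List (List Elem)) :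
    unionAll (ls.map List.toFinset) = ls.flatten.toFinset := by
  induction ls with
  | nil => rfl
  | cons l ls ih =>
    rw [List.map_cons, List.flatten_cons, List.toFinset_append, ← ih]; rfl

theorem PT.flatten {f : α → List (List β)} (hf : PT M f) : PT M fun a => (f a).flatten :=
  (hf.flatMap (g := fun _ l => l) (.snd .self)).congr fun a => by
    rw [List.flatMap_def]; simp

/-- The active elements of a scenario, as a list. -/
noncomputable def Mode.activeList (m : Mode) (b f t c : List Elem) : List Elem :=
  match m with
  | .explicit => f ++ c
  | .implicit => b.filter (fun x => !decide (x ∈ f ++ c)) ++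
      (f ++ c).filter fun x => !decide (x ∈ b)
  | .mixed => ((b.filter (fun x => !decide (x ∈ f)) ++ f.filter fun x => !decide (x ∈ b)).filter
      fun x => !decide (x ∈ t)) ++ c

theorem Mode.toFinset_activeList (m : Mode) (b f t c : List Elem) :
    (m.activeList b f t c).toFinset = m.active b.toFinset f.toFinset t.toFinset c.toFinset := by
  ext x
  cases m <;> simp [Mode.activeList, Mode.active, Finset.mem_symmDiff] <;> tauto

theorem PT.activeList (m : Mode) {b f t c : α → List Elem} (hb : PT M b) (hf : PT M f)
    (ht : PT M t) (hc : PT M c) : PT M fun a => m.activeList (b a) (f a) (t a) (c a) := by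
  have diff : ∀ {l l' : α → List Elem}, PT M l → PT M l' →
      PT M fun a => (l a).filter fun x => !decide (x ∈ l' a) := fun hl hl' =>
    hl.filter (.not (.mem (.snd .self) (hl'.comp (.fst .self))))
  cases m with
  | explicit => exact hf.append hc
  | implicit => exact (diff hb (hf.append hc)).append (diff (hf.append hc) hb)
  | mixed => exact (diff ((diff hb hf).append (diff hf hb)) ht).append hc

/-- A component of a tuple (a junk value if there is none). -/
def Elem.child (i : ℕ) (e : Elem) : Elem := (e.children.drop i).headD (.atom [])

theorem PT.child (i : ℕ) {f : α → Elem} (hf : PT M f) : PT M fun a => (f a).child i := by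
  refine PT.headD (f := fun a => (f a).children.drop i) ?_ (.const (Elem.atom []))
  induction i with
  | zero => exact hf.children
  | succ i ih => exact ih.tail.congr fun a => by rw [List.tail_drop]

/-! ### Selections -/

/-- Scan a list and a word simultaneously; replace an element by `f` or `g`, depending on whether
the symbol is a one. -/
def select (f g : Elem → List (List Elem)) : List Γ' → List Elem → List (List Elem)
  | _, [] => []
  | w, d :: l => (bif decide (w.headD .blank = .bit true) then f d else g d) ++ select f g w.tail l

theorem PT.select {f g : Elem → List (List Elem)} {w : α → List Γ'} {l : α → List Elem}
    (hf : PT M f) (hg : PT M g) (hw : PT M w) (hl : PT M l) :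
    PT M fun a => select f g (w a) (l a) := by
  have h₁ : PT M fun p : α × (List Γ' × List (List Elem)) × Elem => p.2.1 := .fst (.snd .self)
  have h₂ : PT M fun p : α × (List Γ' × List (List Elem)) × Elem => p.2.2 := .snd (.snd .self)
  obtain ⟨p, hp⟩ := hl.csize_le_mem (g := fun _ d => f d) (hf.comp (.snd .self))
  obtain ⟨q, hq⟩ := hl.csize_le_mem (g := fun _ d => g d) (hg.comp (.snd .self))
  refine (PT.snd (PT.foldl_incr (h := fun _ (c : List Γ' × List (List Elem)) d => (c.1.tail,
    c.2 ++ bif decide (c.1.headD .blank = .bit true) then f d else g d)) hl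
    (.pair hw (.const [])) (.pair h₁.fst.tail (.append h₁.snd (.cond (.decEq (.headD h₁.fst
      (.const Γ'.blank)) (.const (Γ'.bit true))) (hf.comp h₂) (hg.comp h₂)))) (p + q)
    fun a c d hd => ?_)).congr fun a => ?_
  · have h₃ := csize_tail_le c.1
    have h₄ := csize_append c.2 (bif decide (c.1.headD .blank = .bit true) then f d else g d)
    have h₅ := hp a d hd
    have h₆ := hq a d hd
    rw [show csize c = csize c.1 + csize c.2 + 1 from rfl, csize_prod]
    simp only [Polynomial.eval_add]
    have : csize (bif decide (c.1.headD .blank = .bit true) then f d else g d) ≤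
        csize (f d) + csize (g d) := by
      cases decide (c.1.headD .blank = .bit true) <;> simp only [cond_true, cond_false] <;> omega
    omega
  · have : ∀ (l : List Elem) (w : List Γ') (r : List (List Elem)),
        (l.foldl (fun (c : List Γ' × List (List Elem)) d => (c.1.tail,
          c.2 ++ bif decide (c.1.headD .blank = .bit true) then f d else g d)) (w, r)).2 =
        r ++ HDRR.select f g w l := by
      intro l
      induction l with
      | nil => intro w r; simp [HDRR.select]
      | cons d l ih => intro w r; rw [List.foldl_cons, ih, HDRR.select, List.append_assoc]
    rw [this, List.nil_append]

/-- Only the first `l.length` symbols are consulted. This bounds the length of the words over which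
scenarios have to be quantified. -/
theorem select_take (f g : Elem → List (List Elem)) (w : List Γ') (l : List Elem) :
    select f g (w.take l.length) l = select f g w l := by
  induction l generalizing w with
  | nil => rfl
  | cons d l ih =>
    cases w with
    | nil => rfl
    | cons s w =>
      rw [select, select, List.length_cons, List.take_succ_cons, List.tail_cons, ih]
      rfl

/-! ### Descriptions of relations and solutions -/

/-- Turns the relation into a decidable test on `t` together with the only set that `t` can list;
the analogous lemmas below do the same for the other encodings. -/
theorem listsSet_iff {t : Elem} {A : Finset Elem} :
    ListsSet t A ↔ t.isTuple = true ∧ A = t.children.toFinset := by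
  constructor
  · rintro ⟨l, rfl, h⟩
    exact ⟨rfl, by ext e; simp [Elem.children, h]⟩
  · rintro ⟨h, rfl⟩
    exact ⟨_, Elem.isTuple_iff.1 h, by simp⟩

/-- Whether an element is a tuple of tuples. -/
def Elem.isSets (t : Elem) : Bool := t.isTuple && t.children.all Elem.isTuple

/-- The sets that are listed by a tuple of tuples. -/
noncomputable def Elem.setsOf (t : Elem) : List (Finset Elem) :=
  t.children.map fun c => c.children.toFinset

theorem forall₂_listsSet_iff {l : List Elem} {As : List (Finset Elem)} :
    List.Forall₂ ListsSet l As ↔ (∀ t ∈ l, t.isTuple = true) ∧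
      As = l.map fun c => c.children.toFinset := by
  induction l generalizing As with
  | nil => simp
  | cons t l ih =>
    simp only [List.forall₂_cons_left_iff, ih, listsSet_iff, List.mem_cons, forall_eq_or_imp,
      List.map_cons]
    constructor
    · rintro ⟨A, As, ⟨h₁, rfl⟩, ⟨h₂, rfl⟩, rfl⟩
      exact ⟨⟨h₁, h₂⟩, rfl⟩
    · rintro ⟨⟨h₁, h₂⟩, rfl⟩
      exact ⟨_, _, ⟨h₁, rfl⟩, ⟨h₂, rfl⟩, rfl⟩

theorem listsSets_iff {t : Elem} {As : List (Finset Elem)} :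
    ListsSets t As ↔ t.isSets = true ∧ As = t.setsOf := by
  rw [Elem.isSets, Elem.setsOf, Bool.and_eq_true, List.all_eq_true]
  constructor
  · rintro ⟨l, rfl, h⟩
    rw [forall₂_listsSet_iff] at h
    exact ⟨⟨rfl, h.1⟩, h.2⟩
  · rintro ⟨⟨h₁, h₂⟩, h₃⟩
    exact ⟨_, Elem.isTuple_iff.1 h₁, forall₂_listsSet_iff.2 ⟨h₂, h₃⟩⟩

/-- Whether an element describes a tuple of relations. -/
noncomputable def Elem.isRel (g : Elem) : Bool :=
  decide (g = .tuple [g.child 0, g.child 1]) && ((g.child 0).isTuple &&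
    (((g.child 0).children.all fun a => !a.isTuple) && (g.child 1).isSets))

/-- The tuple of relations that is described by an element. -/
noncomputable def Elem.relOf (g : Elem) : RelTuple :=
  ⟨((g.child 0).children.map Elem.bits).toFinset, (g.child 1).setsOf⟩

theorem atom_injective : Function.Injective Elem.atom := fun a b h => by
  injection h

theorem image_atom_bits {l : List Elem} (h : ∀ a ∈ l, a.isTuple = false) :
    (l.map Elem.bits).toFinset.image Elem.atom = l.toFinset := by
  ext x
  simp only [Finset.mem_image, List.mem_toFinset, List.mem_map, exists_exists_and_eq_and]
  constructor
  · rintro ⟨a, ha, rfl⟩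
    rwa [← Elem.isTuple_eq_false_iff.1 (h a ha)]
  · intro hx
    exact ⟨x, hx, (Elem.isTuple_eq_false_iff.1 (h x hx)).symm⟩

/-- A description determines its tuple of relations: the listed atoms give back the universe because
`Elem.atom` is injective. -/
theorem describes_iff {g : Elem} {R : RelTuple} :
    Describes g R ↔ g.isRel = true ∧ R = g.relOf := by
  simp only [Elem.isRel, Bool.and_eq_true, decide_eq_true_iff, List.all_eq_true,
    Bool.not_eq_true']
  constructor
  · rintro ⟨u, r, rfl, hu, hr⟩
    obtain ⟨U, Rs⟩ := R
    rw [listsSet_iff] at hu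
    rw [listsSets_iff] at hr
    have hat : ∀ a ∈ u.children, a.isTuple = false := by
      intro a ha
      have : a ∈ U.image Elem.atom := by rw [hu.2]; simpa using ha
      obtain ⟨b, -, rfl⟩ := Finset.mem_image.1 this
      rfl
    refine ⟨⟨rfl, hu.1, hat, hr.1⟩, ?_⟩
    have h₁ : U = (u.children.map Elem.bits).toFinset :=
      Finset.image_injective atom_injective (by rw [image_atom_bits hat]; exact hu.2)
    rw [h₁, show Rs = r.setsOf from hr.2]
    rfl
  · rintro ⟨⟨h₁, h₂, h₃, h₄⟩, rfl⟩
    exact ⟨_, _, h₁, listsSet_iff.2 ⟨h₂, image_atom_bits h₃⟩, listsSets_iff.2 ⟨h₄, rfl⟩⟩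

theorem isRel_iff {g : Elem} : g.isRel = true ↔ g = .tuple [g.child 0, g.child 1] ∧
    (g.child 0).isTuple = true ∧ (∀ a ∈ (g.child 0).children, a.isTuple = false) ∧
    (g.child 1).isSets = true := by
  simp [Elem.isRel]

/-- The combinatorial elements of the described tuple of relations. -/
def Elem.elems (g : Elem) : List Elem :=
  (g.child 0).children ++ (g.child 1).children.flatMap Elem.children

theorem elements_relOf {g : Elem} (h : g.isRel = true) :
    g.relOf.elements = g.elems.toFinset := by
  have h₁ := (isRel_iff.1 h).2.2.1
  have h₂ := unionAll_map_toFinset ((g.child 1).children.map Elem.children)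
  rw [unionAll, List.map_map] at h₂
  rw [RelTuple.elements, Elem.elems, List.toFinset_append, List.flatMap_def, ← h₂,
    ← image_atom_bits h₁]
  rfl

/-- The description of the part that remains when the elements in `A` are active. -/
noncomputable def Elem.restrict (g : Elem) (A : List Elem) : Elem :=
  .tuple [.tuple ((g.child 0).children.filter fun a => decide (a ∈ A)),
    .tuple ((g.child 1).children.map fun B => .tuple (B.children.filter fun e =>
      g.elems.all fun x => !x.occursB e || decide (x ∈ A)))]

/-- The condition on occurrences ranges over all objects, but only combinatorial elements count, so
testing the finite list `g.elems` suffices. -/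
theorem describes_restrict {g : Elem} (h : g.isRel = true) (A : List Elem) :
    Describes (g.restrict A) (g.relOf.restrict A.toFinset) := by
  obtain ⟨-, h₁, h₂, h₃⟩ := isRel_iff.1 h
  refine ⟨_, _, rfl, ⟨_, rfl, fun e => ?_⟩, ⟨_, rfl, ?_⟩⟩
  · simp only [List.mem_filter, RelTuple.restrict, Elem.relOf, Finset.mem_image, Finset.mem_filter,
      List.mem_toFinset, List.mem_map, decide_eq_true_iff]
    constructor
    · rintro ⟨he, hA⟩
      have := Elem.isTuple_eq_false_iff.1 (h₂ e he)
      exact ⟨e.bits, ⟨⟨e, he, rfl⟩, this ▸ hA⟩, this.symm⟩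
    · rintro ⟨_, ⟨⟨a, ha, rfl⟩, hA⟩, rfl⟩
      rw [← Elem.isTuple_eq_false_iff.1 (h₂ a ha)] at hA ⊢
      exact ⟨ha, hA⟩
  · rw [forall₂_listsSet_iff]
    refine ⟨by simp [Elem.isTuple], ?_⟩
    have hel (x : Elem) : x ∈ g.relOf.elements ↔ x ∈ g.elems := by
      rw [elements_relOf h, List.mem_toFinset]
    change ((g.child 1).children.map _).map _ = _
    rw [List.map_map, List.map_map]
    refine List.map_congr_left fun B _ => Finset.ext fun e =>
      (@Finset.mem_filter _ _ (_) _ _).trans ?_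
    change (e ∈ B.children.toFinset ∧ ∀ x : Elem, x.Occurs e → x ∈ g.relOf.elements →
      x ∈ A.toFinset) ↔ e ∈ (B.children.filter _).toFinset
    simp only [hel, List.mem_toFinset, List.mem_filter, List.all_eq_true, Bool.or_eq_true,
      Bool.not_eq_true', decide_eq_true_iff]
    refine and_congr_right fun _ => ⟨fun h x hx => ?_, fun h x hxe hx => ?_⟩
    · cases ho : x.occursB e with
      | false => exact .inl rfl
      | true => exact .inr (h x (Elem.occursB_iff.1 ho) hx)
    · rcases h x hx with h | h
      · rw [Elem.occursB_iff.2 hxe] at h; cases h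
      · exact h

theorem length_encodeList_filter (l : List Elem) (p : Elem → Bool) :
    (Elem.encodeList (l.filter p)).length ≤ (Elem.encodeList l).length := by
  induction l with
  | nil => simp
  | cons e l ih =>
    rw [List.filter_cons]
    cases p e <;> simp [Elem.encodeList] <;> omega

theorem length_encodeList_map (l : List Elem) (f : Elem → Elem)
    (hf : ∀ e ∈ l, (f e).encode.length ≤ e.encode.length) :
    (Elem.encodeList (l.map f)).length ≤ (Elem.encodeList l).length := by
  induction l with
  | nil => simp
  | cons e l ih =>
    have h₁ := hf e (by simp)
    have h₂ := ih fun e he => hf e (by simp [he])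
    simp only [List.map_cons, Elem.encodeList, List.length_append]
    omega

theorem length_encode_tuple (l : List Elem) :
    (Elem.tuple l).encode.length = (Elem.encodeList l).length + 2 := by
  simp [Elem.encode]

/-- Restriction only filters the lists in the description. Hence one polynomial in the input length
bounds the certificates of all scenarios. -/
theorem length_encode_restrict {g : Elem} (h : g.isRel = true) (A : List Elem) :
    (g.restrict A).encode.length ≤ g.encode.length := by
  obtain ⟨h₀, h₁, -, h₃⟩ := isRel_iff.1 h
  rw [Elem.isSets, Bool.and_eq_true, List.all_eq_true] at h₃
  conv_rhs => rw [h₀, Elem.isTuple_iff.1 h₁, Elem.isTuple_iff.1 h₃.1]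
  have h₄ := length_encodeList_filter (g.child 0).children fun a => decide (a ∈ A)
  have h₅ := length_encodeList_map (g.child 1).children (fun B => .tuple (B.children.filter fun e =>
      g.elems.all fun x => !x.occursB e || decide (x ∈ A))) fun e he => by
    conv_rhs => rw [Elem.isTuple_iff.1 (h₃.2 e he)]
    rw [length_encode_tuple, length_encode_tuple]
    exact Nat.add_le_add_right (length_encodeList_filter _ _) 2
  rw [Elem.restrict]
  simp only [length_encode_tuple, Elem.encodeList, List.length_append, List.length_nil]
  omega

theorem length_encode_child (i : ℕ) (e : Elem) : (e.child i).encode.length ≤ e.encode.length := by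
  rw [Elem.child]
  have key : ∀ l : List Elem, ∀ i, ((l.drop i).headD (.atom [])).encode.length ≤
      (Elem.encodeList l).length + 1 := by
    intro l
    induction l with
    | nil => intro i; simp [Elem.encode, Elem.encodeList]
    | cons c l ih =>
      intro i
      cases i with
      | zero => simp [Elem.encodeList]; omega
      | succ i => have := ih i; simp only [List.drop_succ_cons, Elem.encodeList, List.length_append]; omega
  cases e with
  | atom a => simp [Elem.children, Elem.encode]
  | tuple l => rw [length_encode_tuple]; exact (key l i).trans (by omega)

/-! ### The Hamming distance -/

/-- Subsets and products introduce no new atoms. Consequently the symmetric difference of two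
solutions lies in the universe of the ground instance. -/
theorem mem_of_isRelationOver {U : Finset Atom} {A : Set Elem} (h : IsRelationOver U A) :
    ∀ e ∈ A, ∀ a, (Elem.atom a).Occurs e → a ∈ U := by
  induction h with
  | univ =>
    rintro _ ⟨b, hb, rfl⟩ a ha
    rw [Elem.occurs_atom] at ha
    rwa [atom_injective ha]
  | subset _ hAB ih => exact fun e he => ih e (hAB he)
  | prod As _ ih =>
    rintro _ ⟨l, rfl, hl⟩ a ha
    rcases Elem.occurs_tuple.1 ha with h | ⟨e, he, ho⟩
    · cases h
    · obtain ⟨i, hi, rfl⟩ := List.mem_iff_getElem.1 he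
      exact ih _ (List.getElem_mem (hl.length_eq ▸ hi)) _ (hl.get hi (hl.length_eq ▸ hi)) a ho

/-- The outer tuples of `t` are not atoms, so occurring in a listed member is the same as occurring
in `t`; the sets need not be formed. -/
theorem mem_atoms_setsOf {t : Elem} (h : t.isSets = true) (a : Atom) :
    a ∈ Solution.atoms t.setsOf ↔ (Elem.atom a).Occurs t := by
  rw [Elem.isSets, Bool.and_eq_true, List.all_eq_true] at h
  conv_rhs => rw [Elem.isTuple_iff.1 h.1, Elem.occurs_tuple]
  simp only [Solution.atoms, Elem.setsOf, Set.mem_ofPred_eq, List.mem_map,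
    exists_exists_and_eq_and, List.mem_toFinset, reduceCtorEq, false_or]
  refine exists_congr fun c => and_congr_right fun hc => ?_
  conv_rhs => rw [Elem.isTuple_iff.1 (h.2 c hc), Elem.occurs_tuple]
  simp

/-- The universe elements of `g` that occur in exactly one of two elements. -/
noncomputable def Elem.diffAtoms (g t t' : Elem) : List Elem :=
  (g.child 0).children.dedup.filter fun a => !(a.occursB t == a.occursB t')

/-- As both solutions use only atoms of the universe, the symmetric difference is found by scanning
the universe list, with repetitions removed so that the length is a cardinality. -/
theorem hammingDist_setsOf {g t t' : Elem} (hg : g.isRel = true) (ht : t.isSets = true)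
    (ht' : t'.isSets = true) (hU : ∀ a ∈ Solution.atoms t.setsOf, a ∈ g.relOf.univ)
    (hU' : ∀ a ∈ Solution.atoms t'.setsOf, a ∈ g.relOf.univ) :
    hammingDist t.setsOf t'.setsOf = (g.diffAtoms t t').length := by
  have h₂ := (isRel_iff.1 hg).2.2.1
  have hx (x : Elem) : (!(x.occursB t == x.occursB t')) = true ↔ ¬(x.Occurs t ↔ x.Occurs t') := by
    rw [Bool.not_eq_true', beq_eq_false_iff_ne, ne_eq, Bool.eq_iff_iff, Elem.occursB_iff,
      Elem.occursB_iff]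
  have e : Elem.atom '' symmDiff (Solution.atoms t.setsOf) (Solution.atoms t'.setsOf) =
      ((g.diffAtoms t t').toFinset : Set Elem) := by
    ext x
    simp only [Set.mem_image, Finset.mem_coe, List.mem_toFinset, Elem.diffAtoms, List.mem_filter,
      List.mem_dedup, Set.mem_symmDiff, hx]
    constructor
    · rintro ⟨a, ha, rfl⟩
      refine ⟨?_, ?_⟩
      · have : a ∈ g.relOf.univ := ha.elim (fun h => hU a h.1) fun h => hU' a h.1
        rw [← List.mem_toFinset, ← image_atom_bits h₂]
        exact Finset.mem_image_of_mem _ this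
      · rw [← mem_atoms_setsOf ht, ← mem_atoms_setsOf ht']
        tauto
    · rintro ⟨hx, h⟩
      rw [Elem.isTuple_eq_false_iff.1 (h₂ x hx), ← mem_atoms_setsOf ht,
        ← mem_atoms_setsOf ht'] at h
      exact ⟨x.bits, by tauto, (Elem.isTuple_eq_false_iff.1 (h₂ x hx)).symm⟩
  rw [hammingDist, ← atom_injective.encard_image, e, Set.encard_coe_eq_coe_finsetCard,
    List.toFinset_card_of_nodup]
  exact (List.nodup_dedup _).filter _

/-! ### Polynomial-time tests -/

theorem PT.isSets {f : α → Elem} (hf : PT M f) : PT M fun a => (f a).isSets :=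
  hf.isTuple.and (hf.children.all (g := fun _ c => c.isTuple) (.isTuple (.snd .self)))

theorem PT.isRel {f : α → Elem} (hf : PT M f) : PT M fun a => (f a).isRel :=
  .and (.decEq hf (.tuple (.cons (hf.child 0) (.singleton (hf.child 1)))))
    (.and (hf.child 0).isTuple (.and ((hf.child 0).children.all (g := fun _ a => !a.isTuple)
      (.not (.isTuple (.snd .self)))) (hf.child 1).isSets))

theorem PT.elems {f : α → Elem} (hf : PT M f) : PT M fun a => (f a).elems :=
  .append (hf.child 0).children ((hf.child 1).children.flatMap (g := fun _ B => B.children)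
    (.children (.snd .self)))

theorem PT.restrict {f : α → Elem} {g : α → List Elem} (hf : PT M f) (hg : PT M g) :
    PT M fun a => (f a).restrict (g a) := by
  have h : PT M fun p : ((α × Elem) × Elem) × Elem =>
      !p.2.occursB p.1.2 || decide (p.2 ∈ g p.1.1.1) :=
    .or (.not (.occurs (.snd .self) (.snd (.fst .self))))
      (.mem (.snd .self) (hg.comp (.fst (.fst (.fst .self)))))
  have h' : PT M fun p : (α × Elem) × Elem => (f p.1.1).elems.all fun x =>
      !x.occursB p.2 || decide (x ∈ g p.1.1) :=
    .all (g := fun (p : (α × Elem) × Elem) x => !x.occursB p.2 || decide (x ∈ g p.1.1))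
      (.elems (hf.comp (.fst (.fst .self)))) h
  refine .tuple (.cons (.tuple ((hf.child 0).children.filter (g := fun a x => decide (x ∈ g a))
    (.mem (.snd .self) (hg.comp (.fst .self))))) (.singleton (.tuple ?_)))
  refine (hf.child 1).children.map (g := fun a B => Elem.tuple (B.children.filter fun e =>
    (f a).elems.all fun x => !x.occursB e || decide (x ∈ g a))) (.tuple ?_)
  exact PT.filter (g := fun (p : α × Elem) e => (f p.1).elems.all fun x =>
    !x.occursB e || decide (x ∈ g p.1)) (.children (.snd .self)) h'

theorem PT.diffAtoms {f g h : α → Elem} (hf : PT M f) (hg : PT M g) (hh : PT M h) :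
    PT M fun a => (f a).diffAtoms (g a) (h a) := by
  have H : PT M fun p : α × Elem => !(p.2.occursB (g p.1) == p.2.occursB (h p.1)) :=
    .not (.beqBool (.occurs (.snd .self) (hg.comp (.fst .self)))
      (.occurs (.snd .self) (hh.comp (.fst .self))))
  exact PT.filter (f := fun a => ((f a).child 0).children.dedup)
    (g := fun a x => !(x.occursB (g a) == x.occursB (h a))) (hf.child 0).children.dedup H

/-! ### Finite sequences of words -/

/-- One step of reading a finite sequence of words from right to left. -/
def wordStep : Option Γ' → List (List Γ') → List (List Γ')
  | none, ws => [] :: ws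
  | some s, ws => (s :: ws.headD []) :: ws.tail

theorem foldr_wordStep_encodeWords (ws : List (List Γ')) :
    (encodeWords ws).foldr wordStep [] = ws := by
  induction ws with
  | nil => rfl
  | cons w ws ih =>
    have : ∀ w' : List Γ', (w'.map some).foldr wordStep ([] :: ws) = w' :: ws := by
      intro w'
      induction w' with
      | nil => rfl
      | cons s w' ih => rw [List.map_cons, List.foldr_cons, ih]; rfl
    rw [encodeWords] at ih ⊢
    rw [List.flatMap_cons, List.foldr_append, ih, List.foldr_append]
    exact this w

theorem csize_wordStep_le (s : Option Γ') (ws : List (List Γ')) :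
    csize (wordStep s ws) ≤ csize ws + 20 := by
  cases s with
  | none => rw [wordStep, csize_cons, csize_nil]; omega
  | some s =>
    have h : csize s ≤ csize (some s) := by
      change _ ≤ (Dat.cons .nil (code s)).size; rw [Dat.size]; simp only [csize]; omega
    have := csize_sym_le (some s)
    cases ws with
    | nil => simp only [wordStep, List.headD_nil, List.tail_nil, csize_cons, csize_nil]; omega
    | cons w ws => simp only [wordStep, List.headD_cons, List.tail_cons, csize_cons]; omega

theorem PT.wordStep {f : α → Option Γ'} {g : α → List (List Γ')} (hf : PT M f) (hg : PT M g) :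
    PT M fun a => wordStep (f a) (g a) := by
  refine PT.cases (g := fun a b => HDRR.wordStep b (g a)) hf fun b => ?_
  cases b with
  | none => exact .cons (.const []) hg
  | some s => exact .cons (.cons (.const s) (.headD hg (.const []))) hg.tail

/-- Predicates of finite sequences of words that are polynomial-time relative to a machine are
decided by a Turing machine in polynomial time. -/
theorem PT.polyTimeDecidable' {W : List (List Γ') → Bool} (hW : PT M W) : PolyTimeDecidable W := by
  refine PT.polyTimeDecidable (F := fun r => W (r.foldl (fun ws s => HDRR.wordStep s ws) []))
    (hW.comp ?_) fun ws => by rw [List.foldl_reverse, foldr_wordStep_encodeWords]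
  exact PT.foldl_incr (f := fun r => r) (g := fun _ => []) (h := fun _ ws s => HDRR.wordStep s ws)
    .self (.const []) (.wordStep (.snd (.snd .self)) (.fst (.snd .self))) 20
    fun _ c b _ => (csize_wordStep_le b c).trans (by simp)

/-- The end markers are added by a `flatMap`, and the reversal compensates for the one that occurs
when `M` is fed. -/
theorem PT.callWords {V : List (List Γ') → Bool}
    (H : Turing.TM2ComputableInPolyTime encodeWords Computability.encodeBool V)
    {g : α → List (List Γ')} (hg : PT H.tm g) : PT H.tm fun a => V (g a) := by
  have h : PT H.tm fun p : α × List Γ' => p.2.map Option.some ++ [none] :=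
    .append (PT.map (f := fun p : α × List Γ' => p.2) (g := fun _ s => Option.some s) (.snd .self)
      (.some (.snd .self))) (.const [none])
  have h' : PT H.tm fun a => (g a).flatMap fun w => w.map Option.some ++ [none] := hg.flatMap h
  exact PT.call H h'.reverse

/-! ### Succinct encodings of scenarios -/

/-- A way to write the scenarios of a recoverable robust problem: an input is a tuple of at least
three components, a tuple of relations, the active elements of the base scenario and the fixed set;
`selected e w` are the uncertain sets that are selected by a word `w`. -/
structure Format where
  shape : Elem → Bool
  uncertain : Elem → List (List Elem)
  selected : Elem → List Γ' → List (List Elem)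
  allowed : Elem → List (List Elem) → Bool
  bound : Elem → List Bool
  shape_pt : ∀ M, PT M shape
  uncertain_pt : ∀ M, PT M uncertain
  selected_pt : ∀ M, PT M fun p : Elem × List Γ' => selected p.1 p.2
  allowed_pt : ∀ M, PT M fun p : Elem × List (List Elem) => allowed p.1 p.2
  bound_pt : ∀ M, PT M bound
  -- With this field, the universal quantifier over words of bounded length reaches every scenario.
  selected_short : ∀ e w, ∃ w', w'.length ≤ e.encode.length ∧ selected e w' = selected e w

/-- All sets consist of combinatorial elements, and the fixed set and the uncertain sets are
pairwise disjoint. -/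
noncomputable def Format.wellFormed (F : Format) (e : Elem) : Bool :=
  F.shape e && ((e.child 0).isRel && ((e.child 1).isTuple && ((e.child 2).isTuple &&
    (subsetB (e.child 1).children (e.child 0).elems &&
    ((((e.child 2).children :: F.uncertain e).all fun E => subsetB E (e.child 0).elems) &&
    HDRR.pairwiseDisjoint ((e.child 2).children :: F.uncertain e))))))

/-- The active elements when the uncertain sets in `S` are selected. -/
noncomputable def Format.active (F : Format) (m : Mode) (e : Elem) (S : List (List Elem)) :
    List Elem :=
  m.activeList (e.child 1).children (e.child 2).children (F.uncertain e).flatten S.flatten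

/-- The sets of active elements of the recovery scenarios. -/
def Format.scenarios (F : Format) (m : Mode) (e : Elem) : Set (Finset Elem) :=
  {A | ∃ w, F.allowed e (F.selected e w) = true ∧ A = (F.active m e (F.selected e w)).toFinset}

/-- The language of the recoverable robust version of `P`. -/
def Format.language (F : Format) (P : CombProblem) (m : Mode) : Set (List Γ') :=
  {x | ∃ e : Elem, x = e.encode ∧ F.wellFormed e = true ∧
    P.Recoverable (e.child 0).relOf (e.child 1).children.toFinset (F.scenarios m e)
      (bitsVal (F.bound e))}

/-- The verifier of the recoverable robust problem, for given solutions and a given selection. -/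
noncomputable def Format.verify (F : Format) (m : Mode) (V : List (List Γ') → Bool)
    (x u₁ u₂ u₃ : List Γ') : Bool :=
  let e := Elem.parse x
  let S := F.selected e u₂
  decide (e.encode = x) && (F.wellFormed e &&
    (V [((e.child 0).restrict (e.child 1).children).encode, u₁] &&
    (!F.allowed e S || (V [((e.child 0).restrict (F.active m e S)).encode, u₃] &&
      lengthLe (((e.child 0).diffAtoms (Elem.parse u₁) (Elem.parse u₃)).map fun _ => true)
        (F.bound e)))))

section

variable (F : Format)

theorem Format.pt_wellFormed {f : α → Elem} (hf : PT M f) : PT M fun a => F.wellFormed (f a) := by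
  have h₀ := (PT.child 0 hf).elems
  have h₁ : PT M fun a => ((f a).child 2).children :: F.uncertain (f a) :=
    .cons (hf.child 2).children ((F.uncertain_pt M).comp hf)
  refine .and ((F.shape_pt M).comp hf) (.and (hf.child 0).isRel (.and (hf.child 1).isTuple
    (.and (hf.child 2).isTuple (.and (.subsetB (hf.child 1).children h₀)
      (.and (PT.all (g := fun a E => subsetB E ((f a).child 0).elems) h₁ ?_)
        h₁.pairwiseDisjoint)))))
  exact .subsetB (.snd .self) (h₀.comp (.fst .self))

theorem Format.pt_active (m : Mode) {f : α → Elem} {S : α → List (List Elem)} (hf : PT M f)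
    (hS : PT M S) : PT M fun a => F.active m (f a) (S a) :=
  .activeList m (hf.child 1).children (hf.child 2).children ((F.uncertain_pt M).comp hf).flatten
    hS.flatten

theorem Format.pt_verify (m : Mode) {V : List (List Γ') → Bool}
    (H : Turing.TM2ComputableInPolyTime encodeWords Computability.encodeBool V)
    {x u₁ u₂ u₃ : α → List Γ'} (hx : PT H.tm x) (h₁ : PT H.tm u₁) (h₂ : PT H.tm u₂)
    (h₃ : PT H.tm u₃) : PT H.tm fun a => F.verify m V (x a) (u₁ a) (u₂ a) (u₃ a) := by
  have he := hx.parse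
  have hS : PT H.tm fun a => F.selected (Elem.parse (x a)) (u₂ a) :=
    (F.selected_pt H.tm).comp (he.pair h₂)
  have hV {A : α → List Elem} {u : α → List Γ'} (hA : PT H.tm A) (hu : PT H.tm u) :
      PT H.tm fun a => V [(((Elem.parse (x a)).child 0).restrict (A a)).encode, u a] :=
    .callWords H (.cons (.encode (.restrict (he.child 0) hA)) (.singleton hu))
  refine .and (.decEq he.encode hx) (.and (F.pt_wellFormed he) (.and (hV (he.child 1).children h₁)
    (.or (.not ((F.allowed_pt H.tm).comp (he.pair hS))) (.and (hV (F.pt_active m he hS) h₃)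
      (.lengthLe ?_ ((F.bound_pt H.tm).comp he))))))
  exact PT.map (g := fun _ _ => true) (.diffAtoms (he.child 0) h₁.parse h₃.parse) (.const true)

end

/-! ### Correctness of the verifier -/

/-- `z` encodes a solution of the part of `g` in which the elements in `A` are active. -/
def CombProblem.Certifies (P : CombProblem) (g : Elem) (A : Finset Elem) (z : List Γ') : Prop :=
  (Elem.parse z).encode = z ∧ (Elem.parse z).isSets = true ∧
    P.IsSolution (g.relOf.restrict A) (Elem.parse z).setsOf

/-- Words determine elements, and elements determine the relations and solutions they describe, so
the existential over `R` and `s` in the hypothesis has only one candidate. -/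
theorem CombProblem.certifies_iff {P : CombProblem} {V : List (List Γ') → Bool}
    (hdec : ∀ x z, V [x, z] = true ↔ ∃ R s, EncodesRel x R ∧ EncodesSol z s ∧ P.IsSolution R s)
    {g : Elem} (hg : g.isRel = true) (A : List Elem) (z : List Γ') :
    V [(g.restrict A).encode, z] = true ↔ P.Certifies g A.toFinset z := by
  rw [hdec]
  constructor
  · rintro ⟨R, s, ⟨t, ht, hR⟩, ⟨t', rfl, hs⟩, h⟩
    obtain rfl := Elem.encode_injective ht
    have h₁ := (describes_iff.1 (describes_restrict hg A)).2
    have h₂ := (describes_iff.1 hR).2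
    obtain ⟨h₃, rfl⟩ := listsSets_iff.1 hs
    refine ⟨?_, ?_, ?_⟩ <;> rw [Elem.parse_encode]
    · exact h₃
    · rwa [h₁, ← h₂]
  · rintro ⟨h₁, h₂, h₃⟩
    exact ⟨_, _, ⟨_, rfl, describes_restrict hg A⟩, ⟨_, h₁.symm, listsSets_iff.2 ⟨h₂, rfl⟩⟩, h₃⟩

theorem CombProblem.IsSolution.atoms_subset {P : CombProblem} {R : RelTuple} {A : Finset Elem}
    {s : Solution} (h : P.IsSolution (R.restrict A) s) : ∀ a ∈ s.atoms, a ∈ R.univ := by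
  rintro a ⟨B, hB, e, he, ha⟩
  have := mem_of_isRelationOver (P.feasible_isRelationOver _ h.1 s h.2 B hB) e he a ha
  exact (Finset.mem_filter.1 this).1

/-- By choice, the family of recovery solutions may be replaced by one existential per scenario,
inside the universal quantifier. -/
theorem CombProblem.recoverable_iff {P : CombProblem} {R : RelTuple} {b : Finset Elem}
    {scen : Set (Finset Elem)} {κ : ℕ} : P.Recoverable R b scen κ ↔
      ∃ s₀, P.IsSolution (R.restrict b) s₀ ∧ ∀ A ∈ scen, ∃ s, P.IsSolution (R.restrict A) s ∧
        hammingDist s₀ s ≤ κ := by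
  constructor
  · rintro ⟨s₀, s, h₀, h⟩
    exact ⟨s₀, h₀, fun A hA => ⟨s ⟨A, hA⟩, h ⟨A, hA⟩⟩⟩
  · rintro ⟨s₀, h₀, h⟩
    choose s hs using h
    exact ⟨s₀, fun A => s A A.2, h₀, fun A => hs A A.2⟩

/-- The computed distance is meaningful only after both certificates are accepted, since
`hammingDist_setsOf` needs the solutions to lie in the universe. A selection that is not allowed
imposes no condition on `u₃`. -/
theorem Format.verify_iff (F : Format) (m : Mode) {P : CombProblem} {V : List (List Γ') → Bool}
    (hdec : ∀ x z, V [x, z] = true ↔ ∃ R s, EncodesRel x R ∧ EncodesSol z s ∧ P.IsSolution R s)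
    (x u₁ u₂ u₃ : List Γ') : F.verify m V x u₁ u₂ u₃ = true ↔
      ∃ e : Elem, x = e.encode ∧ F.wellFormed e = true ∧
        P.Certifies (e.child 0) (e.child 1).children.toFinset u₁ ∧
        (F.allowed e (F.selected e u₂) = true →
          P.Certifies (e.child 0) (F.active m e (F.selected e u₂)).toFinset u₃ ∧
          hammingDist (Elem.parse u₁).setsOf (Elem.parse u₃).setsOf ≤ bitsVal (F.bound e)) := by
  have key : ∀ e : Elem, F.wellFormed e = true →
      ((V [((e.child 0).restrict (e.child 1).children).encode, u₁] &&
        (!F.allowed e (F.selected e u₂) ||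
        (V [((e.child 0).restrict (F.active m e (F.selected e u₂))).encode, u₃] &&
        lengthLe (((e.child 0).diffAtoms (Elem.parse u₁) (Elem.parse u₃)).map fun _ => true)
        (F.bound e)))) = true ↔
      P.Certifies (e.child 0) (e.child 1).children.toFinset u₁ ∧
        (F.allowed e (F.selected e u₂) = true →
          P.Certifies (e.child 0) (F.active m e (F.selected e u₂)).toFinset u₃ ∧
          hammingDist (Elem.parse u₁).setsOf (Elem.parse u₃).setsOf ≤ bitsVal (F.bound e))) := by
    intro e he
    have hg : (e.child 0).isRel = true := by
      simp only [Format.wellFormed, Bool.and_eq_true] at he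
      exact he.2.1
    rw [Bool.and_eq_true, P.certifies_iff hdec hg]
    refine and_congr_right fun h₁ => ?_
    cases F.allowed e (F.selected e u₂) with
    | false => simp
    | true =>
      rw [Bool.not_true, Bool.false_or, Bool.and_eq_true, P.certifies_iff hdec hg, lengthLe_iff,
        List.length_map]
      simp only [forall_const]
      refine and_congr_right fun h₃ => ?_
      rw [hammingDist_setsOf hg h₁.2.1 h₃.2.1 h₁.2.2.atoms_subset h₃.2.2.atoms_subset,
        Nat.cast_le]
  simp only [Format.verify]
  rw [Bool.and_eq_true, Bool.and_eq_true, decide_eq_true_iff]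
  constructor
  · rintro ⟨h₁, h₂, h₃⟩
    exact ⟨_, h₁.symm, h₂, (key _ h₂).1 h₃⟩
  · rintro ⟨e, rfl, h₂, h₃⟩
    rw [Elem.parse_encode]
    exact ⟨rfl, h₂, (key _ h₂).2 h₃⟩

/-- The words `u₁` and `u₃` are certificates and `u₂` is a selection of uncertain sets. -/
theorem Format.inSigmaP3 (F : Format) {P : CombProblem} (hP : P.InNP) (m : Mode) :
    InSigmaP3 (F.language P m) := by
  obtain ⟨p, V, ⟨H⟩, hdec, hlen⟩ := hP
  have hW : PT H.tm fun ws : List (List Γ') => F.verify m V (ws.headD []) (ws.tail.headD [])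
      (ws.tail.tail.headD []) (ws.tail.tail.tail.headD []) :=
    F.pt_verify m H (.headD .self (.const [])) (.headD (.tail .self) (.const []))
      (.headD (.tail (.tail .self)) (.const [])) (.headD (.tail (.tail (.tail .self))) (.const []))
  -- The polynomial `p` serves the certificates, while the summand `X` leaves room for selections.
  refine ⟨p + .X, _, hW.polyTimeDecidable', fun x => ?_⟩
  simp only [List.headD_cons, List.tail_cons, F.verify_iff m hdec, Polynomial.eval_add,
    Polynomial.eval_X]
  -- solutions have short encodings
  have short : ∀ (e : Elem), (e.child 0).isRel = true → ∀ (A : List Elem) (s : Solution),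
      P.IsSolution ((e.child 0).relOf.restrict A.toFinset) s →
      ∃ z, P.Certifies (e.child 0) A.toFinset z ∧ (Elem.parse z).setsOf = s ∧
        z.length ≤ p.eval e.encode.length + e.encode.length := by
    intro e hg A s hs
    obtain ⟨z, ⟨t, rfl, hz⟩, hle⟩ := hlen _ _ s ⟨_, rfl, describes_restrict hg A⟩ hs
    obtain ⟨h₁, rfl⟩ := listsSets_iff.1 hz
    refine ⟨t.encode, ⟨?_, ?_, ?_⟩, ?_, ?_⟩
    · rw [Elem.parse_encode]
    · rwa [Elem.parse_encode]
    · rwa [Elem.parse_encode]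
    · rw [Elem.parse_encode]
    · have := eval_mono p ((length_encode_restrict hg A).trans (length_encode_child 0 e))
      omega
  constructor
  · rintro ⟨e, rfl, he, hr⟩
    have hg : (e.child 0).isRel = true := by
      simp only [Format.wellFormed, Bool.and_eq_true] at he
      exact he.2.1
    obtain ⟨s₀, h₀, hr⟩ := CombProblem.recoverable_iff.1 hr
    obtain ⟨z₀, hz₀, rfl, hl₀⟩ := short e hg _ s₀ h₀
    refine ⟨z₀, hl₀, fun w _ => ?_⟩
    by_cases ha : F.allowed e (F.selected e w) = true
    · obtain ⟨s, hs, hd⟩ := hr _ ⟨w, ha, rfl⟩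
      obtain ⟨z, hz, rfl, hl⟩ := short e hg _ s hs
      exact ⟨z, hl, e, rfl, he, hz₀, fun _ => ⟨hz, hd⟩⟩
    -- A selection that is not allowed describes no scenario, so any short word is accepted as `u₃`.
    · exact ⟨[], by simp, e, rfl, he, hz₀, fun h => absurd h ha⟩
  · rintro ⟨u₁, -, h⟩
    -- The input element and the validity of `u₁` do not depend on the selection, so the empty word
    -- serves to extract them.
    obtain ⟨-, -, e, rfl, he, h₁, -⟩ := h [] (by simp)
    refine ⟨e, rfl, he, CombProblem.recoverable_iff.2 ⟨_, h₁.2.2, ?_⟩⟩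
    rintro _ ⟨w, ha, rfl⟩
    obtain ⟨w', hl, hw⟩ := F.selected_short e w
    -- A scenario given by an arbitrary word is also given by a short one; the element obtained for
    -- it is the same as before because encoding is injective.
    obtain ⟨u₃, -, e', hee, -, -, h₃⟩ := h w' (by omega)
    obtain rfl := Elem.encode_injective hee
    rw [hw] at h₃
    exact ⟨_, (h₃ ha).1.2.2, (h₃ ha).2⟩

theorem length_children_child_le (i : ℕ) (e : Elem) :
    (e.child i).children.length ≤ e.encode.length := by
  refine le_trans ?_ (length_encode_child i e)
  cases e.child i with
  | atom a => simp [Elem.children]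
  | tuple l =>
    rw [length_encode_tuple]
    exact (Elem.length_le_encodeList l).trans (by omega)

theorem exists_select_short (f g : Elem → List (List Elem)) (i : ℕ) (e : Elem) (w : List Γ') :
    ∃ w', w'.length ≤ e.encode.length ∧
      select f g w' (e.child i).children = select f g w (e.child i).children :=
  ⟨_, ((List.length_take_le _ _).trans (length_children_child_le i e)), select_take f g w _⟩

theorem Format.wellFormed_iff (F : Format) (e : Elem) : F.wellFormed e = true ↔
    F.shape e = true ∧ (e.child 0).isRel = true ∧ (e.child 1).isTuple = true ∧
      (e.child 2).isTuple = true ∧ (e.child 1).children.toFinset ⊆ (e.child 0).relOf.elements ∧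
      (∀ E ∈ (e.child 2).children.toFinset :: (F.uncertain e).map List.toFinset,
        E ⊆ (e.child 0).relOf.elements) ∧
      ((e.child 2).children.toFinset :: (F.uncertain e).map List.toFinset).Pairwise Disjoint := by
  simp only [Format.wellFormed, Bool.and_eq_true]
  refine and_congr_right fun _ => and_congr_right fun hg => ?_
  rw [elements_relOf hg, ← List.map_cons, pairwiseDisjoint_iff, List.all_eq_true, List.forall_mem_map,
    subsetB_iff]
  simp only [subsetB_iff]

theorem Format.toFinset_active (F : Format) (m : Mode) (e : Elem) (S : List (List Elem)) :
    (F.active m e S).toFinset = m.active (e.child 1).children.toFinset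
      (e.child 2).children.toFinset (unionAll ((F.uncertain e).map List.toFinset))
      (unionAll (S.map List.toFinset)) := by
  rw [Format.active, Mode.toFinset_activeList, unionAll_map_toFinset, unionAll_map_toFinset]

/-! ### Numbers -/

/-- Whether an element is a natural number in binary. -/
def Elem.isNat (t : Elem) : Bool := !t.isTuple && isBinary t.bits

theorem Elem.eq_ofNat_iff {t : Elem} {n : ℕ} :
    t = Elem.ofNat n ↔ t.isNat = true ∧ n = bitsVal t.bits := by
  rw [Elem.isNat, Bool.and_eq_true, Bool.not_eq_true', isBinary_iff]
  constructor
  · rintro rfl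
    exact ⟨⟨rfl, n, rfl⟩, (bitsVal_encodeNat n).symm⟩
  · rintro ⟨⟨h, k, hk⟩, rfl⟩
    rw [Elem.isTuple_eq_false_iff.1 h, Elem.ofNat]
    change Elem.atom t.bits = Elem.atom (Computability.encodeNat (bitsVal t.bits))
    rw [hk, bitsVal_encodeNat]

theorem PT.isNat {f : α → Elem} (hf : PT M f) : PT M fun a => (f a).isNat :=
  .and (.not hf.isTuple) hf.bits.isBinary

/-! ### Dependencies -/

/-- Whether an element is a pair of sets. -/
noncomputable def Elem.isDep (d : Elem) : Bool :=
  decide (d = .tuple [d.child 0, d.child 1]) && d.isSets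

theorem PT.isDep {f : α → Elem} (hf : PT M f) : PT M fun a => (f a).isDep :=
  .and (.decEq hf (.tuple (.cons (hf.child 0) (.singleton (hf.child 1))))) hf.isSets

/-- The two sets of a dependency. -/
noncomputable def Elem.depOf (d : Elem) : Finset Elem × Finset Elem :=
  ((d.child 0).children.toFinset, (d.child 1).children.toFinset)

theorem listsSets_pair_iff {t : Elem} {d : Finset Elem × Finset Elem} :
    ListsSets t [d.1, d.2] ↔ t.isDep = true ∧ d = t.depOf := by
  rw [Elem.isDep, Bool.and_eq_true, decide_eq_true_iff]
  constructor
  · rintro ⟨l, rfl, h⟩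
    have h' := listsSets_iff.1 ⟨l, rfl, h⟩
    match l, h.length_eq with
    | [a, b], _ =>
      refine ⟨⟨rfl, h'.1⟩, Prod.ext ?_ ?_⟩
      · exact (List.cons.inj h'.2).1
      · exact (List.cons.inj (List.cons.inj h'.2).2).1
  · rintro ⟨⟨h₁, h₂⟩, rfl⟩
    refine listsSets_iff.2 ⟨h₂, ?_⟩
    rw [h₁]
    rfl

theorem forall₂_listsSets_pair_iff {l : List Elem} {ds : List (Finset Elem × Finset Elem)} :
    List.Forall₂ (fun t d => ListsSets t [d.1, d.2]) l ds ↔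
      (∀ t ∈ l, t.isDep = true) ∧ ds = l.map Elem.depOf := by
  simp only [listsSets_pair_iff]
  induction l generalizing ds with
  | nil => simp
  | cons t l ih =>
    simp only [List.forall₂_cons_left_iff, ih, List.mem_cons,
      forall_eq_or_imp, List.map_cons]
    constructor
    · rintro ⟨A, As, ⟨h₁, rfl⟩, ⟨h₂, rfl⟩, rfl⟩
      exact ⟨⟨h₁, h₂⟩, rfl⟩
    · rintro ⟨⟨h₁, h₂⟩, rfl⟩
      exact ⟨_, _, ⟨h₁, rfl⟩, ⟨h₂, rfl⟩, rfl⟩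

/-- Words correspond to choices, `bit true` for the first set and any other symbol for the second,
where missing symbols count as blanks. Thus every word selects a scenario. -/
theorem forall₂_depOf_iff {l : List Elem} {Es : List (Finset Elem)} :
    List.Forall₂ (fun E d => E = d.1 ∨ E = d.2) Es (l.map Elem.depOf) ↔
      ∃ w, Es = (select (fun d => [(d.child 0).children]) (fun d => [(d.child 1).children]) w
        l).map List.toFinset := by
  induction l generalizing Es with
  | nil => simp [select]
  | cons d l ih =>
    rw [List.map_cons, List.forall₂_cons_right_iff]
    constructor
    · rintro ⟨E, Es, h, hEs, rfl⟩
      obtain ⟨w, rfl⟩ := ih.1 hEs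
      rcases h with rfl | rfl
      · exact ⟨.bit true :: w, rfl⟩
      · exact ⟨.bit false :: w, rfl⟩
    · rintro ⟨w, rfl⟩
      rw [select, List.map_append]
      cases decide (w.headD .blank = .bit true) with
      | true => exact ⟨_, _, .inl rfl, ih.2 ⟨_, rfl⟩, rfl⟩
      | false => exact ⟨_, _, .inr rfl, ih.2 ⟨_, rfl⟩, rfl⟩

/-- A sublist is given by one keep-or-skip decision per entry; the number of kept entries is checked
separately. -/
theorem sublist_children_iff {l : List Elem} {Es : List (Finset Elem)} :
    Es.Sublist (l.map fun d => d.children.toFinset) ↔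
      ∃ w, Es = (select (fun d => [d.children]) (fun _ => []) w l).map List.toFinset := by
  induction l generalizing Es with
  | nil => simp [select]
  | cons d l ih =>
    rw [List.map_cons, List.sublist_cons_iff]
    constructor
    · rintro (h | ⟨Es, rfl, h⟩)
      · obtain ⟨w, rfl⟩ := ih.1 h
        exact ⟨.bit false :: w, rfl⟩
      · obtain ⟨w, rfl⟩ := ih.1 h
        exact ⟨.bit true :: w, rfl⟩
    · rintro ⟨w, rfl⟩
      rw [select, List.map_append]
      cases decide (w.headD .blank = .bit true) with
      | true => exact .inr ⟨_, rfl, ih.2 ⟨_, rfl⟩⟩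
      | false => exact .inl (ih.2 ⟨_, rfl⟩)

/-! ### `xor`-dependencies -/

/-- The encoding of scenarios by `xor`-dependencies. -/
noncomputable def xorFormat : Format where
  shape e := decide (e = .tuple [e.child 0, e.child 1, e.child 2, e.child 3, e.child 4]) &&
    ((e.child 3).isTuple && ((e.child 3).children.all Elem.isDep && (e.child 4).isNat))
  uncertain e := (e.child 3).children.flatMap fun d => [(d.child 0).children, (d.child 1).children]
  selected e w := select (fun d => [(d.child 0).children]) (fun d => [(d.child 1).children]) w
    (e.child 3).children
  -- Any choice between the two sets of each dependency is a scenario.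
  allowed _ _ := true
  bound e := (e.child 4).bits
  shape_pt _ := by
    refine .and (.decEq .self (.tuple (.cons (.child 0 .self) (.cons (.child 1 .self)
      (.cons (.child 2 .self) (.cons (.child 3 .self) (.singleton (.child 4 .self))))))))
      (.and (.isTuple (.child 3 .self)) (.and ?_ (.isNat (.child 4 .self))))
    exact (PT.children (.child 3 .self)).all (g := fun _ d => d.isDep) (.isDep (.snd .self))
  uncertain_pt _ := (PT.children (.child 3 .self)).flatMap
    (g := fun _ d => [(d.child 0).children, (d.child 1).children])
    (.cons (.children (.child 0 (.snd .self))) (.singleton (.children (.child 1 (.snd .self)))))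
  selected_pt _ := .select (.singleton (.children (.child 0 .self)))
    (.singleton (.children (.child 1 .self))) (.snd .self) (.children (.child 3 (.fst .self)))
  allowed_pt _ := .const true
  bound_pt _ := .bits (.child 4 .self)
  selected_short e w := exists_select_short _ _ 3 e w

/-- The input that is described by an element. -/
noncomputable def Elem.xorInput (e : Elem) : XorInput where
  ground := (e.child 0).relOf
  base := (e.child 1).children.toFinset
  fixed := (e.child 2).children.toFinset
  deps := (e.child 3).children.map Elem.depOf
  kappa := bitsVal (e.child 4).bits

theorem XorInput.encoded_iff {w : List Γ'} {X : XorInput} : X.Encoded w ↔ ∃ e : Elem,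
    w = e.encode ∧ xorFormat.shape e = true ∧ (e.child 0).isRel = true ∧
      (e.child 1).isTuple = true ∧ (e.child 2).isTuple = true ∧ X = e.xorInput := by
  simp only [xorFormat, Bool.and_eq_true, decide_eq_true_iff, List.all_eq_true]
  constructor
  · rintro ⟨g, b, f, l, rfl, hg, hb, hf, hl⟩
    obtain ⟨R, A, E, D, κ⟩ := X
    obtain ⟨h₁, rfl⟩ := describes_iff.1 hg
    obtain ⟨h₂, rfl⟩ := listsSet_iff.1 hb
    obtain ⟨h₃, rfl⟩ := listsSet_iff.1 hf
    obtain ⟨h₄, rfl⟩ := forall₂_listsSets_pair_iff.1 hl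
    obtain ⟨h₅, h₆⟩ := Elem.eq_ofNat_iff.1 (rfl : Elem.ofNat κ = _)
    refine ⟨_, rfl, ⟨rfl, rfl, h₄, h₅⟩, h₁, h₂, h₃, ?_⟩
    exact congrArg (XorInput.mk _ _ _ _) h₆
  · rintro ⟨e, rfl, ⟨h, h₀, h₄, h₅⟩, h₁, h₂, h₃, rfl⟩
    refine ⟨e.child 0, e.child 1, e.child 2, (e.child 3).children, ?_, describes_iff.2 ⟨h₁, rfl⟩,
      listsSet_iff.2 ⟨h₂, rfl⟩, listsSet_iff.2 ⟨h₃, rfl⟩, forall₂_listsSets_pair_iff.2 ⟨h₄, rfl⟩⟩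
    rw [← Elem.isTuple_iff.1 h₀, Elem.xorInput, ← Elem.eq_ofNat_iff.2 ⟨h₅, rfl⟩, ← h]

theorem Elem.uncertain_xorInput (e : Elem) :
    e.xorInput.uncertain = (xorFormat.uncertain e).map List.toFinset := by
  simp only [XorInput.uncertain, Elem.xorInput, xorFormat, List.flatMap_map, List.map_flatMap]
  rfl

theorem Elem.scenarios_xorInput (m : Mode) (e : Elem) :
    e.xorInput.scenarios m = xorFormat.scenarios m e := by
  ext A
  constructor
  · rintro ⟨Es, hEs, rfl⟩
    obtain ⟨w, rfl⟩ := forall₂_depOf_iff.1 hEs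
    refine ⟨w, rfl, ?_⟩
    rw [Format.toFinset_active, Elem.uncertain_xorInput]
    rfl
  · rintro ⟨w, -, rfl⟩
    refine ⟨_, forall₂_depOf_iff.2 ⟨w, rfl⟩, ?_⟩
    rw [Format.toFinset_active, Elem.uncertain_xorInput]
    rfl

theorem CombProblem.xorLanguage_eq (P : CombProblem) (m : Mode) :
    P.xorLanguage m = xorFormat.language P m := by
  ext w
  simp only [CombProblem.xorLanguage, Format.language, Set.mem_ofPred_eq, XorInput.encoded_iff,
    Format.wellFormed_iff]
  constructor
  · rintro ⟨_, ⟨e, rfl, h₁, h₂, h₃, h₄, rfl⟩, h₅, h₆⟩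
    rw [XorInput.WellFormed, Elem.uncertain_xorInput] at h₅
    rw [Elem.scenarios_xorInput] at h₆
    exact ⟨e, rfl, ⟨h₁, h₂, h₃, h₄, h₅⟩, h₆⟩
  · rintro ⟨e, rfl, ⟨h₁, h₂, h₃, h₄, h₅⟩, h₆⟩
    refine ⟨_, ⟨e, rfl, h₁, h₂, h₃, h₄, rfl⟩, ?_, ?_⟩
    · rw [XorInput.WellFormed, Elem.uncertain_xorInput]
      exact h₅
    · rw [Elem.scenarios_xorInput]
      exact h₆

/-! ### `Γ`-set scenarios -/

/-- The encoding of `Γ`-set scenarios. -/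
noncomputable def gammaFormat : Format where
  shape e := decide (e = .tuple [e.child 0, e.child 1, e.child 2, e.child 3, e.child 4, e.child 5])
    && ((e.child 3).isSets && ((e.child 4).isNat && (e.child 5).isNat))
  uncertain e := (e.child 3).children.map Elem.children
  selected e w := select (fun d => [d.children]) (fun _ => []) w (e.child 3).children
  -- The limit `Γ` counts the selected list entries, so a selection is tested after it has been
  -- read.
  allowed e S := lengthLe (S.map fun _ => true) (e.child 4).bits
  bound e := (e.child 5).bits
  shape_pt _ := .and (.decEq .self (.tuple (.cons (.child 0 .self) (.cons (.child 1 .self)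
      (.cons (.child 2 .self) (.cons (.child 3 .self) (.cons (.child 4 .self)
      (.singleton (.child 5 .self)))))))))
      (.and (.isSets (.child 3 .self)) (.and (.isNat (.child 4 .self)) (.isNat (.child 5 .self))))
  uncertain_pt _ := (PT.children (.child 3 .self)).map (g := fun _ d => d.children)
    (.children (.snd .self))
  selected_pt _ := .select (.singleton (.children .self)) (.const []) (.snd .self)
    (.children (.child 3 (.fst .self)))
  allowed_pt _ := .lengthLe (PT.map (f := fun p : Elem × List (List Elem) => p.2)
    (g := fun _ _ => true) (.snd .self) (.const true)) (.bits (.child 4 (.fst .self)))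
  bound_pt _ := .bits (.child 5 .self)
  selected_short e w := exists_select_short _ _ 3 e w

/-- The input that is described by an element. -/
noncomputable def Elem.gammaInput (e : Elem) : GammaInput where
  ground := (e.child 0).relOf
  base := (e.child 1).children.toFinset
  fixed := (e.child 2).children.toFinset
  uncertain := (e.child 3).setsOf
  gamma := bitsVal (e.child 4).bits
  kappa := bitsVal (e.child 5).bits

theorem GammaInput.encoded_iff {w : List Γ'} {X : GammaInput} : X.Encoded w ↔ ∃ e : Elem,
    w = e.encode ∧ gammaFormat.shape e = true ∧ (e.child 0).isRel = true ∧
      (e.child 1).isTuple = true ∧ (e.child 2).isTuple = true ∧ X = e.gammaInput := by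
  simp only [gammaFormat, Bool.and_eq_true, decide_eq_true_iff]
  constructor
  · rintro ⟨g, b, f, u, rfl, hg, hb, hf, hu⟩
    obtain ⟨R, A, E, D, n, κ⟩ := X
    obtain ⟨h₁, rfl⟩ := describes_iff.1 hg
    obtain ⟨h₂, rfl⟩ := listsSet_iff.1 hb
    obtain ⟨h₃, rfl⟩ := listsSet_iff.1 hf
    obtain ⟨h₄, rfl⟩ := listsSets_iff.1 hu
    obtain ⟨h₅, h₆⟩ := Elem.eq_ofNat_iff.1 (rfl : Elem.ofNat n = _)
    obtain ⟨h₇, h₈⟩ := Elem.eq_ofNat_iff.1 (rfl : Elem.ofNat κ = _)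
    refine ⟨_, rfl, ⟨rfl, h₄, h₅, h₇⟩, h₁, h₂, h₃, ?_⟩
    exact congrArg₂ (GammaInput.mk _ _ _ _) h₆ h₈
  · rintro ⟨e, rfl, ⟨h, h₄, h₅, h₆⟩, h₁, h₂, h₃, rfl⟩
    refine ⟨e.child 0, e.child 1, e.child 2, e.child 3, ?_, describes_iff.2 ⟨h₁, rfl⟩,
      listsSet_iff.2 ⟨h₂, rfl⟩, listsSet_iff.2 ⟨h₃, rfl⟩, listsSets_iff.2 ⟨h₄, rfl⟩⟩
    rw [Elem.gammaInput, ← Elem.eq_ofNat_iff.2 ⟨h₅, rfl⟩, ← Elem.eq_ofNat_iff.2 ⟨h₆, rfl⟩, ← h]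

theorem Elem.uncertain_gammaInput (e : Elem) :
    e.gammaInput.uncertain = (gammaFormat.uncertain e).map List.toFinset := by
  simp only [Elem.gammaInput, gammaFormat, Elem.setsOf, List.map_map]
  rfl

theorem Elem.scenarios_gammaInput (m : Mode) (e : Elem) :
    e.gammaInput.scenarios m = gammaFormat.scenarios m e := by
  have hallow (w : List Γ') : gammaFormat.allowed e (gammaFormat.selected e w) = true ↔
      ((gammaFormat.selected e w).map List.toFinset).length ≤ e.gammaInput.gamma := by
    simp only [gammaFormat, lengthLe_iff, List.length_map, Elem.gammaInput]
  ext A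
  constructor
  · rintro ⟨Es, hEs, hle, rfl⟩
    obtain ⟨w, rfl⟩ := sublist_children_iff.1 hEs
    refine ⟨w, (hallow w).2 hle, ?_⟩
    rw [Format.toFinset_active, Elem.uncertain_gammaInput]
    rfl
  · rintro ⟨w, ha, rfl⟩
    refine ⟨_, sublist_children_iff.2 ⟨w, rfl⟩, (hallow w).1 ha, ?_⟩
    rw [Format.toFinset_active, Elem.uncertain_gammaInput]
    rfl

theorem CombProblem.gammaLanguage_eq (P : CombProblem) (m : Mode) :
    P.gammaLanguage m = gammaFormat.language P m := by
  ext w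
  simp only [CombProblem.gammaLanguage, Format.language, Set.mem_ofPred_eq, GammaInput.encoded_iff,
    Format.wellFormed_iff]
  constructor
  · rintro ⟨_, ⟨e, rfl, h₁, h₂, h₃, h₄, rfl⟩, h₅, h₆⟩
    rw [GammaInput.WellFormed, Elem.uncertain_gammaInput] at h₅
    rw [Elem.scenarios_gammaInput] at h₆
    exact ⟨e, rfl, ⟨h₁, h₂, h₃, h₄, h₅⟩, h₆⟩
  · rintro ⟨e, rfl, ⟨h₁, h₂, h₃, h₄, h₅⟩, h₆⟩
    refine ⟨_, ⟨e, rfl, h₁, h₂, h₃, h₄, rfl⟩, ?_, ?_⟩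
    · rw [GammaInput.WellFormed, Elem.uncertain_gammaInput]
      exact h₅
    · rw [Elem.scenarios_gammaInput]
      exact h₆

end HDRR

theorem mainTheorem7 (P : HDRR.CombProblem) (hP : P.InNP) (m : HDRR.Mode) :
    HDRR.InSigmaP3 (P.xorLanguage m) ∧ HDRR.InSigmaP3 (P.gammaLanguage m) := by
  rw [P.xorLanguage_eq, P.gammaLanguage_eq]
  exact ⟨HDRR.xorFormat.inSigmaP3 hP m, HDRR.gammaFormat.inSigmaP3 hP m⟩
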